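/- Conventions. $\lg$ is the base-2 logarithm. A $k$-CNF formula is a conjunction of distinct clauses, each a disjunction of at most $k$ literals; $\#k$-SAT is the problem of computing, for a $k$-CNF formula $F$ in $n$ variables, the number $\mathrm{SAT}(F)$ of its satisfying assignments. Running times refer to randomised algorithms on the word RAM with words of logarithmic length (a constant multiple of the logarithm of input size plus running time), and are worst-case bounds over inputs and coin tosses. For positive integers $k,s$ let $\Pi_{k,s}$ be the following problem. Given a formula of the form $F(\mathbf x)\wedge(A\mathbf x=\mathbf b)$ in $n$ variables, where $F$ is a $k$-CNF formula, $A$ is an $m\times n$ matrix over $\mathrm{GF}(2)$ with $0\le m\le n$ and at most $s$ nonzero entries in every row, and $\mathbf b\in\mathrm{GF}(2)^m$, decide whether it is satisfiable. The growth rate $\pi_{k,s}$ is the infimum of all $\beta>0$ such that $\Pi_{k,s}$ has a randomised algorithm that outputs the correct answer with probability at least $2/3$ and runs in time $O(n^c\,2^{\beta n})$ for some constant $c$. A randomised approximation scheme for a function $f$ is a randomised algorithm that, given an instance $x$ and a rational $\epsilon$ with $0<\epsilon<1$, outputs a rational number $z$ with $\mathbb P\big((1-\epsilon)f(x)\le z\le(1+\epsilon)f(x)\big)\ge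 2/3$. Theorem. Let $k\ge 2$ be an integer, let $0<\delta<1$ be real, and let $s$ be a positive integer with $s\ge 120\,\lg(6/\delta)^2/\delta$, where $\lg(6/\delta)^2=(\lg(6/\delta))^2$. Then there is a randomised approximation scheme for $\#k$-SAT which, given a $k$-CNF formula in $n$ variables and an error tolerance $\epsilon$, runs in time $\epsilon^{-2}\cdot O\big(2^{(\pi_{k,s}+\delta)n}\big)$, where the constant implied by $O$ depends only on $k$, $s$ and $\delta$. -/

import Mathlib

/-! ### A randomised word RAM

A machine has words of `w` bits, registers, and arrays of words indexed by words; a program is a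
fixed finite text, so it mentions only a constant number of registers and arrays.  Control flow is
structured (conditionals and while-loops), which costs at most a constant factor compared with jumps.
Every instruction, including every test of a conditional or a loop, takes unit time. -/

namespace WordRAM

/-- The word operations (unsigned arithmetic modulo `2 ^ w`, bitwise operations, shifts and
comparisons). -/
inductive BinOp where
  | add | sub | mul | div | and | or | xor | shl | shr | eq | lt

/-- The value of an operation on two words; comparisons return the word `1` or `0`, and a quotient
by `0` is `0`. -/
def BinOp.eval {w : ℕ} : BinOp → BitVec w → BitVec w → BitVec w
  | .add, x, y => x + y
  | .sub, x, y => x - y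
  | .mul, x, y => x * y
  | .div, x, y => x / y
  | .and, x, y => x &&& y
  | .or, x, y => x ||| y
  | .xor, x, y => x ^^^ y
  | .shl, x, y => x <<< y
  | .shr, x, y => x >>> y
  | .eq, x, y => if x = y then 1 else 0
  | .lt, x, y => if x.toNat < y.toNat then 1 else 0

/-- Programs. Registers and arrays are named by natural numbers. -/
inductive Prog where
  /-- do nothing -/
  | skip : Prog
  /-- `const r v`: put the constant `v` into register `r` -/
  | const (r v : ℕ) : Prog
  /-- `op o r a b`: put the result of `o` on the registers `a`, `b` into register `r` -/
  | op (o : BinOp) (r a b : ℕ) : Prog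
  /-- `load r A a`: read array `A` at the index in register `a` into register `r` -/
  | load (r A a : ℕ) : Prog
  /-- `store A a r`: write register `r` into array `A` at the index in register `a` -/
  | store (A a r : ℕ) : Prog
  /-- `flip r`: toss a fair coin and put the outcome, `0` or `1`, into register `r` -/
  | flip (r : ℕ) : Prog
  /-- sequential composition -/
  | seq (p q : Prog) : Prog
  /-- `ite r p q`: if register `r` is nonzero then `p` else `q` -/
  | ite (r : ℕ) (p q : Prog) : Prog
  /-- `loop r p`: while register `r` is nonzero, do `p` -/
  | loop (r : ℕ) (p : Prog) : Prog

/-- The contents of all registers and arrays. -/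
structure State (w : ℕ) where
  reg : ℕ → BitVec w
  mem : ℕ → BitVec w → BitVec w

/-- Assignment to a register. -/
def State.setReg {w : ℕ} (σ : State w) (r : ℕ) (v : BitVec w) : State w :=
  { σ with reg := Function.update σ.reg r v }

/-- Assignment to an array cell. -/
def State.setMem {w : ℕ} (σ : State w) (A : ℕ) (i v : BitVec w) : State w :=
  { σ with mem := Function.update σ.mem A (Function.update (σ.mem A) i v) }

/-- A configuration: the stack of program parts that are still to be executed, and the state.
It is halted when the stack is empty. -/
abbrev Cfg (w : ℕ) : Type := List Prog × State w

/-- One step of the machine, as a probability distribution on the next configuration. -/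
noncomputable def step {w : ℕ} : Cfg w → PMF (Cfg w)
  | ([], σ) => PMF.pure ([], σ)
  | (.skip :: K, σ) => PMF.pure (K, σ)
  | (.const r v :: K, σ) => PMF.pure (K, σ.setReg r (BitVec.ofNat w v))
  | (.op o r a b :: K, σ) => PMF.pure (K, σ.setReg r (o.eval (σ.reg a) (σ.reg b)))
  | (.load r A a :: K, σ) => PMF.pure (K, σ.setReg r (σ.mem A (σ.reg a)))
  | (.store A a r :: K, σ) => PMF.pure (K, σ.setMem A (σ.reg a) (σ.reg r))
  | (.flip r :: K, σ) =>
      (PMF.uniformOfFintype Bool).map fun c => (K, σ.setReg r (if c then 1 else 0))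
  | (.seq p q :: K, σ) => PMF.pure (p :: q :: K, σ)
  | (.ite r p q :: K, σ) => PMF.pure (if σ.reg r ≠ 0 then (p :: K, σ) else (q :: K, σ))
  | (.loop r p :: K, σ) => PMF.pure (if σ.reg r ≠ 0 then (p :: .loop r p :: K, σ) else (K, σ))

/-- The distribution of the configuration after `t` steps. -/
noncomputable def run {w : ℕ} : ℕ → Cfg w → PMF (Cfg w)
  | 0, c => PMF.pure c
  | t + 1, c => (step c).bind (run t)

/-- From the state `σ`, the program `P` halts within `t` steps whatever the coin tosses are, and
with probability at least `2/3` its final state satisfies `good`. -/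
def Succeeds {w : ℕ} (P : Prog) (σ : State w) (t : ℕ) (good : State w → Prop) : Prop :=
  (∀ c ∈ (run t ([P], σ)).support, c.1 = []) ∧
    (2 / 3 : ENNReal) ≤ (run t ([P], σ)).toOuterMeasure {c | good c.2}

/-- An input is a finite sequence of arrays of natural numbers, one word per entry. -/
abbrev Input : Type := List (List ℕ)

/-- The size of an input: the number of array entries plus the sum of all entries. Its logarithm is,
up to constant factors, that of the largest among the lengths and entries of the arrays. -/
def Input.size (I : Input) : ℕ := (I.map fun l => (l.map (· + 1)).sum).sum

/-- `σ` is an initial state for the input `I`: array `i` holds the `i`-th array of `I` and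
register `i` its length. All other registers and cells are uninitialised. -/
def IsInitial {w : ℕ} (I : Input) (σ : State w) : Prop :=
  ∀ (i : ℕ) (l : List ℕ), I[i]? = some l →
    σ.reg i = BitVec.ofNat w l.length ∧
    ∀ (j v : ℕ), l[j]? = some v → σ.mem i (BitVec.ofNat w j) = BitVec.ofNat w v

/-- `P` runs on every input `enc x` in time `T x` and with probability at least `2/3` ends with a
result that is `good` for `x`. Words have logarithmic length: `P` works for every word length `w`
that is at least a constant multiple of the logarithm of input size plus time bound. -/
def RunsInTime {ι : Type} (P : Prog) (enc : ι → Input) (T : ι → ℝ)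
    (good : ι → ∀ w : ℕ, State w → Prop) : Prop :=
  ∃ c : ℕ, ∀ (x : ι) (w : ℕ), c * Real.logb 2 ((enc x).size + T x) ≤ w →
    ∀ σ : State w, IsInitial (enc x) σ →
      ∃ t : ℕ, (t : ℝ) ≤ T x ∧ Succeeds P σ t (good x w)

/-- `P` is a randomised algorithm for the decision problem `L` with running time `T` and success
probability at least `2/3`; the answer is `1` or `0` in register `0`. -/
def Decides {ι : Type} (P : Prog) (enc : ι → Input) (L : ι → Prop) (T : ι → ℝ) : Prop :=
  RunsInTime P enc T fun x _ σ => (L x → σ.reg 0 = 1) ∧ (¬ L x → σ.reg 0 = 0)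

/-- An instance together with a rational error tolerance in `(0, 1)`. -/
structure WithTolerance (ι : Type) where
  inst : ι
  ε : ℚ
  pos : 0 < ε
  lt_one : ε < 1

/-- The tolerance is given by the binary digits of its numerator and of its denominator. -/
def WithTolerance.encode {ι : Type} (enc : ι → Input) (x : WithTolerance ι) : Input :=
  enc x.inst ++ [Nat.digits 2 x.ε.num.toNat, Nat.digits 2 x.ε.den]

/-- `P` is a randomised approximation scheme for `f` with running time `T x ε`; the output is the
rational number with numerator in register `0` and nonzero denominator in register `1`. -/
def IsApproxScheme {ι : Type} (P : Prog) (enc : ι → Input) (f : ι → ℕ) (T : ι → ℚ → ℝ) : Prop :=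
  RunsInTime P (WithTolerance.encode enc) (fun x => T x.inst x.ε) fun x _ σ =>
    (σ.reg 1).toNat ≠ 0 ∧
    (1 - x.ε) * (f x.inst : ℚ) ≤ ((σ.reg 0).toNat : ℚ) / ((σ.reg 1).toNat : ℚ) ∧
    ((σ.reg 0).toNat : ℚ) / ((σ.reg 1).toNat : ℚ) ≤ (1 + x.ε) * (f x.inst : ℚ)

end WordRAM

/-! ### CNF formulae and sparse linear systems -/

/-- A `k`-CNF formula with `n` variables: a list, without repetitions, of clauses of at most `k`
literals. The literal `(i, a)` says that the `i`-th variable has the value `a`. -/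
structure KCNF (k n : ℕ) where
  clauses : List (List (Fin n × ZMod 2))
  width : ∀ C ∈ clauses, C.length ≤ k
  nodup : clauses.Nodup

namespace KCNF

/-- The assignment `x` satisfies the formula. -/
def Sat {k n : ℕ} (F : KCNF k n) (x : Fin n → ZMod 2) : Prop :=
  ∀ C ∈ F.clauses, ∃ l ∈ C, x l.1 = l.2

/-- The number of satisfying assignments. -/
noncomputable def numSat {k n : ℕ} (F : KCNF k n) : ℕ := Nat.card {x : Fin n → ZMod 2 // F.Sat x}

/-- The clauses one after another, each as its length followed by its literals. -/
def code {k n : ℕ} (F : KCNF k n) : List ℕ :=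
  (F.clauses.map fun C => C.length :: C.map fun l => 2 * (l.1 : ℕ) + l.2.val).flatten

end KCNF

/-- Instances of #`k`-SAT. -/
structure CNFInstance (k : ℕ) where
  n : ℕ
  F : KCNF k n

/-- The input for a `k`-CNF formula: the number of variables, and the clauses. -/
def CNFInstance.encode {k : ℕ} (I : CNFInstance k) : WordRAM.Input := [[I.n], I.F.code]

/-- The counting problem #`k`-SAT. -/
noncomputable def CNFInstance.count {k : ℕ} (I : CNFInstance k) : ℕ := I.F.numSat

/-- Instances of the problem `Π_{k,s}`: a `k`-CNF formula in `n` variables and a linear system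
`A x = b` over `GF(2)` with at most `n` equations and at most `s` nonzero entries in each row. -/
structure SparseInstance (k s : ℕ) where
  n : ℕ
  F : KCNF k n
  m : ℕ
  m_le : m ≤ n
  A : Matrix (Fin m) (Fin n) (ZMod 2)
  sparse : ∀ i, (Finset.univ.filter fun j => A i j ≠ 0).card ≤ s
  b : Fin m → ZMod 2

namespace SparseInstance

/-- The formula `F(x) ∧ (A x = b)` is satisfiable. -/
def Satisfiable {k s : ℕ} (I : SparseInstance k s) : Prop :=
  ∃ x : Fin I.n → ZMod 2, I.F.Sat x ∧ I.A.mulVec x = I.b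

/-- The input for an instance: the number of variables, the clauses, the matrix row by row, and
the right-hand side. -/
def encode {k s : ℕ} (I : SparseInstance k s) : WordRAM.Input :=
  [[I.n], I.F.code, (List.ofFn fun i => List.ofFn fun j => (I.A i j).val).flatten,
    List.ofFn fun i => (I.b i).val]

end SparseInstance

/-- The growth rate `π_{k,s}`: the infimum over all `β > 0` such that `Π_{k,s}` has a randomised
algorithm with success probability at least `2/3` and running time `2 ^ (β n)` up to a factor
polynomial in `n`. -/
noncomputable def growthRate (k s : ℕ) : ℝ :=
  sInf {β : ℝ | 0 < β ∧ ∃ (P : WordRAM.Prog) (C : ℝ) (d : ℕ),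
    WordRAM.Decides P SparseInstance.encode
      (fun I : SparseInstance k s => I.Satisfiable)
      (fun I => C * ((I.n : ℝ) + 1) ^ d * 2 ^ (β * I.n))}

/-! The solution set is cut down by random sparse affine subspaces. Let `N` be the number of
solutions. At level `m ≤ n`, draw `m` random equations, each the sum of `s` random unit vectors with
a random right-hand side, and let `Z` be the number of solutions satisfying all of them, so that the
mean is `μ = N / 2 ^ m`. The solutions in such a bucket are found by fixing one variable after
another and asking the algorithm for `Π_{k,s}` whether the current prefix extends; unit clauses keep
the formula `k`-CNF, and a bucket of size `Z` costs at most `1 + 2 n Z` queries (`next_pot`). The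
estimate is the total over `L` independent trials, times `2 ^ m / L`.

Sparse equations are only approximately pairwise independent. Two assignments at distance `d` both
satisfy a random equation with probability `(1 + (1 - 2 d / 2 ^ l) ^ s) / 4`, where `2 ^ l`, between
`2 n` and `4 n`, is the number of positions a random word can name (`sum_rowAgrees_and`). If `d > δ
n / (5 lg (6 / δ))`, the size of `s` makes the power at most `δ / 6` (`far_le`). Each solution has
at most `2 ^ (δ n / 2)` neighbours at smaller distance, by an entropy bound (`card_wt_le`,
`near_le`). Hence the second moment of `Z` is at most `2 ^ (δ n / 2) (μ + μ ^ 2)`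
(`KCNF.sum_bucket_sq`), and when `μ ≥ 1 / 2`, Chebyshev's inequality with `L` of order `n 2 ^ (δ n /
2) / ε ^ 2` bounds the failure probability of a level by `1 / (20 (n + 1))` (`le_trials`,
`KCNF.le_trials_bucket`).

The right level is unknown, so the levels are tried in increasing order, each with a budget of `B =
(4 n + 3) L` search steps, and the first level that completes its trials gives the result. Up to
level `M = ⌈lg N⌉` the mean is at least `1 / 2`, so a level that finishes is likely to be accurate;
at level `M` the mean is at most `1`, so an accurate total is at most `2 L` and fits into the budget
(`ewp_levelP`, `ewp_outerP`, `KCNF.exists_levels`). If `ε` is so small that `2 ^ n` is `O (1 / ε)`,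
level `0`, which has no equations, counts exactly instead. All queries are decided by majority
votes, reliable enough to be all correct with probability at least `9 / 10` (`le_amp`,
`KCNF.prob_bound`).

The running time is polynomial in `n` times `B` times the time of one call. Calls cost `2 ^ (β n)`
with `β < π + δ / 8` up to a polynomial factor, `B` contributes `2 ^ (5 δ n / 8) / ε ^ 2`, and the
polynomials are absorbed in `2 ^ (δ n / 4)`; the clauses being distinct, the input length is
polynomial in `n` (`schemeT_le`, `scheme_time`).

Programs are analysed through lower bounds for the expected value of a function of the final state,
counting unhalted runs as `0` (`wpc`, `ewp`). Taking the constant `1` expresses certain halting,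
taking an indicator expresses success probability, and both compose along the syntax. -/

open scoped ENNReal NNReal

namespace WordRAM

/-! ### Expected values -/

/-- The expected value of `g` under `μ`. -/
noncomputable def pexp {α : Type*} (μ : PMF α) (g : α → ℝ≥0∞) : ℝ≥0∞ := ∑' a, μ a * g a

section pexp
variable {α β : Type*}

theorem pexp_pure (a : α) (g : α → ℝ≥0∞) : pexp (PMF.pure a) g = g a := by
  unfold pexp
  rw [tsum_eq_single a]
  · simp
  · intro b hb
    simp [PMF.pure_apply, hb]

theorem pexp_bind (μ : PMF α) (κ : α → PMF β) (g : β → ℝ≥0∞) :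
    pexp (μ.bind κ) g = pexp μ fun a => pexp (κ a) g := by
  unfold pexp
  simp only [PMF.bind_apply, ← ENNReal.tsum_mul_right, ← ENNReal.tsum_mul_left]
  rw [ENNReal.tsum_comm]
  simp only [mul_assoc]

theorem pexp_map (μ : PMF α) (h : α → β) (g : β → ℝ≥0∞) :
    pexp (μ.map h) g = pexp μ fun a => g (h a) := by
  unfold PMF.map
  rw [pexp_bind]
  simp [pexp_pure]

theorem pexp_mono (μ : PMF α) {g h : α → ℝ≥0∞} (H : ∀ a ∈ μ.support, g a ≤ h a) :
    pexp μ g ≤ pexp μ h := by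
  unfold pexp
  refine ENNReal.tsum_le_tsum fun a => ?_
  by_cases ha : μ a = 0
  · simp [ha]
  · exact mul_le_mul_right (H a ((PMF.mem_support_iff _ _).2 ha)) _

theorem pexp_add (μ : PMF α) (g h : α → ℝ≥0∞) :
    pexp μ (fun a => g a + h a) = pexp μ g + pexp μ h := by
  unfold pexp
  simp only [mul_add, ENNReal.tsum_add]

theorem pexp_const_mul (μ : PMF α) (x : ℝ≥0∞) (g : α → ℝ≥0∞) :
    pexp μ (fun a => x * g a) = x * pexp μ g := by
  unfold pexp
  rw [← ENNReal.tsum_mul_left]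
  simp only [mul_left_comm]

theorem pexp_const (μ : PMF α) (x : ℝ≥0∞) : pexp μ (fun _ => x) = x := by
  unfold pexp
  rw [ENNReal.tsum_mul_right, PMF.tsum_coe, one_mul]

theorem pexp_bool (g : Bool → ℝ≥0∞) :
    pexp (PMF.uniformOfFintype Bool) g = (g true + g false) / 2 := by
  unfold pexp
  rw [tsum_fintype]
  simp [PMF.uniformOfFintype_apply]
  rw [ENNReal.div_eq_inv_mul, mul_add]

end pexp

/-! ### Expected values after a run -/

section wpc
variable {w : ℕ}

/-- The expected value of `f` in the final state of a run that halts within `t` steps (and `0`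
for the runs that do not halt). -/
noncomputable def wpc (t : ℕ) (c : Cfg w) (f : State w → ℝ≥0∞) : ℝ≥0∞ :=
  pexp (run t c) fun c' => if c'.1 = [] then f c'.2 else 0

theorem wpc_zero (c : Cfg w) (f : State w → ℝ≥0∞) :
    wpc 0 c f = if c.1 = [] then f c.2 else 0 := by
  unfold wpc run
  rw [pexp_pure]

theorem wpc_succ (t : ℕ) (c : Cfg w) (f : State w → ℝ≥0∞) :
    wpc (t + 1) c f = pexp (step c) fun c' => wpc t c' f := by
  unfold wpc
  rw [run, pexp_bind]

theorem wpc_nil (t : ℕ) (σ : State w) (f : State w → ℝ≥0∞) : wpc t ([], σ) f = f σ := by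
  induction t with
  | zero => simp [wpc_zero]
  | succ t ih => rw [wpc_succ, step, pexp_pure, ih]

theorem wpc_mono_fun (t : ℕ) (c : Cfg w) {f g : State w → ℝ≥0∞} (h : ∀ σ, f σ ≤ g σ) :
    wpc t c f ≤ wpc t c g := by
  refine pexp_mono _ fun c' _ => ?_
  split_ifs
  · exact h _
  · exact le_rfl

/-- A halted configuration is fixed by `step`, so more time can only add runs that halt. -/
theorem wpc_le_succ (t : ℕ) (c : Cfg w) (f : State w → ℝ≥0∞) : wpc t c f ≤ wpc (t + 1) c f := by
  induction t generalizing c with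
  | zero =>
    obtain ⟨K, σ⟩ := c
    cases K with
    | nil => rw [wpc_nil, wpc_nil]
    | cons p K => simp [wpc_zero]
  | succ t ih =>
    rw [wpc_succ, wpc_succ (t + 1)]
    exact pexp_mono _ fun c' _ => ih c'

theorem wpc_mono_time {t t' : ℕ} (h : t ≤ t') (c : Cfg w) (f : State w → ℝ≥0∞) :
    wpc t c f ≤ wpc t' c f := by
  induction h with
  | refl => exact le_rfl
  | step _ ih => exact ih.trans (wpc_le_succ _ _ _)

/-- Only the head of the stack determines a step; whatever lies below is carried along unchanged. -/
theorem step_append (p : Prog) (S K : List Prog) (σ : State w) :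
    step (p :: S ++ K, σ) = (step (p :: S, σ)).map fun c => (c.1 ++ K, c.2) := by
  cases p <;> simp [step, PMF.pure_map, PMF.map_comp] <;> try rfl
  all_goals split_ifs <;> simp

/-- Only an inequality: a run that empties `S` early idles on the left side, while on the right side
it goes on with `K` and keeps the time that is left. -/
theorem wpc_append (t u : ℕ) (S K : List Prog) (σ : State w) (f : State w → ℝ≥0∞) :
    pexp (run t (S, σ)) (fun c => wpc u (c.1 ++ K, c.2) f) ≤ wpc (t + u) (S ++ K, σ) f := by
  induction t generalizing S σ with
  | zero => simp [run, pexp_pure]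
  | succ t ih =>
    rw [run, pexp_bind]
    cases S with
    | nil =>
      rw [step, pexp_pure]
      exact (ih [] σ).trans (wpc_mono_time (by omega) _ _)
    | cons p S =>
      rw [show t + 1 + u = (t + u) + 1 by ring, wpc_succ, step_append, pexp_map]
      exact pexp_mono _ fun c _ => ih c.1 c.2

/-- Running `p` first. -/
theorem wpc_cons (t u : ℕ) (p : Prog) (K : List Prog) (σ : State w) (f : State w → ℝ≥0∞) :
    wpc t ([p], σ) (fun σ' => wpc u (K, σ') f) ≤ wpc (t + u) (p :: K, σ) f := by
  refine le_trans ?_ (wpc_append t u [p] K σ f)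
  refine pexp_mono _ fun c _ => ?_
  split_ifs with h
  · rw [h, List.nil_append]
  · exact zero_le

theorem wpc_seq (t u : ℕ) (p q : Prog) (σ : State w) (f : State w → ℝ≥0∞) :
    wpc t ([p], σ) (fun σ' => wpc u ([q], σ') f) ≤ wpc (t + u + 1) ([p.seq q], σ) f := by
  rw [wpc_succ, step, pexp_pure]
  exact wpc_cons t u p [q] σ f

theorem wpc_add (t : ℕ) (c : Cfg w) (f g : State w → ℝ≥0∞) :
    wpc t c (fun σ => f σ + g σ) = wpc t c f + wpc t c g := by
  unfold wpc
  rw [← pexp_add]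
  congr 1
  ext c'
  split_ifs <;> simp

theorem wpc_const_mul (t : ℕ) (c : Cfg w) (x : ℝ≥0∞) (f : State w → ℝ≥0∞) :
    wpc t c (fun σ => x * f σ) = x * wpc t c f := by
  unfold wpc
  rw [← pexp_const_mul]
  congr 1
  ext c'
  split_ifs <;> simp

theorem wpc_skip (σ : State w) (f : State w → ℝ≥0∞) : wpc 1 ([.skip], σ) f = f σ := by
  rw [wpc_succ, step, pexp_pure, wpc_nil]

theorem wpc_const (r v : ℕ) (σ : State w) (f : State w → ℝ≥0∞) :
    wpc 1 ([.const r v], σ) f = f (σ.setReg r (BitVec.ofNat w v)) := by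
  rw [wpc_succ, step, pexp_pure, wpc_nil]

theorem wpc_op (o : BinOp) (r a b : ℕ) (σ : State w) (f : State w → ℝ≥0∞) :
    wpc 1 ([.op o r a b], σ) f = f (σ.setReg r (o.eval (σ.reg a) (σ.reg b))) := by
  rw [wpc_succ, step, pexp_pure, wpc_nil]

theorem wpc_load (r A a : ℕ) (σ : State w) (f : State w → ℝ≥0∞) :
    wpc 1 ([.load r A a], σ) f = f (σ.setReg r (σ.mem A (σ.reg a))) := by
  rw [wpc_succ, step, pexp_pure, wpc_nil]

theorem wpc_store (A a r : ℕ) (σ : State w) (f : State w → ℝ≥0∞) :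
    wpc 1 ([.store A a r], σ) f = f (σ.setMem A (σ.reg a) (σ.reg r)) := by
  rw [wpc_succ, step, pexp_pure, wpc_nil]

theorem wpc_flip (r : ℕ) (σ : State w) (f : State w → ℝ≥0∞) :
    wpc 1 ([.flip r], σ) f = (f (σ.setReg r 1) + f (σ.setReg r 0)) / 2 := by
  rw [wpc_succ, step, pexp_map, pexp_bool]
  simp [wpc_nil]

theorem wpc_ite (t r : ℕ) (p q : Prog) (σ : State w) (f : State w → ℝ≥0∞) :
    wpc (t + 1) ([.ite r p q], σ) f =
      if σ.reg r ≠ 0 then wpc t ([p], σ) f else wpc t ([q], σ) f := by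
  rw [wpc_succ, step, pexp_pure]
  split_ifs <;> rfl

/-- A program halts with certainty if the constant `1` has expected value `1`. -/
theorem halted_of_wpc_one {t : ℕ} {c : Cfg w} (h : 1 ≤ wpc t c fun _ => 1) :
    ∀ c' ∈ (run t c).support, c'.1 = [] := by
  intro c' hc'
  by_contra hne
  have h1 : wpc t c (fun _ => 1) + run t c c' ≤ 1 := by
    have : run t c c' ≤ pexp (run t c) fun d => if d.1 = [] then 0 else 1 := by
      refine le_trans ?_ (ENNReal.le_tsum c')
      simp [hne]
    calc wpc t c (fun _ => 1) + run t c c'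
        ≤ pexp (run t c) (fun d => if d.1 = [] then 1 else 0) +
          pexp (run t c) (fun d => if d.1 = [] then 0 else 1) := add_le_add le_rfl this
      _ = pexp (run t c) (fun _ => 1) := by
          rw [← pexp_add]
          congr 1
          ext d
          split_ifs <;> simp
      _ = 1 := pexp_const _ _
  have h2 : run t c c' ≠ 0 := (PMF.mem_support_iff _ _).1 hc'
  have h3 : (1 : ℝ≥0∞) + run t c c' ≤ 1 + 0 := by
    rw [add_zero]
    exact (add_le_add h le_rfl).trans h1
  have := ENNReal.le_of_add_le_add_left ENNReal.one_ne_top h3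
  exact h2 (le_antisymm this zero_le)

-- Both halves of `Succeeds` follow from expectations: those of the constant `1` and of the
-- indicator of `good`.
open Classical in
theorem succeeds_of_wpc {P : Prog} {σ : State w} {t : ℕ} {good : State w → Prop}
    (h1 : 1 ≤ wpc t ([P], σ) fun _ => 1)
    (h2 : 2 / 3 ≤ wpc t ([P], σ) fun σ' => if good σ' then 1 else 0) :
    Succeeds P σ t good := by
  refine ⟨halted_of_wpc_one h1, h2.trans ?_⟩
  rw [PMF.toOuterMeasure_apply]
  refine ENNReal.tsum_le_tsum fun c => ?_
  by_cases hg : good c.2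
  · simp only [Set.indicator, Set.mem_ofPred_eq, hg, if_true]
    split_ifs <;> simp
  · simp [hg]

-- The converse direction, for calling a given algorithm. The predicate `any` records what holds on
-- every reachable configuration, such as that the caller's memory is untouched.
open Classical in
theorem wpc_of_succeeds {P : Prog} {σ : State w} {t : ℕ} {good : State w → Prop}
    (h : Succeeds P σ t good) (any : State w → Prop)
    (ha : ∀ c ∈ (run t ([P], σ)).support, any c.2) :
    (1 ≤ wpc t ([P], σ) fun σ' => if any σ' then 1 else 0) ∧
      2 / 3 ≤ wpc t ([P], σ) fun σ' => if good σ' ∧ any σ' then 1 else 0 := by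
  constructor
  · refine (pexp_const (run t ([P], σ)) 1).ge.trans ?_
    refine pexp_mono _ fun c hc => ?_
    simp [h.1 c hc, ha c hc]
  · refine h.2.trans ?_
    rw [PMF.toOuterMeasure_apply]
    refine le_trans (ENNReal.tsum_le_tsum fun c => ?_) (pexp_mono _
      (g := fun c => if good c.2 then 1 else 0) fun c hc => ?_)
    · by_cases hg : good c.2 <;> simp [Set.indicator, hg]
    · simp [h.1 c hc, ha c hc]

end wpc

/-! ### Shifting the names of registers and arrays -/

/-- The program `P` with all names of registers and arrays increased by `d`. -/
def Prog.shift (d : ℕ) : Prog → Prog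
  | .skip => .skip
  | .const r v => .const (r + d) v
  | .op o r a b => .op o (r + d) (a + d) (b + d)
  | .load r A a => .load (r + d) (A + d) (a + d)
  | .store A a r => .store (A + d) (a + d) (r + d)
  | .flip r => .flip (r + d)
  | .seq p q => .seq (p.shift d) (q.shift d)
  | .ite r p q => .ite (r + d) (p.shift d) (q.shift d)
  | .loop r p => .loop (r + d) (p.shift d)

section shift
variable {w : ℕ} (d : ℕ)

/-- The part of a state that a shifted program sees. -/
def State.unshift (σ : State w) : State w :=
  ⟨fun r => σ.reg (r + d), fun A => σ.mem (A + d)⟩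

theorem State.unshift_setReg (σ : State w) (r : ℕ) (v : BitVec w) :
    (σ.setReg (r + d) v).unshift d = (σ.unshift d).setReg r v := by
  simp only [State.unshift, State.setReg, State.mk.injEq, and_true]
  ext1 r'
  by_cases h : r' = r <;> simp [Function.update, h]

theorem State.unshift_setMem (σ : State w) (A : ℕ) (i v : BitVec w) :
    (σ.setMem (A + d) i v).unshift d = (σ.unshift d).setMem A i v := by
  simp only [State.unshift, State.setMem, State.mk.injEq, true_and]
  ext1 A'
  by_cases h : A' = A
  · subst h; simp
  · simp [Function.update, h]

/-- The shifted program on `σ` and the original one on `σ.unshift d` proceed in lockstep. -/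
theorem wpc_shift (t : ℕ) (K : List Prog) (σ : State w) (f : State w → ℝ≥0∞) :
    wpc t (K.map (Prog.shift d), σ) (fun σ' => f (σ'.unshift d)) = wpc t (K, σ.unshift d) f := by
  induction t generalizing K σ with
  | zero => cases K <;> simp [wpc_zero]
  | succ t ih =>
    cases K with
    | nil => rw [List.map_nil, wpc_nil, wpc_nil]
    | cons p K =>
      rw [wpc_succ, wpc_succ, List.map_cons]
      cases p with
      | flip r =>
        simp only [Prog.shift, step, pexp_map, pexp_bool]
        rw [ih, ih, State.unshift_setReg, State.unshift_setReg]
      | ite r p q =>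
        simp only [Prog.shift, step, pexp_pure]
        have : (σ.unshift d).reg r = σ.reg (r + d) := rfl
        rw [this]
        split_ifs
        · exact ih (p :: K) σ
        · exact ih (q :: K) σ
      | loop r p =>
        simp only [Prog.shift, step, pexp_pure]
        have : (σ.unshift d).reg r = σ.reg (r + d) := rfl
        rw [this]
        split_ifs
        · exact ih (p :: .loop r p :: K) σ
        · exact ih K σ
      | seq p q => simp only [Prog.shift, step, pexp_pure]; exact ih (p :: q :: K) σ
      | skip => simp only [Prog.shift, step, pexp_pure]; exact ih K σ
      | store A a r =>
        simp only [Prog.shift, step, pexp_pure]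
        rw [ih, State.unshift_setMem]; rfl
      | const r v =>
        simp only [Prog.shift, step, pexp_pure]
        rw [ih, State.unshift_setReg]
      | op o r a b =>
        simp only [Prog.shift, step, pexp_pure]
        rw [ih, State.unshift_setReg]; rfl
      | load r A a =>
        simp only [Prog.shift, step, pexp_pure]
        rw [ih, State.unshift_setReg]; rfl

/-- The registers and arrays below `d` agree. -/
def State.AgreeBelow (σ σ' : State w) : Prop :=
  (∀ r < d, σ'.reg r = σ.reg r) ∧ ∀ A < d, σ'.mem A = σ.mem A

theorem State.AgreeBelow.setReg {σ σ' : State w} (h : σ.AgreeBelow d σ') (r : ℕ) (v : BitVec w) :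
    σ.AgreeBelow d (σ'.setReg (r + d) v) := by
  refine ⟨fun r' hr => ?_, h.2⟩
  rw [← h.1 r' hr]
  exact Function.update_of_ne (by omega) _ _

theorem State.AgreeBelow.setMem {σ σ' : State w} (h : σ.AgreeBelow d σ') (A : ℕ)
    (i v : BitVec w) : σ.AgreeBelow d (σ'.setMem (A + d) i v) := by
  refine ⟨h.1, fun A' hA => ?_⟩
  rw [← h.2 A' hA]
  exact Function.update_of_ne (by omega) _ _

/-- Every name that a shifted program writes to is at least `d`. -/
theorem agreeBelow_of_mem_support_run (t : ℕ) (K : List Prog) (σ σ₀ : State w)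
    (h₀ : σ₀.AgreeBelow d σ) :
    ∀ c ∈ (run t (K.map (Prog.shift d), σ)).support, σ₀.AgreeBelow d c.2 := by
  induction t generalizing K σ with
  | zero =>
    intro c hc
    simp only [run, PMF.support_pure, Set.mem_singleton_iff] at hc
    rw [hc]; exact h₀
  | succ t ih =>
    intro c hc
    rw [run, PMF.mem_support_bind_iff] at hc
    obtain ⟨c', hc', hc⟩ := hc
    cases K with
    | nil =>
      simp only [List.map_nil, step, PMF.support_pure, Set.mem_singleton_iff] at hc'
      subst hc'
      exact ih [] σ h₀ c hc
    | cons p K =>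
      rw [List.map_cons] at hc'
      cases p with
      | flip r =>
        simp only [Prog.shift, step, PMF.mem_support_map_iff] at hc'
        obtain ⟨b, -, rfl⟩ := hc'
        exact ih K _ (h₀.setReg d r _) c hc
      | ite r p q =>
        simp only [Prog.shift, step, PMF.support_pure, Set.mem_singleton_iff] at hc'
        subst hc'
        split_ifs at hc
        · exact ih (p :: K) σ h₀ c hc
        · exact ih (q :: K) σ h₀ c hc
      | loop r p =>
        simp only [Prog.shift, step, PMF.support_pure, Set.mem_singleton_iff] at hc'
        subst hc'
        split_ifs at hc
        · exact ih (p :: .loop r p :: K) σ h₀ c hc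
        · exact ih K σ h₀ c hc
      | seq p q =>
        simp only [Prog.shift, step, PMF.support_pure, Set.mem_singleton_iff] at hc'
        subst hc'
        exact ih (p :: q :: K) σ h₀ c hc
      | skip =>
        simp only [Prog.shift, step, PMF.support_pure, Set.mem_singleton_iff] at hc'
        subst hc'
        exact ih K σ h₀ c hc
      | store A a r =>
        simp only [Prog.shift, step, PMF.support_pure, Set.mem_singleton_iff] at hc'
        subst hc'
        exact ih K _ (h₀.setMem d A _ _) c hc
      | const r v =>
        simp only [Prog.shift, step, PMF.support_pure, Set.mem_singleton_iff] at hc'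
        subst hc'
        exact ih K _ (h₀.setReg d r _) c hc
      | op o r a b =>
        simp only [Prog.shift, step, PMF.support_pure, Set.mem_singleton_iff] at hc'
        subst hc'
        exact ih K _ (h₀.setReg d r _) c hc
      | load r A a =>
        simp only [Prog.shift, step, PMF.support_pure, Set.mem_singleton_iff] at hc'
        subst hc'
        exact ih K _ (h₀.setReg d r _) c hc

open Classical in
/-- A shifted program works on the shifted part of the state and leaves the rest alone. -/
theorem wpc_shift_of_succeeds {P : Prog} {σ : State w} {t : ℕ} {good : State w → Prop}
    (h : Succeeds P (σ.unshift d) t good) :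
    (1 ≤ wpc t ([P.shift d], σ) fun σ' => if σ.AgreeBelow d σ' then 1 else 0) ∧
      2 / 3 ≤ wpc t ([P.shift d], σ) fun σ' =>
        if good (σ'.unshift d) ∧ σ.AgreeBelow d σ' then 1 else 0 := by
  have h0 := wpc_of_succeeds h (fun _ => True) (fun _ _ => trivial)
  have hs : Succeeds (P.shift d) σ t fun σ' => good (σ'.unshift d) := by
    apply succeeds_of_wpc
    · have := wpc_shift d t [P] σ fun _ => 1
      simp only [List.map_cons, List.map_nil] at this
      rw [this]
      simpa using h0.1
    · have := wpc_shift d t [P] σ fun σ' => if good σ' then 1 else 0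
      simp only [List.map_cons, List.map_nil] at this
      rw [this]
      simpa using h0.2
  exact wpc_of_succeeds hs (σ.AgreeBelow d)
    (agreeBelow_of_mem_support_run d t [P] σ σ ⟨fun _ _ => rfl, fun _ _ => rfl⟩)

end shift

end WordRAM

namespace WordRAM

/-! ### Expressions and their compilation -/

/-- Expressions over registers, constants and array entries. -/
inductive Ex where
  | v (r : ℕ)
  | c (k : ℕ)
  | bin (o : BinOp) (a b : Ex)
  | ld (A : ℕ) (e : Ex)

instance : Add Ex := ⟨.bin .add⟩
instance : Sub Ex := ⟨.bin .sub⟩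
instance : Mul Ex := ⟨.bin .mul⟩
instance : Div Ex := ⟨.bin .div⟩

/-- Code that puts the value of an expression into register `t`, using registers from `t` on. -/
def Ex.comp : Ex → ℕ → Prog
  | .v r, t => .op .or t r r
  | .c k, t => .const t k
  | .bin o a b, t => .seq (a.comp t) (.seq (b.comp (t + 1)) (.op o t t (t + 1)))
  | .ld A e, t => .seq (e.comp t) (.load t A t)

/-- The running time of `Ex.comp`. -/
def Ex.cost : Ex → ℕ
  | .v _ => 1
  | .c _ => 1
  | .bin _ a b => a.cost + b.cost + 3
  | .ld _ e => e.cost + 2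

/-- The number of auxiliary registers used besides the first. -/
def Ex.depth : Ex → ℕ
  | .v _ => 0
  | .c _ => 0
  | .bin _ a b => max a.depth (b.depth + 1)
  | .ld _ e => e.depth

/-- Registers and arrays with natural numbers as contents. -/
@[ext] structure NS where
  reg : ℕ → ℕ
  mem : ℕ → ℕ → ℕ

/-- Assignment to a register. -/
def NS.setR (s : NS) (r v : ℕ) : NS := { s with reg := Function.update s.reg r v }

/-- Assignment to an array cell. -/
def NS.setM (s : NS) (A i v : ℕ) : NS :=
  { s with mem := Function.update s.mem A (Function.update (s.mem A) i v) }

@[simp] theorem NS.setR_reg (s : NS) (r v r' : ℕ) :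
    (s.setR r v).reg r' = if r' = r then v else s.reg r' := by
  simp [NS.setR, Function.update_apply]

@[simp] theorem NS.setR_mem (s : NS) (r v : ℕ) : (s.setR r v).mem = s.mem := rfl

@[simp] theorem NS.setM_reg (s : NS) (A i v : ℕ) : (s.setM A i v).reg = s.reg := rfl

@[simp] theorem NS.setM_mem (s : NS) (A i v A' : ℕ) :
    (s.setM A i v).mem A' = if A' = A then Function.update (s.mem A) i v else s.mem A' := by
  simp [NS.setM, Function.update_apply]

/-- The operations on natural numbers. -/
def BinOp.nat : BinOp → ℕ → ℕ → ℕ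
  | .add, x, y => x + y
  | .sub, x, y => x - y
  | .mul, x, y => x * y
  | .div, x, y => x / y
  | .and, x, y => x &&& y
  | .or, x, y => x ||| y
  | .xor, x, y => x ^^^ y
  | .shl, x, y => x * 2 ^ y
  | .shr, x, y => x / 2 ^ y
  | .eq, x, y => if x = y then 1 else 0
  | .lt, x, y => if x < y then 1 else 0

/-- The operation gives the same result on words with `W` values. -/
def BinOp.Safe (W : ℕ) : BinOp → ℕ → ℕ → Prop
  | .add, x, y => x + y < W
  | .sub, x, y => y ≤ x
  | .mul, x, y => x * y < W
  | .shl, x, y => x * 2 ^ y < W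
  | .eq, _, _ => 1 < W
  | .lt, _, _ => 1 < W
  | _, _, _ => True

/-- The value of an expression. -/
def Ex.val (s : NS) : Ex → ℕ
  | .v r => s.reg r
  | .c k => k
  | .bin o a b => o.nat (a.val s) (b.val s)
  | .ld A e => s.mem A (e.val s)

/-- The registers from `50` to `99` are reserved for the evaluation of expressions. -/
def IsTemp (r : ℕ) : Prop := 50 ≤ r ∧ r < 100

instance (r : ℕ) : Decidable (IsTemp r) := by unfold IsTemp; infer_instance

/-- No overflow occurs in the evaluation. -/
def Ex.Safe (W : ℕ) (s : NS) : Ex → Prop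
  | .v r => ¬ IsTemp r
  | .c k => k < W
  | .bin o a b => a.Safe W s ∧ b.Safe W s ∧ o.Safe W (a.val s) (b.val s)
  | .ld _ e => e.Safe W s

/-- The expression can be evaluated without overflow in the reserved registers. -/
def Ex.Ok (W : ℕ) (s : NS) (e : Ex) : Prop := e.depth < 40 ∧ e.Safe W s

section simp_lemmas
variable (a b e : Ex) (s : NS) (W k r A : ℕ) (o : BinOp)

@[simp] theorem Ex.val_add : (a + b).val s = a.val s + b.val s := rfl
@[simp] theorem Ex.safe_add : (a + b).Safe W s ↔ a.Safe W s ∧ b.Safe W s ∧ a.val s + b.val s < W := Iff.rfl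
@[simp] theorem Ex.depth_add : (a + b).depth = max a.depth (b.depth + 1) := rfl
@[simp] theorem Ex.cost_add : (a + b).cost = a.cost + b.cost + 3 := rfl
@[simp] theorem Ex.val_sub : (a - b).val s = a.val s - b.val s := rfl
@[simp] theorem Ex.safe_sub : (a - b).Safe W s ↔ a.Safe W s ∧ b.Safe W s ∧ b.val s ≤ a.val s := Iff.rfl
@[simp] theorem Ex.depth_sub : (a - b).depth = max a.depth (b.depth + 1) := rfl
@[simp] theorem Ex.cost_sub : (a - b).cost = a.cost + b.cost + 3 := rfl
@[simp] theorem Ex.val_mul : (a * b).val s = a.val s * b.val s := rfl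
@[simp] theorem Ex.safe_mul : (a * b).Safe W s ↔ a.Safe W s ∧ b.Safe W s ∧ a.val s * b.val s < W := Iff.rfl
@[simp] theorem Ex.depth_mul : (a * b).depth = max a.depth (b.depth + 1) := rfl
@[simp] theorem Ex.cost_mul : (a * b).cost = a.cost + b.cost + 3 := rfl
@[simp] theorem Ex.val_div : (a / b).val s = a.val s / b.val s := rfl
@[simp] theorem Ex.safe_div : (a / b).Safe W s ↔ a.Safe W s ∧ b.Safe W s ∧ True := Iff.rfl
@[simp] theorem Ex.depth_div : (a / b).depth = max a.depth (b.depth + 1) := rfl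
@[simp] theorem Ex.cost_div : (a / b).cost = a.cost + b.cost + 3 := rfl
@[simp] theorem Ex.val_c : (Ex.c k).val s = k := rfl
@[simp] theorem Ex.safe_c : (Ex.c k).Safe W s ↔ k < W := Iff.rfl
@[simp] theorem Ex.depth_c : (Ex.c k).depth = 0 := rfl
@[simp] theorem Ex.cost_c : (Ex.c k).cost = 1 := rfl
@[simp] theorem Ex.val_v : (Ex.v r).val s = s.reg r := rfl
@[simp] theorem Ex.safe_v : (Ex.v r).Safe W s ↔ ¬ IsTemp r := Iff.rfl
@[simp] theorem Ex.depth_v : (Ex.v r).depth = 0 := rfl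
@[simp] theorem Ex.cost_v : (Ex.v r).cost = 1 := rfl
@[simp] theorem Ex.val_ld : (Ex.ld A e).val s = s.mem A (e.val s) := rfl
@[simp] theorem Ex.safe_ld : (Ex.ld A e).Safe W s ↔ e.Safe W s := Iff.rfl
@[simp] theorem Ex.depth_ld : (Ex.ld A e).depth = e.depth := rfl
@[simp] theorem Ex.cost_ld : (Ex.ld A e).cost = e.cost + 2 := rfl
@[simp] theorem Ex.val_bin : (Ex.bin o a b).val s = o.nat (a.val s) (b.val s) := rfl
@[simp] theorem Ex.safe_bin : (Ex.bin o a b).Safe W s ↔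
    a.Safe W s ∧ b.Safe W s ∧ o.Safe W (a.val s) (b.val s) := Iff.rfl
@[simp] theorem Ex.depth_bin : (Ex.bin o a b).depth = max a.depth (b.depth + 1) := rfl
@[simp] theorem Ex.cost_bin : (Ex.bin o a b).cost = a.cost + b.cost + 3 := rfl

end simp_lemmas

variable {w : ℕ}

/-- The number of words. -/
def wsz (w : ℕ) : ℕ := 2 ^ w

theorem BinOp.toNat_eval (o : BinOp) (x y : BitVec w) (h : o.Safe (2 ^ w) x.toNat y.toNat) :
    (o.eval x y).toNat = o.nat x.toNat y.toNat := by
  cases o <;> simp only [BinOp.Safe, BinOp.eval, BinOp.nat] at h ⊢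
  · rw [BitVec.toNat_add, Nat.mod_eq_of_lt h]
  · rw [BitVec.toNat_sub_of_le (by rwa [BitVec.le_def])]
  · rw [BitVec.toNat_mul, Nat.mod_eq_of_lt h]
  · rw [BitVec.toNat_udiv]
  · rw [BitVec.toNat_and]
  · rw [BitVec.toNat_or]
  · rw [BitVec.toNat_xor]
  · rw [BitVec.shiftLeft_eq', BitVec.toNat_shiftLeft, Nat.shiftLeft_eq, Nat.mod_eq_of_lt h]
  · rw [BitVec.ushiftRight_eq', BitVec.toNat_ushiftRight, Nat.shiftRight_eq_div_pow]
  · have hw : w ≠ 0 := by rintro rfl; simp at h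
    by_cases hxy : x = y
    · simp [hxy, Nat.pos_of_ne_zero hw]
    · simp [hxy, BitVec.toNat_inj]
  · have hw : w ≠ 0 := by rintro rfl; simp at h
    split_ifs <;> simp [Nat.pos_of_ne_zero hw]

/-- The contents of a state as natural numbers, except those of the reserved registers. -/
def view (σ : State w) : NS where
  reg r := if IsTemp r then 0 else (σ.reg r).toNat
  mem A i := if i < 2 ^ w then (σ.mem A (BitVec.ofNat w i)).toNat else 0

theorem view_setReg_temp (σ : State w) {r : ℕ} (hr : IsTemp r) (x : BitVec w) :
    view (σ.setReg r x) = view σ := by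
  ext r' <;> simp only [view, State.setReg]
  by_cases h : r' = r
  · subst h; simp [hr]
  · simp [Function.update_of_ne h]

theorem view_setReg (σ : State w) {r : ℕ} (hr : ¬ IsTemp r) (x : BitVec w) :
    view (σ.setReg r x) = (view σ).setR r x.toNat := by
  ext r'
  · simp only [view, State.setReg, NS.setR_reg]
    by_cases h : r' = r
    · subst h; simp [hr]
    · simp [h]
  · rfl

/-- Indices of at least `2 ^ w` have value `0` in `view` and are never written, so distinct natural
indices below `2 ^ w` correspond to distinct cells. -/
theorem view_setMem (σ : State w) (A : ℕ) (i x : BitVec w) :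
    view (σ.setMem A i x) = (view σ).setM A i.toNat x.toNat := by
  ext A' j
  · rfl
  · simp only [view, State.setMem, NS.setM_mem]
    by_cases h : A' = A
    · subst h
      simp only [Function.update_self, if_true]
      by_cases hj : j = i.toNat
      · subst hj; simp [i.isLt]
      · rw [Function.update_of_ne hj]
        split_ifs with hlt
        · rw [Function.update_of_ne]
          rintro rfl
          simp [Nat.mod_eq_of_lt hlt] at hj
        · rfl
    · simp [h]

/-- Compilation at `t` leaves the registers below `t` alone, so the first operand in `t` survives
the evaluation of the second one from `t + 1` on. The reserved registers are invisible in `view`, so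
evaluation has no visible effect. -/
theorem Ex.wpc_comp (e : Ex) (t : ℕ) (ht : 50 ≤ t) (hd : t + e.depth < 100) (σ : State w)
    (hs : e.Safe (wsz w) (view σ)) :
    ∃ σ' : State w, (σ'.reg t).toNat = e.val (view σ) ∧ view σ' = view σ ∧
      (∀ r < t, σ'.reg r = σ.reg r) ∧ ∀ f, f σ' ≤ wpc e.cost ([e.comp t], σ) f := by
  induction e generalizing t σ with
  | v r =>
    simp only [Ex.Safe] at hs
    simp only [Ex.depth] at hd
    refine ⟨σ.setReg t (BinOp.or.eval (σ.reg r) (σ.reg r)), ?_, ?_, ?_, ?_⟩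
    · simp [State.setReg, Ex.val, view, hs, BinOp.eval]
    · exact view_setReg_temp _ ⟨ht, by omega⟩ _
    · intro r' hr; simp [State.setReg, Function.update_of_ne hr.ne]
    · intro f; rw [Ex.cost, Ex.comp, wpc_op]
  | c k =>
    simp only [Ex.Safe] at hs
    simp only [Ex.depth] at hd
    refine ⟨σ.setReg t (BitVec.ofNat w k), ?_, ?_, ?_, ?_⟩
    · simp [State.setReg, Ex.val, Nat.mod_eq_of_lt (show k < 2 ^ w from hs)]
    · exact view_setReg_temp _ ⟨ht, by omega⟩ _
    · intro r' hr; simp [State.setReg, Function.update_of_ne hr.ne]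
    · intro f; rw [Ex.cost, Ex.comp, wpc_const]
  | bin o a b iha ihb =>
    simp only [Ex.Safe] at hs
    simp only [Ex.depth] at hd
    obtain ⟨σ₁, hv₁, hw₁, hr₁, hf₁⟩ := iha t ht (by omega) σ hs.1
    obtain ⟨σ₂, hv₂, hw₂, hr₂, hf₂⟩ := ihb (t + 1) (by omega) (by omega) σ₁ (by rw [hw₁]; exact hs.2.1)
    have hv₁' : (σ₂.reg t).toNat = a.val (view σ) := by rw [hr₂ t (by omega), hv₁]
    rw [hw₁] at hv₂
    refine ⟨σ₂.setReg t (o.eval (σ₂.reg t) (σ₂.reg (t + 1))), ?_, ?_, ?_, ?_⟩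
    · simp only [State.setReg, Function.update_self, Ex.val]
      rw [BinOp.toNat_eval, hv₁', hv₂]
      rw [hv₁', hv₂]; exact hs.2.2
    · rw [view_setReg_temp _ ⟨ht, by omega⟩ _, hw₂, hw₁]
    · intro r' hr
      simp only [State.setReg]
      rw [Function.update_of_ne hr.ne, hr₂ _ (by omega), hr₁ _ hr]
    · intro f
      rw [Ex.cost, Ex.comp, show a.cost + b.cost + 3 = a.cost + (b.cost + 1 + 1) + 1 by ring]
      refine le_trans ?_ (wpc_seq _ _ _ _ _ _)
      refine le_trans ?_ (hf₁ _)
      refine le_trans ?_ (wpc_seq _ _ _ _ _ _)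
      refine le_trans ?_ (hf₂ _)
      rw [wpc_op]
  | ld A e ih =>
    simp only [Ex.Safe] at hs
    simp only [Ex.depth] at hd
    obtain ⟨σ₁, hv₁, hw₁, hr₁, hf₁⟩ := ih t ht hd σ hs
    refine ⟨σ₁.setReg t (σ₁.mem A (σ₁.reg t)), ?_, ?_, ?_, ?_⟩
    · simp only [State.setReg, Function.update_self, Ex.val]
      rw [← hv₁, ← hw₁]
      simp [view, (σ₁.reg t).isLt]
    · rw [view_setReg_temp _ ⟨ht, by omega⟩ _, hw₁]
    · intro r' hr
      simp only [State.setReg]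
      rw [Function.update_of_ne hr.ne, hr₁ _ hr]
    · intro f
      rw [Ex.cost, Ex.comp]
      refine le_trans ?_ (wpc_seq _ _ _ _ _ _)
      refine le_trans ?_ (hf₁ _)
      rw [wpc_load]

/-! ### Programs with expressions -/

/-- `r := e` -/
def assign (r : ℕ) (e : Ex) : Prog := .seq (e.comp 50) (.op .or r 50 50)

/-- `A[i] := e` -/
def storeP (A : ℕ) (i e : Ex) : Prog :=
  .seq (i.comp 50) (.seq (e.comp 51) (.store A 50 51))

/-- if `e ≠ 0` then `p` else `q` -/
def iteP (e : Ex) (p q : Prog) : Prog := .seq (e.comp 50) (.ite 50 p q)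

/-- while `e ≠ 0` do `p` -/
def whileP (e : Ex) (p : Prog) : Prog := .seq (e.comp 50) (.loop 50 (.seq p (e.comp 50)))

/-- one after another -/
def blk : List Prog → Prog
  | [] => .skip
  | p :: ps => .seq p (blk ps)

/-- for `i = 0, …, n - 1` do `p`, where `n` is the value of `e` -/
def forP (i : ℕ) (e : Ex) (p : Prog) : Prog :=
  blk [assign i (.c 0), whileP (.bin .lt (.v i) e) (blk [p, assign i (.v i + .c 1)])]

/-- A lower bound for the expected value of `f` after at most `T` steps from states with
contents `s`. -/
noncomputable def ewp (w : ℕ) (p : Prog) (T : ℕ) (f : NS → ℝ≥0∞) (s : NS) : ℝ≥0∞ :=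
  ⨅ (σ : State w) (_ : view σ = s), wpc T ([p], σ) fun σ' => f (view σ')

section ewp
variable {p q : Prog} {T T' T₁ T₂ : ℕ} {f g : NS → ℝ≥0∞} {s : NS} {x y : ℝ≥0∞} {r : ℕ}

theorem le_ewp (h : ∀ σ : State w, view σ = s → x ≤ wpc T ([p], σ) fun σ' => f (view σ')) :
    x ≤ ewp w p T f s :=
  le_iInf₂ h

theorem ewp_le (σ : State w) : ewp w p T f (view σ) ≤ wpc T ([p], σ) fun σ' => f (view σ') :=
  iInf₂_le_of_le σ rfl le_rfl

theorem ewp_mono (hT : T ≤ T') (h : ∀ s, f s ≤ g s) : ewp w p T f s ≤ ewp w p T' g s := by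
  refine le_ewp fun σ hσ => ?_
  subst hσ
  exact (ewp_le σ).trans ((wpc_mono_time hT _ _).trans (wpc_mono_fun _ _ fun σ => h _))

theorem ewp_seq : ewp w p T₁ (ewp w q T₂ f) s ≤ ewp w (p.seq q) (T₁ + T₂ + 1) f s := by
  refine le_ewp fun σ hσ => ?_
  subst hσ
  exact (ewp_le σ).trans ((wpc_mono_fun _ _ fun σ' => ewp_le σ').trans (wpc_seq _ _ _ _ _ _))

/-- Superadditivity is all that remains of linearity, since `ewp` is an infimum over the states with
the given contents. -/
theorem ewp_add : ewp w p T f s + ewp w p T g s ≤ ewp w p T (fun s' => f s' + g s') s := by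
  refine le_ewp fun σ hσ => ?_
  subst hσ
  rw [wpc_add]
  exact add_le_add (ewp_le σ) (ewp_le σ)

theorem ewp_const_mul : x * ewp w p T f s ≤ ewp w p T (fun s' => x * f s') s := by
  refine le_ewp fun σ hσ => ?_
  subst hσ
  rw [wpc_const_mul]
  exact mul_le_mul_right (ewp_le σ) _

theorem ewp_assign {e : Ex} (he : e.Ok (wsz w) s) (hr : ¬ IsTemp r) :
    f (s.setR r (e.val s)) ≤ ewp w (assign r e) (e.cost + 2) f s := by
  refine le_ewp fun σ hσ => ?_
  subst hσ
  obtain ⟨σ', hv, hw, -, hf⟩ := e.wpc_comp 50 le_rfl (by have := he.1; omega) σ he.2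
  refine le_trans ?_ (wpc_seq e.cost 1 _ _ _ _)
  refine le_trans ?_ (hf _)
  rw [wpc_op, view_setReg _ hr, hw]
  simp [BinOp.eval, hv]

theorem ewp_store {A : ℕ} {i e : Ex} (hi : i.Ok (wsz w) s) (he : e.Ok (wsz w) s) :
    f (s.setM A (i.val s) (e.val s)) ≤ ewp w (storeP A i e) (i.cost + e.cost + 3) f s := by
  refine le_ewp fun σ hσ => ?_
  subst hσ
  obtain ⟨σ₁, hv₁, hw₁, hr₁, hf₁⟩ := i.wpc_comp 50 le_rfl (by have := hi.1; omega) σ hi.2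
  obtain ⟨σ₂, hv₂, hw₂, hr₂, hf₂⟩ := e.wpc_comp 51 (by omega) (by have := he.1; omega) σ₁
    (by rw [hw₁]; exact he.2)
  rw [show i.cost + e.cost + 3 = i.cost + (e.cost + 1 + 1) + 1 by ring]
  refine le_trans ?_ (wpc_seq _ _ _ _ _ _)
  refine le_trans ?_ (hf₁ _)
  refine le_trans ?_ (wpc_seq _ _ _ _ _ _)
  refine le_trans ?_ (hf₂ _)
  rw [wpc_store, view_setMem, hw₂, hw₁, hv₂, hr₂ _ (by omega), hv₁, hw₁]

theorem ewp_flip (hw : w ≠ 0) (hr : ¬ IsTemp r) :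
    (f (s.setR r 1) + f (s.setR r 0)) / 2 ≤ ewp w (.flip r) 1 f s := by
  refine le_ewp fun σ hσ => ?_
  subst hσ
  rw [wpc_flip, view_setReg _ hr, view_setReg _ hr]
  simp [Nat.mod_eq_of_lt (Nat.one_lt_two_pow hw)]

theorem ewp_ite {e : Ex} (he : e.Ok (wsz w) s) (hT : e.cost + 2 ≤ T)
    (h1 : e.val s ≠ 0 → x ≤ ewp w p (T - (e.cost + 2)) f s)
    (h0 : e.val s = 0 → x ≤ ewp w q (T - (e.cost + 2)) f s) :
    x ≤ ewp w (iteP e p q) T f s := by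
  refine le_ewp fun σ hσ => ?_
  subst hσ
  obtain ⟨σ', hv, hw, -, hf⟩ := e.wpc_comp 50 le_rfl (by have := he.1; omega) σ he.2
  obtain ⟨T, rfl⟩ : ∃ u, T = e.cost + (u + 1) + 1 := ⟨T - (e.cost + 2), by omega⟩
  refine le_trans ?_ (wpc_seq _ _ _ _ _ _)
  refine le_trans ?_ (hf _)
  rw [show e.cost + (T + 1) + 1 - (e.cost + 2) = T by omega, ← hw] at h1 h0
  rw [← hw] at hv
  rw [wpc_ite]
  split_ifs with h
  · refine (h1 ?_).trans (ewp_le σ')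
    rw [← hv]
    intro h'
    exact h (BitVec.eq_of_toNat_eq (by simpa using h'))
  · refine (h0 ?_).trans (ewp_le σ')
    rw [not_not] at h
    rw [← hv, h]; simp

theorem ewp_while_true {e : Ex} (he : e.Ok (wsz w) s) (h : e.val s ≠ 0) :
    ewp w p T₁ (ewp w (whileP e p) T₂ f) s ≤ ewp w (whileP e p) (T₁ + T₂ + (e.cost + 3)) f s := by
  refine le_ewp fun σ hσ => ?_
  subst hσ
  obtain ⟨σ', hv, hw, -, hf⟩ := e.wpc_comp 50 le_rfl (by have := he.1; omega) σ he.2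
  rw [show T₁ + T₂ + (e.cost + 3) = e.cost + (T₁ + T₂ + 1 + 1) + 1 by ring]
  refine le_trans ?_ (wpc_seq _ _ _ _ _ _)
  refine le_trans ?_ (hf _)
  rw [wpc_succ, step, pexp_pure, if_pos, wpc_succ, step, pexp_pure]
  · refine le_trans ?_ (wpc_cons _ _ _ _ _ _)
    rw [← hw]
    refine (ewp_le σ').trans (wpc_mono_fun _ _ fun τ => ?_)
    -- The body ends by evaluating the condition again, so the stack left after `p` is exactly
    -- `whileP e p` with its outer `seq` already unfolded; this accounts for the one extra step.
    refine (ewp_le τ).trans ((wpc_le_succ _ _ _).trans ?_)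
    rw [wpc_succ, whileP, step, pexp_pure]
  · intro h'
    rw [h'] at hv
    exact h (by rw [← hv]; simp)

theorem ewp_while_false {e : Ex} (he : e.Ok (wsz w) s) (h : e.val s = 0) :
    f s ≤ ewp w (whileP e p) (e.cost + 3) f s := by
  refine le_ewp fun σ hσ => ?_
  subst hσ
  obtain ⟨σ', hv, hw, -, hf⟩ := e.wpc_comp 50 le_rfl (by have := he.1; omega) σ he.2
  rw [show e.cost + 3 = e.cost + (1 + 1) + 1 by ring]
  refine le_trans ?_ (wpc_seq _ _ _ _ _ _)
  refine le_trans ?_ (hf _)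
  rw [wpc_succ, step, pexp_pure, if_neg, wpc_nil, hw]
  rw [not_not]
  exact BitVec.eq_of_toNat_eq (by rw [hv, h]; simp)

theorem blk_nil (hT : 1 ≤ T) (h : x ≤ f s) : x ≤ ewp w (blk []) T f s := by
  refine le_trans ?_ (ewp_mono hT fun _ => le_rfl)
  refine le_ewp fun σ hσ => ?_
  subst hσ
  rwa [blk, wpc_skip]

theorem blk_cons {ps : List Prog} (hT : T₁ + 1 ≤ T)
    (h : x ≤ ewp w p T₁ (ewp w (blk ps) (T - (T₁ + 1)) f) s) : x ≤ ewp w (blk (p :: ps)) T f s := by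
  refine h.trans (ewp_seq.trans (ewp_mono (by omega) fun _ => le_rfl))

theorem blk_assign {ps : List Prog} {e : Ex} (hr : ¬ IsTemp r) (he : e.Ok (wsz w) s)
    (hT : e.cost + 3 ≤ T)
    (h : x ≤ ewp w (blk ps) (T - (e.cost + 3)) f (s.setR r (e.val s))) :
    x ≤ ewp w (blk (assign r e :: ps)) T f s :=
  blk_cons hT (h.trans (ewp_assign he hr))

theorem blk_store {ps : List Prog} {A : ℕ} {i e : Ex} (hi : i.Ok (wsz w) s)
    (he : e.Ok (wsz w) s) (hT : i.cost + e.cost + 4 ≤ T)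
    (h : x ≤ ewp w (blk ps) (T - (i.cost + e.cost + 4)) f (s.setM A (i.val s) (e.val s))) :
    x ≤ ewp w (blk (storeP A i e :: ps)) T f s :=
  blk_cons hT (h.trans (ewp_store hi he))

open Classical in
/-- The indicator function of a predicate. -/
noncomputable def ind (P : NS → Prop) (s : NS) : ℝ≥0∞ := if P s then 1 else 0

theorem ind_of {P : NS → Prop} (h : P s) : ind P s = 1 := if_pos h

theorem ind_mono {P Q : NS → Prop} (h : P s → Q s) : ind P s ≤ ind Q s := by
  unfold ind
  split_ifs <;> simp_all

/-- From contents `s`, the program halts within `T` steps and `Post` holds in the end, whatever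
the coin tosses are. -/
def Tot (w : ℕ) (p : Prog) (T : ℕ) (s : NS) (Post : NS → Prop) : Prop :=
  1 ≤ ewp w p T (ind Post) s

/-- A lower bound `x` for `f` on an event of probability at least `y` contributes `x * y`. -/
theorem ewp_of_ind {P : NS → Prop} (h : y ≤ ewp w p T (ind P) s) (hP : ∀ s', P s' → x ≤ f s') :
    x * y ≤ ewp w p T f s := by
  refine (mul_le_mul_right h x).trans (ewp_const_mul.trans (ewp_mono le_rfl fun s' => ?_))
  unfold ind
  split_ifs with h
  · simpa using hP s' h
  · simp

theorem Tot.ewp {P : NS → Prop} (h : Tot w p T s P) (hP : ∀ s', P s' → x ≤ f s') :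
    x ≤ ewp w p T f s := by
  simpa using ewp_of_ind h hP

theorem Tot.mono {P Q : NS → Prop} (h : Tot w p T s P) (hT : T ≤ T') (hP : ∀ s', P s' → Q s') :
    Tot w p T' s Q :=
  le_trans h (ewp_mono hT fun _ => ind_mono (hP _))

theorem blk_tot {ps : List Prog} {P : NS → Prop} (h : Tot w p T₁ s P) (hT : T₁ + 1 ≤ T)
    (hP : ∀ s', P s' → x ≤ ewp w (blk ps) (T - (T₁ + 1)) f s') :
    x ≤ ewp w (blk (p :: ps)) T f s :=
  blk_cons hT (h.ewp hP)

theorem blk_prob {ps : List Prog} {P : NS → Prop} (h : y ≤ ewp w p T₁ (ind P) s)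
    (hT : T₁ + 1 ≤ T) (hP : ∀ s', P s' → x ≤ ewp w (blk ps) (T - (T₁ + 1)) f s') :
    x * y ≤ ewp w (blk (p :: ps)) T f s :=
  blk_cons hT (ewp_of_ind h hP)

end ewp

/-! ### For-loops -/

/-- `V j` is an expectation that is guaranteed when round `j` begins, so it plays the part of a
quantitative invariant. It may vanish on states in which nothing is promised, so the counter and the
loop bound need to be right only where `V j` is nonzero. -/
theorem ewp_for {i N Tb : ℕ} {e : Ex} {p : Prog} {f : NS → ℝ≥0∞} (hi : ¬ IsTemp i)
    (hw : N + 1 < wsz w) (hd : e.depth < 38) (V : ℕ → NS → ℝ≥0∞)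
    (hV : ∀ j ≤ N, ∀ s, V j s ≠ 0 → s.reg i = j ∧ e.Safe (wsz w) s ∧ e.val s = N)
    (hb : ∀ j < N, ∀ s, V j s ≤
      ewp w p Tb (fun s' => if s'.reg i = j then V (j + 1) (s'.setR i (j + 1)) else 0) s)
    (hf : ∀ s, V N s ≤ f s) (s : NS) :
    V 0 (s.setR i 0) ≤ ewp w (forP i e p) ((N + 1) * (Tb + e.cost + 20)) f s := by
  have hw1 : 1 < wsz w := by omega
  -- The induction is on the number `k` of rounds still to be made.
  have main : ∀ k ≤ N, ∀ s, V (N - k) s ≤ ewp w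
      (whileP (.bin .lt (.v i) e) (blk [p, assign i (.v i + .c 1)]))
      (k * (Tb + e.cost + 20) + (e.cost + 7)) f s := by
    intro k
    induction k with
    | zero =>
      intro _ s
      by_cases h0 : V N s = 0
      · simp [h0]
      obtain ⟨h1, h2, h3⟩ := hV N le_rfl s h0
      refine (hf s).trans ((ewp_while_false ?_ ?_).trans (ewp_mono ?_ fun _ => le_rfl))
      · exact ⟨by simp [Ex.depth]; omega, hi, h2, hw1⟩
      · simp [Ex.val, BinOp.nat, h1, h3]
      · simp only [Ex.cost]; omega
    | succ k ih =>
      intro hk s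
      by_cases h0 : V (N - (k + 1)) s = 0
      · simp [h0]
      obtain ⟨h1, h2, h3⟩ := hV _ (by omega) s h0
      refine le_trans ?_ (ewp_mono (T := (Tb + 10) + (k * (Tb + e.cost + 20) + (e.cost + 7)) +
        (Ex.cost (.bin .lt (.v i) e) + 3)) ?_ fun _ => le_rfl)
      · refine le_trans ?_ (ewp_while_true ⟨by simp [Ex.depth]; omega, hi, h2, hw1⟩ ?_)
        · refine blk_cons (T₁ := Tb) (by omega) ((hb _ (by omega) s).trans
            (ewp_mono le_rfl fun s' => ?_))
          split_ifs with hs'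
          · refine blk_assign hi ?_ ?_ ?_
            · refine ⟨by simp, by simp; exact ⟨hi, hw1, by omega⟩⟩
            · simp only [Ex.cost_v, Ex.cost_add, Ex.cost_c]; omega
            · refine blk_nil (by simp only [Ex.cost_v, Ex.cost_add, Ex.cost_c]; omega) ?_
              have := ih (by omega) (s'.setR i (N - (k + 1) + 1))
              rw [show N - k = N - (k + 1) + 1 by omega] at this
              simpa [hs'] using this
          · exact zero_le
        · simp only [Ex.val, BinOp.nat, h1, h3]
          rw [if_pos (by omega)]; simp
      · simp only [Ex.cost]; ring_nf; omega
  refine blk_assign (T := (N + 1) * (Tb + e.cost + 20)) hi ⟨by simp, by simp; omega⟩ ?_ ?_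
  · simp; ring_nf; omega
  refine blk_cons (T₁ := N * (Tb + e.cost + 20) + (e.cost + 7)) ?_ ?_
  · simp; ring_nf; omega
  have := main N le_rfl (s.setR i 0)
  rw [Nat.sub_self] at this
  simp only [Ex.val_c]
  refine this.trans (ewp_mono le_rfl fun s' => blk_nil ?_ le_rfl)
  simp; ring_nf; omega

end WordRAM

/-! ### Loop invariants, frame conditions, and calls of a given algorithm -/

namespace WordRAM

attribute [simp] BinOp.Safe BinOp.nat IsTemp

variable {w : ℕ}

theorem tot_for {i N Tb T : ℕ} {e : Ex} {p : Prog} {s : NS} (hi : ¬ IsTemp i)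
    (hw : N + 1 < wsz w) (hd : e.depth < 38) (Inv : ℕ → NS → Prop)
    (hV : ∀ j ≤ N, ∀ s, Inv j s → s.reg i = j ∧ e.Safe (wsz w) s ∧ e.val s = N)
    (hb : ∀ j < N, ∀ s, Inv j s →
      Tot w p Tb s fun s' => s'.reg i = j ∧ Inv (j + 1) (s'.setR i (j + 1)))
    (h0 : Inv 0 (s.setR i 0)) (hT : (N + 1) * (Tb + e.cost + 20) ≤ T) :
    Tot w (forP i e p) T s (Inv N) := by
  have := ewp_for (p := p) (f := ind (Inv N)) (Tb := Tb) hi hw hd (fun j => ind (Inv j)) ?_ ?_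
    (fun _ => le_rfl) s
  · rw [ind_of h0] at this
    exact this.trans (ewp_mono hT fun _ => le_rfl)
  · intro j hj s hs
    refine hV j hj s ?_
    by_contra h
    exact hs (if_neg h)
  · intro j hj s
    by_cases h : Inv j s
    · rw [ind_of h]
      refine (hb j hj s h).ewp fun s' hs' => ?_
      rw [if_pos hs'.1, ind_of hs'.2]
    · rw [ind, if_neg h]
      exact zero_le

/-- The registers below `r` and the arrays below `a` agree. -/
structure Fr (r a : ℕ) (s s' : NS) : Prop where
  reg : ∀ i < r, s'.reg i = s.reg i
  mem : ∀ A < a, s'.mem A = s.mem A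

theorem Fr.refl (r a : ℕ) (s : NS) : Fr r a s s := ⟨fun _ _ => rfl, fun _ _ => rfl⟩

theorem Fr.trans {r a : ℕ} {s s' s'' : NS} (h : Fr r a s s') (h' : Fr r a s' s'') :
    Fr r a s s'' :=
  ⟨fun i hi => (h'.reg i hi).trans (h.reg i hi), fun i hi => (h'.mem i hi).trans (h.mem i hi)⟩

theorem Fr.mono {r a r' a' : ℕ} {s s' : NS} (h : Fr r a s s') (hr : r' ≤ r) (ha : a' ≤ a) :
    Fr r' a' s s' :=
  ⟨fun i hi => h.reg i (by omega), fun i hi => h.mem i (by omega)⟩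

theorem Fr.setR {r a i v : ℕ} {s s' : NS} (h : Fr r a s s') (hi : r ≤ i) :
    Fr r a s (s'.setR i v) :=
  ⟨fun j hj => by rw [NS.setR_reg, if_neg (by omega), h.reg j hj], h.mem⟩

theorem Fr.setM {r a A i v : ℕ} {s s' : NS} (h : Fr r a s s') (hA : a ≤ A) :
    Fr r a s (s'.setM A i v) :=
  ⟨h.reg, fun j hj => by rw [NS.setM_mem, if_neg (by omega), h.mem j hj]⟩

/-- The array `m` starts with the entries of the list `l`. -/
def Holds (m : ℕ → ℕ) (l : List ℕ) : Prop := ∀ j v, l[j]? = some v → m j = v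

theorem Holds.nil (m : ℕ → ℕ) : Holds m [] := by intro j v h; simp at h

theorem Holds.push {m : ℕ → ℕ} {l : List ℕ} (h : Holds m l) {i : ℕ} (hi : i = l.length) (v : ℕ) :
    Holds (Function.update m i v) (l ++ [v]) := by
  subst hi
  intro j x hj
  rcases lt_trichotomy j l.length with hlt | heq | hgt
  · rw [Function.update_of_ne hlt.ne]
    rw [List.getElem?_append_left hlt] at hj
    exact h j x hj
  · subst heq
    simp at hj
    simpa using hj
  · rw [List.getElem?_eq_none (by simp; omega)] at hj
    simp at hj

theorem Holds.get {m : ℕ → ℕ} {l : List ℕ} (h : Holds m l) {j : ℕ} (hj : j < l.length) :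
    m j = l[j] := h j _ (List.getElem?_eq_getElem hj)

theorem Holds.take_succ {m m' : ℕ → ℕ} {l : List ℕ} {j : ℕ} (h : Holds m (l.take j))
    (h' : Holds m' l) (hj : j < l.length) :
    Holds (Function.update m j (m' j)) (l.take (j + 1)) := by
  rw [h'.get hj, List.take_succ_eq_append_getElem hj]
  exact h.push (by simp; omega) _

/-- `B[i] := A[i]` for all `i < e` -/
def copyP (i : ℕ) (e : Ex) (A B : ℕ) : Prog :=
  forP i e (blk [storeP B (.v i) (.ld A (.v i))])

/-- The bound `e` is evaluated afresh in every round, so its value has to be stable under changes of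
the counter and of the target array. -/
theorem tot_copy {i A B N T : ℕ} {e : Ex} {s : NS} {l : List ℕ} (hi : ¬ IsTemp i) (hAB : A ≠ B)
    (hw : N + 1 < wsz w) (hd : e.depth < 38) (hl : l.length = N) (hA : Holds (s.mem A) l)
    (he : ∀ s' : NS, (∀ r, r ≠ i → s'.reg r = s.reg r) → (∀ C, C ≠ B → s'.mem C = s.mem C) →
      e.Safe (wsz w) s' ∧ e.val s' = N)
    (hT : (N + 1) * (e.cost + 40) ≤ T) :
    Tot w (copyP i e A B) T s fun s' => (∀ r, r ≠ i → s'.reg r = s.reg r) ∧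
      (∀ C, C ≠ B → s'.mem C = s.mem C) ∧ Holds (s'.mem B) l := by
  refine Tot.mono (T := T) (tot_for hi hw hd (Tb := 20) (fun j s' => s'.reg i = j ∧
    (∀ r, r ≠ i → s'.reg r = s.reg r) ∧ (∀ C, C ≠ B → s'.mem C = s.mem C) ∧
      Holds (s'.mem B) (l.take j)) ?_ ?_ ?_ (by nlinarith)) le_rfl ?_
  · rintro j hj s' ⟨h1, h2, h3, h4⟩
    exact ⟨h1, he s' h2 h3⟩
  · rintro j hj s' ⟨h1, h2, h3, h4⟩
    refine blk_store ?_ ?_ ?_ (blk_nil ?_ (ind_of ⟨?_, ?_, ?_, ?_, ?_⟩).ge)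
    · exact ⟨by simp, by simpa using hi⟩
    · exact ⟨by simp, by simpa using hi⟩
    · simp
    · simp
    · simpa using h1
    · simp
    · intro r hr
      simp [hr, h2 r hr]
    · intro C hC
      simp [hC, h3 C hC]
    · have := h4.take_succ hA (by omega)
      simpa [h1, h3 A hAB] using this
  · exact ⟨by simp, fun r hr => by simp [hr], fun C _ => rfl, by simpa using Holds.nil _⟩
  · rintro s' ⟨-, h2, h3, h4⟩
    exact ⟨h2, h3, by rwa [List.take_of_length_le (by omega)] at h4⟩

/-! ### Running a given algorithm as a subroutine -/

/-- `IsInitial` says nothing about registers and cells outside the input, so the algorithm can be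
called again and again on memory that earlier calls have left dirty. The caller's names below `100`
survive every call. -/
theorem tot_shift {P : Prog} {ι : Type} {enc : ι → Input} {L : ι → Prop} {T : ι → ℝ} {c : ℕ}
    (hP : ∀ (x : ι) (w : ℕ), c * Real.logb 2 ((enc x).size + T x) ≤ w →
      ∀ σ : State w, IsInitial (enc x) σ →
        ∃ t : ℕ, (t : ℝ) ≤ T x ∧ Succeeds P σ t fun σ => (L x → σ.reg 0 = 1) ∧ (¬ L x → σ.reg 0 = 0))
    (x : ι) (hw : c * Real.logb 2 ((enc x).size + T x) ≤ w) (hw0 : w ≠ 0) {T' : ℕ} (hT : T x ≤ T')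
    {s : NS} (hs : ∀ (i : ℕ) (l : List ℕ), (enc x)[i]? = some l →
      s.reg (100 + i) = l.length ∧ l.length < wsz w ∧ Holds (s.mem (100 + i)) l) :
    Tot w (P.shift 100) T' s (Fr 100 100 s) ∧
    2 / 3 ≤ ewp w (P.shift 100) T' (ind fun s' => Fr 100 100 s s' ∧
      (L x → s'.reg 100 = 1) ∧ (¬ L x → s'.reg 100 = 0)) s := by
  have key : ∀ σ : State w, view σ = s → ∃ t : ℕ, t ≤ T' ∧
      Succeeds P (σ.unshift 100) t fun σ => (L x → σ.reg 0 = 1) ∧ (¬ L x → σ.reg 0 = 0) := by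
    intro σ hσ
    have hinit : IsInitial (enc x) (σ.unshift 100) := by
      intro i l hl
      obtain ⟨h1, h2, h3⟩ := hs i l hl
      subst hσ
      constructor
      · rw [← h1]
        simp [view, State.unshift, add_comm]
      · intro j v hj
        have hjl : j < l.length := by
          by_contra hge
          rw [List.getElem?_eq_none (by omega)] at hj
          simp at hj
        rw [← h3 j v hj]
        have : j < 2 ^ w := hjl.trans h2
        simp [view, State.unshift, add_comm, this]
    obtain ⟨t, ht, h⟩ := hP x w hw (σ.unshift 100) hinit
    exact ⟨t, by exact_mod_cast ht.trans hT, h⟩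
  have frame : ∀ σ σ' : State w, σ.AgreeBelow 100 σ' → Fr 100 100 (view σ) (view σ') := by
    intro σ σ' h
    constructor
    · intro r hr
      simp only [view, h.1 r hr]
    · intro A hA
      simp only [view, h.2 A hA]
  constructor
  · refine le_ewp fun σ hσ => ?_
    obtain ⟨t, ht, h⟩ := key σ hσ
    refine (wpc_shift_of_succeeds 100 h).1.trans ((wpc_mono_time ht _ _).trans
      (wpc_mono_fun _ _ fun σ' => ?_))
    subst hσ
    split_ifs with h'
    · rw [ind_of (frame _ _ h')]
    · exact zero_le
  · refine le_ewp fun σ hσ => ?_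
    obtain ⟨t, ht, h⟩ := key σ hσ
    refine (wpc_shift_of_succeeds 100 h).2.trans ((wpc_mono_time ht _ _).trans
      (wpc_mono_fun _ _ fun σ' => ?_))
    subst hσ
    split_ifs with h'
    · have hg : (L x → (view σ').reg 100 = 1) ∧ (¬ L x → (view σ').reg 100 = 0) := by
        constructor
        · intro hL
          have h2 : σ'.reg 100 = 1 := h'.1.1 hL
          simp [view, h2, Nat.mod_eq_of_lt (Nat.one_lt_two_pow hw0)]
        · intro hL
          have h2 : σ'.reg 100 = 0 := h'.1.2 hL
          simp [view, h2]
      rw [ind_of ⟨frame _ _ h'.2, hg⟩]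
    · exact zero_le

end WordRAM

namespace WordRAM

variable {w : ℕ}

/-! ### Walking through the clauses of a formula -/

/-- The code of a formula from the codes of its literals. -/
def codeL (Cs : List (List ℕ)) : List ℕ := (Cs.map fun C => C.length :: C).flatten

theorem codeL_append (Cs Ds : List (List ℕ)) : codeL (Cs ++ Ds) = codeL Cs ++ codeL Ds := by
  simp [codeL]

theorem codeL_cons (C : List ℕ) (Cs : List (List ℕ)) :
    codeL (C :: Cs) = (C.length :: C) ++ codeL Cs := by
  simp [codeL]

theorem codeL_split (Cs : List (List ℕ)) {c : ℕ} (hc : c < Cs.length) :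
    codeL Cs = codeL (Cs.take c) ++ ((Cs[c].length :: Cs[c]) ++ codeL (Cs.drop (c + 1))) := by
  rw [← codeL_cons, ← codeL_append, ← List.drop_eq_getElem_cons hc, List.take_append_drop]

theorem length_codeL_take_succ (Cs : List (List ℕ)) {c : ℕ} (hc : c < Cs.length) :
    (codeL (Cs.take (c + 1))).length = (codeL (Cs.take c)).length + Cs[c].length + 1 := by
  rw [List.take_succ_eq_append_getElem hc, codeL_append]
  simp [codeL]; omega

theorem length_codeL_take_le (Cs : List (List ℕ)) {c : ℕ} (hc : c < Cs.length) :
    (codeL (Cs.take c)).length + Cs[c].length + 1 ≤ (codeL Cs).length := by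
  rw [codeL_split Cs hc]
  simp

theorem length_le_length_codeL (Cs : List (List ℕ)) : Cs.length ≤ (codeL Cs).length := by
  induction Cs with
  | nil => simp
  | cons C Cs ih => rw [codeL_cons]; simp; omega

theorem codeL_getElem?_length (Cs : List (List ℕ)) {c : ℕ} (hc : c < Cs.length) :
    (codeL Cs)[(codeL (Cs.take c)).length]? = some Cs[c].length := by
  rw [codeL_split Cs hc, List.getElem?_append_right le_rfl]
  simp

theorem codeL_getElem?_lit (Cs : List (List ℕ)) {c t : ℕ} (hc : c < Cs.length)
    (ht : t < Cs[c].length) :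
    (codeL Cs)[(codeL (Cs.take c)).length + 1 + t]? = some Cs[c][t] := by
  rw [codeL_split Cs hc, List.getElem?_append_right (by omega),
    show (codeL (Cs.take c)).length + 1 + t - (codeL (Cs.take c)).length = t + 1 by omega,
    List.cons_append, List.getElem?_cons_succ, List.getElem?_append_left ht,
    List.getElem?_eq_getElem ht]

/-- Do `p` for each clause, where `p` has to move register `pos` to the next clause. -/
def walkP (i pos : ℕ) (p : Prog) : Prog :=
  forP i (.v 1) (iteP (.bin .lt (.v pos) (.v 1)) p .skip)

/-- The number of clauses is not part of the input, only the length of the code is. The loop makes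
one round per code entry, which is enough, and the guard on `pos` makes the surplus rounds idle;
hence the `min` in the invariant. -/
theorem tot_walk {i pos Tb T : ℕ} {p : Prog} {s : NS} {Cs : List (List ℕ)} (hi : ¬ IsTemp i)
    (hp : ¬ IsTemp pos) (hw : (codeL Cs).length + 1 < wsz w)
    (Inv : ℕ → NS → Prop)
    (hI : ∀ c s v, Inv c s → Inv c (s.setR i v))
    (hlen : ∀ c s, Inv c s → s.reg 1 = (codeL Cs).length)
    (hpos : ∀ c s, Inv c s → s.reg pos = (codeL (Cs.take c)).length)
    (hb : ∀ c (_ : c < Cs.length) s, Inv c s →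
      Tot w p Tb s fun s' => s'.reg i = s.reg i ∧ Inv (c + 1) s')
    (h0 : Inv 0 s) (hT : ((codeL Cs).length + 1) * (Tb + 40) ≤ T) :
    Tot w (walkP i pos p) T s (Inv Cs.length) := by
  refine Tot.mono (T := T) (tot_for (Tb := Tb + 10) hi hw (by simp)
    (fun j s => s.reg i = j ∧ Inv (min j Cs.length) s) ?_ ?_ ?_ ?_) le_rfl ?_
  · rintro j - s ⟨h1, h2⟩
    refine ⟨h1, by simp, ?_⟩
    simpa using hlen _ _ h2
  · rintro j hj s ⟨h1, h2⟩
    have hl := hlen _ _ h2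
    have hps := hpos _ _ h2
    refine ewp_ite (T := Tb + 10) ⟨by simp, ?_⟩ (by simp) ?_ ?_
    · simp only [Ex.safe_bin, Ex.safe_v, BinOp.Safe]
      exact ⟨hp, by simp, by omega⟩
    · intro hv
      have hjc : j < Cs.length := by
        by_contra hge
        rw [min_eq_right (by omega), List.take_length] at hps
        simp [hl, hps] at hv
      rw [min_eq_left hjc.le] at h2
      refine (Tot.mono (hb j hjc s h2) (by simp) ?_)
      rintro s' ⟨h3, h4⟩
      refine ⟨by rw [h3, h1], by simp, ?_⟩
      rw [min_eq_left (by omega)]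
      exact hI _ _ _ h4
    · intro hv
      have hjc : Cs.length ≤ j := by
        by_contra hge
        rw [min_eq_left (by omega)] at hps
        have := length_codeL_take_le Cs (show j < Cs.length by omega)
        simp [hl, hps] at hv
        omega
      refine blk_nil (by simp) (ind_of ⟨h1, by simp, ?_⟩).ge
      rw [min_eq_right (by omega)] at h2 ⊢
      exact hI _ _ _ h2
  · exact ⟨by simp, by simpa using hI _ _ _ h0⟩
  · simp only [Ex.cost_v]; nlinarith
  · rintro s' ⟨h1, h2⟩
    rwa [min_eq_right (length_le_length_codeL Cs)] at h2

/-- The `i`-th bit of `x`. -/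
def bitE (x i : Ex) : Ex := .bin .and (.bin .shr x i) (.c 1)

@[simp] theorem val_bitE (s : NS) (x i : Ex) :
    (bitE x i).val s = x.val s / 2 ^ i.val s % 2 := by
  simp [bitE, Nat.and_one_is_mod]

@[simp] theorem safe_bitE (W : ℕ) (s : NS) (x i : Ex) :
    (bitE x i).Safe W s ↔ (x.Safe W s ∧ i.Safe W s) ∧ 1 < W := by
  simp [bitE]

@[simp] theorem depth_bitE (x i : Ex) :
    (bitE x i).depth = max (max x.depth (i.depth + 1)) 1 := by
  simp [bitE]

@[simp] theorem cost_bitE (x i : Ex) : (bitE x i).cost = x.cost + i.cost + 7 := by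
  simp [bitE]

/-- The literal with code `l` is true under the assignment with bits `x`. -/
def litTrue (x l : ℕ) : Bool := x / 2 ^ (l / 2) % 2 = l % 2

/-- All clauses are true under the assignment with bits `x`. -/
def clausesTrue (x : ℕ) (Cs : List (List ℕ)) : Bool := Cs.all fun C => C.any (litTrue x)

/-- Put into register `13` whether the assignment in register `12` satisfies the formula. -/
def clausesP : Prog := blk [
  assign 13 (.c 1),
  assign 14 (.c 0),
  walkP 15 14 (blk [
    assign 16 (.ld 1 (.v 14)),
    assign 17 (.c 0),
    forP 18 (.v 16) (blk [
      assign 19 (.ld 1 (.v 14 + .c 1 + .v 18)),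
      iteP (.bin .eq (bitE (.v 12) (.bin .shr (.v 19) (.c 1))) (.bin .and (.v 19) (.c 1)))
        (assign 17 (.c 1)) .skip]),
    iteP (.v 17) .skip (assign 13 (.c 0)),
    assign 14 (.v 14 + .v 16 + .c 1)])]

theorem tot_clauseP {s : NS} {C : List ℕ} {pos : ℕ} (hw : C.length + 1 < wsz w)
    (hw' : pos + C.length + 1 < wsz w)
    (h14 : s.reg 14 = pos) (h16 : s.reg 16 = C.length)
    (h17 : s.reg 17 = 0) (hC : ∀ t (ht : t < C.length), s.mem 1 (pos + 1 + t) = C[t]) :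
    Tot w (forP 18 (.v 16) (blk [
      assign 19 (.ld 1 (.v 14 + .c 1 + .v 18)),
      iteP (.bin .eq (bitE (.v 12) (.bin .shr (.v 19) (.c 1))) (.bin .and (.v 19) (.c 1)))
        (assign 17 (.c 1)) .skip])) ((C.length + 1) * 100) s
      (fun s' => Fr 17 100 s s' ∧ s'.reg 17 = (C.any (litTrue (s.reg 12))).toNat) := by
  refine Tot.mono (tot_for (Tb := 60) (by simp) hw (by simp) (fun t s' => s'.reg 18 = t ∧
    Fr 17 100 s s' ∧ s'.reg 17 = ((C.take t).any (litTrue (s.reg 12))).toNat) ?_ ?_ ?_ le_rfl)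
    (by simp) ?_
  · rintro j hj s' ⟨h1, h2, h3⟩
    exact ⟨h1, by simp, by simp [h2.reg, h16]⟩
  · rintro j hj s' ⟨h1, h2, h3⟩
    have e14 : s'.reg 14 = pos := by rw [h2.reg 14 (by omega), h14]
    have e12 : s'.reg 12 = s.reg 12 := h2.reg 12 (by omega)
    have em : s'.mem 1 (pos + 1 + j) = C[j] := by rw [h2.mem 1 (by omega), hC]
    refine blk_assign (by simp) ⟨by simp, ?_⟩ (by simp) ?_
    · simp [e14, h1]; omega
    have htake : (C.take (j + 1)).any (litTrue (s.reg 12)) =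
        ((C.take j).any (litTrue (s.reg 12)) || litTrue (s.reg 12) C[j]) := by
      rw [List.take_succ_eq_append_getElem hj, List.any_append]; simp
    refine blk_cons (T₁ := 40) (by simp) (ewp_ite ⟨by simp, ?_⟩ (by simp) ?_ ?_)
    · simp; omega
    · intro hv
      refine le_trans ?_ ((ewp_assign ⟨by simp, by simp; omega⟩ (by simp)).trans
        (ewp_mono (by simp) fun _ => le_rfl))
      refine blk_nil (by simp) (ind_of ⟨by simpa using h1, by simp, ?_, ?_⟩).ge
      · exact (((h2.setR (by omega)).setR (by omega)).setR (by omega))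
      · have : litTrue (s.reg 12) C[j] = true := by
          simpa [e14, h1, e12, em, litTrue, Nat.and_one_is_mod] using hv
        simp [htake, this]
    · intro hv
      refine blk_nil (by simp) (blk_nil (by simp) (ind_of ⟨by simpa using h1, by simp, ?_, ?_⟩).ge)
      · exact ((h2.setR (by omega)).setR (by omega))
      · have : litTrue (s.reg 12) C[j] = false := by
          simpa [e14, h1, e12, em, litTrue, Nat.and_one_is_mod] using hv
        simp [htake, this, h3]
  · exact ⟨by simp, (Fr.refl _ _ _).setR (by omega), by simp [h17]⟩
  · rintro s' ⟨-, h2, h3⟩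
    exact ⟨h2, by rwa [List.take_length] at h3⟩

theorem tot_clausesP {s : NS} {Cs : List (List ℕ)} {k : ℕ}
    (hw : (codeL Cs).length + 1 < wsz w) (hk : ∀ C ∈ Cs, C.length ≤ k)
    (h1 : s.reg 1 = (codeL Cs).length) (hm : Holds (s.mem 1) (codeL Cs)) :
    Tot w clausesP (((codeL Cs).length + 1) * ((k + 1) * 100 + 200) + 50) s
      (fun s' => Fr 13 100 s s' ∧ s'.reg 13 = (clausesTrue (s.reg 12) Cs).toNat) := by
  refine blk_assign (by simp) ⟨by simp, by simp; omega⟩ (by simp) ?_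
  refine blk_assign (by simp) ⟨by simp, by simp; omega⟩ (by simp) ?_
  refine blk_tot (tot_walk (Tb := (k + 1) * 100 + 100) (Cs := Cs) (by simp) (by simp) hw (fun c s' => Fr 13 100 s s' ∧ s'.reg 14 = (codeL (Cs.take c)).length ∧
      s'.reg 13 = (clausesTrue (s.reg 12) (Cs.take c)).toNat) ?_ ?_ ?_ ?_ ?_ le_rfl) ?_ ?_
  · rintro c s' v ⟨h2, h3, h4⟩
    exact ⟨h2.setR (by omega), by simpa using h3, by simpa using h4⟩
  · rintro c s' ⟨h2, h3, h4⟩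
    rw [h2.reg 1 (by omega), h1]
  · rintro c s' ⟨h2, h3, h4⟩
    exact h3
  · rintro c hc s' ⟨h2, h3, h4⟩
    have hle := length_codeL_take_le Cs hc
    have hkc := hk _ (List.getElem_mem hc)
    have em : s'.mem 1 = s.mem 1 := h2.mem 1 (by omega)
    refine blk_assign (by simp) ⟨by simp, by simp⟩ (by simp) ?_
    refine blk_assign (by simp) ⟨by simp, by simp; omega⟩ (by simp) ?_
    have e16 : s'.mem 1 (s'.reg 14) = Cs[c].length := by
      rw [em, h3]
      exact hm _ _ (codeL_getElem?_length Cs hc)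
    refine blk_tot (tot_clauseP (C := Cs[c]) (pos := (codeL (Cs.take c)).length) (by omega)
      (by omega) (by simp [h3]) (by simp [e16]) (by simp) ?_) (by simp; omega) ?_
    · intro t ht
      simp only [NS.setR_mem, em]
      exact hm _ _ (codeL_getElem?_lit Cs hc ht)
    rintro s₂ ⟨g1, g2⟩
    have r14 : s₂.reg 14 = (codeL (Cs.take c)).length := by simp [g1.reg, h3]
    have r16 : s₂.reg 16 = Cs[c].length := by simp [g1.reg, e16]
    have r13 : s₂.reg 13 = s'.reg 13 := by simp [g1.reg]
    have r15 : s₂.reg 15 = s'.reg 15 := by simp [g1.reg]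
    have gf : Fr 13 100 s s₂ :=
      h2.trans (((((Fr.refl _ _ _).setR (by omega)).setR (by omega))).trans (g1.mono (by omega) le_rfl))
    have e12 : s'.reg 12 = s.reg 12 := h2.reg 12 (by omega)
    have htake : clausesTrue (s.reg 12) (Cs.take (c + 1)) =
        (clausesTrue (s.reg 12) (Cs.take c) && Cs[c].any (litTrue (s.reg 12))) := by
      rw [List.take_succ_eq_append_getElem hc, clausesTrue, List.all_append]; simp [clausesTrue]
    simp only [NS.setR_reg, e12] at g2
    norm_num at g2
    refine blk_tot (T₁ := 10) (P := fun s₃ => Fr 13 100 s s₃ ∧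
      s₃.reg 14 = (codeL (Cs.take c)).length ∧ s₃.reg 16 = Cs[c].length ∧ s₃.reg 15 = s'.reg 15 ∧
      s₃.reg 13 = (clausesTrue (s.reg 12) (Cs.take (c + 1))).toNat)
      (ewp_ite ⟨by simp, by simp⟩ (by simp) ?_ ?_) (by simp; omega) ?_
    · intro hv
      refine blk_nil (by simp) (ind_of ⟨gf, r14, r16, r15, ?_⟩).ge
      simp only [Ex.val_v, g2] at hv
      rw [r13, h4, htake]
      cases h : (Cs[c].any (litTrue (s.reg 12)))
      · simp [h] at hv
      · simp
    · intro hv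
      refine le_trans ?_ ((ewp_assign ⟨by simp, by simp; omega⟩ (by simp)).trans
        (ewp_mono (by simp) fun _ => le_rfl))
      refine (ind_of ⟨gf.setR (by omega), by simpa using r14, by simpa using r16,
        by simpa using r15, ?_⟩).ge
      simp only [Ex.val_v, g2] at hv
      rw [htake]
      cases h : (Cs[c].any (litTrue (s.reg 12)))
      · simp
      · simp [h] at hv
    · rintro s₃ ⟨f1, f2, f3, f4, f5⟩
      refine blk_assign (by simp) ⟨by simp, ?_⟩ (by simp; omega) ?_
      · simp [f2, f3]; omega
      · refine blk_nil (by simp; omega) (ind_of ⟨by simpa using f4, f1.setR (by omega), ?_, ?_⟩).ge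
        · simp [f2, f3, length_codeL_take_succ Cs hc]
        · simpa using f5
  · exact ⟨((Fr.refl _ _ _).setR (by omega)).setR (by omega), by simp [codeL], by simp [clausesTrue]⟩
  · simp; nlinarith
  · rintro s' ⟨h2, h3, h4⟩
    rw [List.take_length] at h4
    refine blk_nil ?_ (ind_of ⟨h2, h4⟩).ge
    simp; ring_nf; omega

end WordRAM

namespace WordRAM

variable {w : ℕ}

/-! ### Exhaustive search -/

/-- The bits of `x` satisfy the `i`-th equation of the linear system in the arrays `A`, `b`. -/
def rowTrue (n : ℕ) (A b : ℕ → ℕ) (x i : ℕ) : Bool :=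
  (∑ j ∈ Finset.range n, A (i * n + j) * (x / 2 ^ j % 2)) % 2 = b i

/-- Set register `13` to `0` if the assignment in register `12` violates one of the equations. -/
def rowsP : Prog :=
  forP 15 (.v 3) (blk [
    assign 16 (.c 0),
    forP 17 (.v 10) (blk [
      assign 16 (.v 16 + .ld 2 (.v 15 * .v 10 + .v 17) * bitE (.v 12) (.v 17))]),
    iteP (.bin .eq (.bin .and (.v 16) (.c 1)) (.ld 3 (.v 15))) .skip (assign 13 (.c 0))])

/-- The sum is accumulated over the integers and reduced modulo `2` only by the caller. It is at
most the number of terms, which excludes overflow. -/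
theorem tot_rowSum {s : NS} {n i : ℕ} (hw : n + 1 < wsz w) (hw' : i * n + n < wsz w)
    (h10 : s.reg 10 = n) (h15 : s.reg 15 = i) (h16 : s.reg 16 = 0)
    (hA : ∀ j < n, s.mem 2 (i * n + j) ≤ 1) :
    Tot w (forP 17 (.v 10) (blk [
      assign 16 (.v 16 + .ld 2 (.v 15 * .v 10 + .v 17) * bitE (.v 12) (.v 17))]))
      ((n + 1) * 100) s (fun s' => Fr 16 100 s s' ∧
        s'.reg 16 = ∑ j ∈ Finset.range n, s.mem 2 (i * n + j) * (s.reg 12 / 2 ^ j % 2)) := by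
  refine Tot.mono (tot_for (Tb := 60) (by simp) hw (by simp) (fun t s' => s'.reg 17 = t ∧
    Fr 16 100 s s' ∧ s'.reg 16 ≤ t ∧
      s'.reg 16 = ∑ j ∈ Finset.range t, s.mem 2 (i * n + j) * (s.reg 12 / 2 ^ j % 2)) ?_ ?_ ?_ le_rfl)
    (by simp) ?_
  · rintro j hj s' ⟨h1, h2, h3, h4⟩
    exact ⟨h1, by simp, by simp [h2.reg, h10]⟩
  · rintro j hj s' ⟨h1, h2, h3, h4⟩
    have e10 : s'.reg 10 = n := by rw [h2.reg 10 (by omega), h10]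
    have e15 : s'.reg 15 = i := by rw [h2.reg 15 (by omega), h15]
    have e12 : s'.reg 12 = s.reg 12 := h2.reg 12 (by omega)
    have em : s'.mem 2 = s.mem 2 := h2.mem 2 (by omega)
    have hb : s.mem 2 (i * n + j) * (s.reg 12 / 2 ^ j % 2) ≤ 1 :=
      (Nat.mul_le_mul (hA j hj) (show _ ≤ 1 by omega)).trans (by simp)
    refine blk_assign (by simp) ⟨by simp, ?_⟩ (by simp) ?_
    · simp [e10, e15, e12, em, h1]
      refine ⟨⟨⟨by omega, by omega⟩, by omega, by omega⟩, by omega⟩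
    · refine blk_nil (by simp) (ind_of ⟨by simpa using h1, by simp, ?_, ?_, ?_⟩).ge
      · exact (h2.setR (by omega)).setR (by omega)
      · simp [e10, e15, e12, em, h1]; omega
      · simp [e10, e15, e12, em, h1, Finset.sum_range_succ, h4]
  · exact ⟨by simp, (Fr.refl _ _ _).setR (by omega), by simp [h16], by simp [h16]⟩
  · rintro s' ⟨-, h2, h3, h4⟩
    exact ⟨h2, h4⟩

theorem tot_rowsP {s : NS} {n m : ℕ} {ok : Bool} (hw : n + 1 < wsz w) (hw' : m * n + 1 < wsz w)
    (hwm : m + 1 < wsz w) (h10 : s.reg 10 = n) (h3 : s.reg 3 = m) (h13 : s.reg 13 = ok.toNat)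
    (hA : ∀ i < m, ∀ j < n, s.mem 2 (i * n + j) ≤ 1) :
    Tot w rowsP ((m + 1) * ((n + 1) * 100 + 100)) s (fun s' => Fr 13 100 s s' ∧
      s'.reg 13 = (ok && (List.range m).all (rowTrue n (s.mem 2) (s.mem 3) (s.reg 12))).toNat) := by
  refine Tot.mono (tot_for (Tb := (n + 1) * 100 + 60) (by simp) hwm (by simp)
    (fun i s' => s'.reg 15 = i ∧ Fr 13 100 s s' ∧
      s'.reg 13 = (ok && (List.range i).all (rowTrue n (s.mem 2) (s.mem 3) (s.reg 12))).toNat)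
      ?_ ?_ ?_ le_rfl) (by simp) ?_
  · rintro j hj s' ⟨h1, h2, -⟩
    exact ⟨h1, by simp, by simp [h2.reg, h3]⟩
  · rintro i hi s' ⟨h1, h2, g3⟩
    have e10 : s'.reg 10 = n := by rw [h2.reg 10 (by omega), h10]
    have e12 : s'.reg 12 = s.reg 12 := h2.reg 12 (by omega)
    have em : s'.mem 2 = s.mem 2 := h2.mem 2 (by omega)
    have em3 : s'.mem 3 = s.mem 3 := h2.mem 3 (by omega)
    have hin : i * n + n ≤ m * n := by nlinarith
    refine blk_assign (by simp) ⟨by simp, by simp; omega⟩ (by simp) ?_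
    refine blk_tot (tot_rowSum (n := n) (i := i) hw (by omega) (by simp [e10]) (by simp [h1])
      (by simp) (by simpa [em] using hA i hi)) (by simp) ?_
    rintro s₂ ⟨g1, g2⟩
    simp only [NS.setR_reg, NS.setR_mem, em, e12] at g2
    norm_num at g2
    have r13 : s₂.reg 13 = s'.reg 13 := by simp [g1.reg]
    have r15 : s₂.reg 15 = i := by simp [g1.reg, h1]
    have m3 : s₂.mem 3 = s.mem 3 := by simp [g1.mem, em3]
    have gf : Fr 13 100 s s₂ :=
      h2.trans ((((Fr.refl _ _ _).setR (by omega))).trans (g1.mono (by omega) le_rfl))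
    have hall : (List.range (i + 1)).all (rowTrue n (s.mem 2) (s.mem 3) (s.reg 12)) =
      ((List.range i).all (rowTrue n (s.mem 2) (s.mem 3) (s.reg 12)) &&
        rowTrue n (s.mem 2) (s.mem 3) (s.reg 12) i) := by
      rw [List.range_succ, List.all_append]; simp
    have hrow : rowTrue n (s.mem 2) (s.mem 3) (s.reg 12) i = decide (s₂.reg 16 % 2 = s.mem 3 i) := by
      rw [g2, rowTrue]
    refine blk_cons (T₁ := 20) (by simp) (ewp_ite ⟨by simp, by simp; omega⟩ (by simp) ?_ ?_)
    · intro hv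
      simp [Nat.and_one_is_mod, r15, m3] at hv
      refine blk_nil (by simp) (blk_nil (by simp) (ind_of ⟨r15, by simp, ?_, ?_⟩).ge)
      · exact gf.setR (by omega)
      · simp [r13, g3, hall, hrow, hv]
    · intro hv
      simp [Nat.and_one_is_mod, r15, m3] at hv
      refine le_trans ?_ ((ewp_assign ⟨by simp, by simp; omega⟩ (by simp)).trans
        (ewp_mono (by simp) fun _ => le_rfl))
      refine (blk_nil (by simp) (ind_of ⟨by simpa using r15, by simp, ?_, ?_⟩).ge)
      · exact (gf.setR (by omega)).setR (by omega)
      · simp [hall, hrow, hv]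
  · exact ⟨by simp, (Fr.refl _ _ _).setR (by omega), by simp [h13]⟩
  · rintro s' ⟨-, h2, h3⟩
    exact ⟨h2, h3⟩

/-- Decide the satisfiability of a formula with a linear system by exhaustive search. -/
def bruteP : Prog := blk [
  assign 10 (.ld 0 (.c 0)),
  assign 11 (.c 0),
  forP 12 (.bin .shl (.c 1) (.v 10)) (blk [
    clausesP,
    rowsP,
    iteP (.v 13) (assign 11 (.c 1)) .skip]),
  assign 0 (.v 11)]

/-- The time bound for `bruteP`. -/
def bruteT (k len n m : ℕ) : ℕ :=
  (2 ^ n + 1) * ((len + 1) * ((k + 1) * 100 + 200) + (m + 1) * ((n + 1) * 100 + 100) + 150) + 100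

theorem tot_bruteP {s : NS} {Cs : List (List ℕ)} {k n m : ℕ} (hwn : 2 ^ n + n + 1 < wsz w)
    (hw : (codeL Cs).length + 1 < wsz w) (hk : ∀ C ∈ Cs, C.length ≤ k)
    (hw' : m * n + 1 < wsz w) (hwm : m + 1 < wsz w) (hn : s.mem 0 0 = n)
    (h1 : s.reg 1 = (codeL Cs).length) (hm : Holds (s.mem 1) (codeL Cs))
    (h3 : s.reg 3 = m) (hA : ∀ i < m, ∀ j < n, s.mem 2 (i * n + j) ≤ 1) :
    Tot w bruteP (bruteT k (codeL Cs).length n m) s (fun s' => s'.reg 0 =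
      ((List.range (2 ^ n)).any fun x => clausesTrue x Cs &&
        (List.range m).all (rowTrue n (s.mem 2) (s.mem 3) x)).toNat) := by
  have h2n : 1 ≤ 2 ^ n := Nat.one_le_two_pow
  set good : ℕ → Bool := fun x => clausesTrue x Cs &&
        (List.range m).all (rowTrue n (s.mem 2) (s.mem 3) x)
  set TC := ((codeL Cs).length + 1) * ((k + 1) * 100 + 200) + 50 with hTC
  set TR := (m + 1) * ((n + 1) * 100 + 100) with hTR
  have hT : bruteT k (codeL Cs).length n m = (2 ^ n + 1) * (TC + TR + 100) + 100 := by
    rw [bruteT, hTC, hTR]; ring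
  rw [hT]
  refine blk_assign (by simp) ⟨by simp, by simp; omega⟩ (by simp) ?_
  refine blk_assign (by simp) ⟨by simp, by simp; omega⟩ (by simp) ?_
  refine blk_tot (tot_for (N := 2 ^ n) (Tb := TC + TR + 40) (by simp) (by omega) (by simp)
    (fun x s' => s'.reg 12 = x ∧ Fr 10 100 s s' ∧ s'.reg 10 = n ∧
      s'.reg 11 = ((List.range x).any good).toNat) ?_ ?_ ?_ le_rfl) ?_ ?_
  · rintro j hj s' ⟨g1, g2, g3, g4⟩
    exact ⟨g1, by simp [g3]; omega, by simp [g3]⟩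
  · rintro x hx s' ⟨g1, g2, g3, g4⟩
    refine blk_tot (tot_clausesP hw hk (by rw [g2.reg 1 (by omega), h1])
      (by rw [g2.mem 1 (by omega)]; exact hm)) (by omega) ?_
    rintro s₂ ⟨f1, f2⟩
    have em2 : s₂.mem 2 = s.mem 2 := by rw [f1.mem 2 (by omega), g2.mem 2 (by omega)]
    have em3 : s₂.mem 3 = s.mem 3 := by rw [f1.mem 3 (by omega), g2.mem 3 (by omega)]
    refine blk_tot (tot_rowsP (n := n) (m := m) (by omega) hw' hwm
      (by rw [f1.reg 10 (by omega), g3]) (by rw [f1.reg 3 (by omega), g2.reg 3 (by omega), h3]) f2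
      (by rw [em2]; exact hA)) (by omega) ?_
    rintro s₃ ⟨d1, d2⟩
    rw [em2, em3, f1.reg 12 (by omega), g1] at d2
    clear_value TC TR
    have hg : s₃.reg 13 = (good x).toNat := d2
    have hfr : Fr 10 100 s s₃ := g2.trans ((f1.trans d1).mono (by omega) le_rfl)
    have r12 : s₃.reg 12 = x := by rw [d1.reg 12 (by omega), f1.reg 12 (by omega), g1]
    have r10 : s₃.reg 10 = n := by rw [d1.reg 10 (by omega), f1.reg 10 (by omega), g3]
    have r11 : s₃.reg 11 = ((List.range x).any good).toNat := by rw [d1.reg 11 (by omega), f1.reg 11 (by omega), g4]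
    have hany : (List.range (x + 1)).any good = ((List.range x).any good || good x) := by
      rw [List.range_succ, List.any_append]; simp
    refine blk_cons (T₁ := 20) (by omega) (ewp_ite ⟨by simp, by simp⟩ (by simp) ?_ ?_)
    · intro hv
      refine le_trans ?_ ((ewp_assign ⟨by simp, by simp; omega⟩ (by simp)).trans
        (ewp_mono (by simp) fun _ => le_rfl))
      refine blk_nil (by omega) (ind_of ⟨by simpa using r12, by simp, ?_, ?_, ?_⟩).ge
      · exact (hfr.setR (by omega)).setR (by omega)
      · simpa using r10
      · have : good x = true := by
          cases h : good x
          · simp [hg, h] at hv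
          · rfl
        simp only [hany, this]; simp
    · intro hv
      refine blk_nil (by simp) (blk_nil (by omega) (ind_of ⟨r12, by simp, ?_, ?_, ?_⟩).ge)
      · exact (hfr.setR (by omega))
      · simpa using r10
      · have : good x = false := by
          cases h : good x
          · rfl
          · simp [hg, h] at hv
        simp only [hany, this]; simpa using r11
  · refine ⟨by simp, ?_, by simp [hn], by simp⟩
    exact (((Fr.refl _ _ _).setR (by omega)).setR (by omega)).setR (by omega)
  · clear_value TC TR; simp; ring_nf; omega
  · rintro s' ⟨g1, g2, g3, g4⟩
    clear_value TC TR
    refine blk_assign (by simp) ⟨by simp, by simp⟩ (by simp; ring_nf; omega) ?_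
    refine blk_nil (by simp; ring_nf; omega) (ind_of ?_).ge
    simpa using g4

end WordRAM

/-! ### Literals, assignments, formulae and matrices as numbers -/

/-- The code of a literal. -/
def litCode {n : ℕ} (l : Fin n × ZMod 2) : ℕ := 2 * (l.1 : ℕ) + l.2.val

/-- The assignment given by the bits of `x`. -/
def bitAssign (n x : ℕ) : Fin n → ZMod 2 := fun i => ((x / 2 ^ (i : ℕ) : ℕ) : ZMod 2)

theorem litCode_lt {n : ℕ} (l : Fin n × ZMod 2) : litCode l < 2 * n := by
  have := l.1.isLt
  have h2 : l.2.val < 2 := ZMod.val_lt _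
  unfold litCode
  omega

theorem exists_bitAssign {n : ℕ} (x : Fin n → ZMod 2) : ∃ y < 2 ^ n, bitAssign n y = x := by
  induction n with
  | zero => exact ⟨0, by simp, Subsingleton.elim _ _⟩
  | succ n ih =>
    obtain ⟨y, hy, h⟩ := ih fun i => x i.castSucc
    have h2 : (x (Fin.last n)).val < 2 := ZMod.val_lt _
    refine ⟨y + 2 ^ n * (x (Fin.last n)).val, ?_, ?_⟩
    · rw [pow_succ]
      have : 2 ^ n * (x (Fin.last n)).val ≤ 2 ^ n * 1 := Nat.mul_le_mul_left _ (by omega)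
      omega
    · funext i
      refine Fin.lastCases ?_ (fun i => ?_) i
      · simp only [bitAssign, Fin.val_last]
        rw [Nat.add_mul_div_left _ _ (by positivity), Nat.div_eq_of_lt hy, zero_add]
        simp
      · rw [← congrFun h i]
        simp only [bitAssign, Fin.val_castSucc]
        have hi : n = i + 1 + (n - i - 1) := by omega
        have h3 : ∀ v : ℕ, 2 ^ n * v = 2 ^ (i : ℕ) * (2 * (2 ^ (n - i - 1) * v)) := by
          intro v
          conv_lhs => rw [hi]
          ring
        rw [h3, Nat.add_mul_div_left _ _ (by positivity), Nat.cast_add, Nat.cast_mul]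
        have : ((2 : ℕ) : ZMod 2) = 0 := rfl
        rw [this]; ring

theorem bitAssign_eq_iff {n : ℕ} (x : ℕ) (l : Fin n × ZMod 2) :
    bitAssign n x l.1 = l.2 ↔ WordRAM.litTrue x (litCode l) = true := by
  have h2 : l.2.val < 2 := ZMod.val_lt _
  have h3 : litCode l / 2 = l.1 := by unfold litCode; omega
  have h4 : litCode l % 2 = l.2.val := by unfold litCode; omega
  simp only [WordRAM.litTrue, h3, h4, bitAssign, decide_eq_true_eq]
  rw [← ZMod.val_natCast]
  exact (ZMod.val_injective 2).eq_iff.symm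

namespace KCNF
variable {k n : ℕ} (F : KCNF k n)

/-- The clauses with their literals as numbers. -/
def codes : List (List ℕ) := F.clauses.map fun C => C.map litCode

theorem code_eq : F.code = WordRAM.codeL F.codes := by
  simp [code, WordRAM.codeL, codes, Function.comp_def]
  rfl

theorem codes_width : ∀ C ∈ F.codes, C.length ≤ k := by
  intro C hC
  simp only [codes, List.mem_map] at hC
  obtain ⟨D, hD, rfl⟩ := hC
  simpa using F.width D hD

theorem sat_bitAssign (x : ℕ) : F.Sat (bitAssign n x) ↔ WordRAM.clausesTrue x F.codes = true := by
  simp [Sat, WordRAM.clausesTrue, codes, bitAssign_eq_iff]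

/-- The number of clauses is polynomial. -/
theorem length_clauses_le : F.clauses.length ≤ (2 * n + 1) ^ k := by
  -- A clause of at most `k` literals is determined by its entries at the positions below `k`, with
  -- `none` beyond its end, and there are `(2 n + 1) ^ k` such patterns. Without `F.nodup` the
  -- number of clauses would not be bounded in terms of `n`.
  let g : List (Fin n × ZMod 2) → (Fin k → Option (Fin n × ZMod 2)) := fun C i => C[(i : ℕ)]?
  have hinj : ∀ C ∈ F.clauses, ∀ D ∈ F.clauses, g C = g D → C = D := by
    intro C hC D hD h
    apply List.ext_getElem?
    intro i
    by_cases hi : i < k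
    · exact congrFun h ⟨i, hi⟩
    · have := F.width C hC
      have := F.width D hD
      rw [List.getElem?_eq_none (by omega), List.getElem?_eq_none (by omega)]
  have hn : (F.clauses.map g).Nodup := (List.nodup_map_iff_inj_on F.nodup).2 hinj
  have := hn.length_le_card
  simpa [mul_comm] using this

theorem length_code_le : F.code.length ≤ (k + 1) * (2 * n + 1) ^ k := by
  have h : ∀ Cs : List (List ℕ), (∀ C ∈ Cs, C.length ≤ k) →
      (WordRAM.codeL Cs).length ≤ (k + 1) * Cs.length := by
    intro Cs
    induction Cs with
    | nil => simp [WordRAM.codeL]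
    | cons C Cs ih =>
      intro hC
      rw [WordRAM.codeL_cons]
      have := ih fun D hD => hC D (by simp [hD])
      have := hC C (by simp)
      simp
      linarith
  rw [F.code_eq]
  refine (h _ F.codes_width).trans ?_
  simp only [codes, List.length_map]
  exact Nat.mul_le_mul_left _ F.length_clauses_le

theorem le_of_mem_code : ∀ v ∈ F.code, v ≤ 2 * n + k := by
  intro v hv
  simp only [code, List.mem_flatten, List.mem_map] at hv
  obtain ⟨_, ⟨C, hC, rfl⟩, hv⟩ := hv
  rw [List.mem_cons] at hv
  rcases hv with rfl | hv
  · have := F.width C hC; omega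
  · rw [List.mem_map] at hv
    obtain ⟨l, -, rfl⟩ := hv
    have := litCode_lt l
    unfold litCode at this
    omega

end KCNF

namespace SparseInstance
variable {k s : ℕ} (I : SparseInstance k s)

/-- The matrix row by row. -/
def matCode : List ℕ := (List.ofFn fun i => List.ofFn fun j => (I.A i j).val).flatten

/-- The right-hand side. -/
def rhsCode : List ℕ := List.ofFn fun i => (I.b i).val

theorem encode_eq : I.encode = [[I.n], I.F.code, I.matCode, I.rhsCode] := rfl

theorem length_matCode : I.matCode.length = I.m * I.n := by
  simp [matCode, Function.comp_def]

theorem length_rhsCode : I.rhsCode.length = I.m := by simp [rhsCode]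

theorem matCode_getElem? (i : Fin I.m) (j : Fin I.n) :
    I.matCode[(i : ℕ) * I.n + j]? = some (I.A i j).val := by
  have hj : 0 < I.n := j.pos
  have : I.matCode = List.ofFn fun t : Fin (I.m * I.n) => (I.A t.divNat t.modNat).val := by
    rw [List.ofFn_mul, matCode]
    congr 2
    funext i
    congr 1
    funext j
    congr 2
    · ext
      simp [Nat.mul_comm _ I.n, Nat.mul_add_div hj, Nat.div_eq_of_lt j.isLt]
    · ext
      simp [Nat.mod_eq_of_lt j.isLt]
  have hlt : (i : ℕ) * I.n + j < I.m * I.n := by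
    have := Nat.mul_le_mul_right I.n (show (i : ℕ) + 1 ≤ I.m from i.isLt)
    have := j.isLt
    nlinarith
  rw [this, List.getElem?_ofFn, dif_pos hlt]
  congr 3
  · ext
    simp [Nat.mul_comm _ I.n, Nat.mul_add_div hj, Nat.div_eq_of_lt j.isLt]
  · ext
    simp [Nat.mod_eq_of_lt j.isLt]

theorem matCode_le (v : ℕ) (hv : v ∈ I.matCode) : v ≤ 1 := by
  simp only [matCode, List.mem_flatten, List.mem_ofFn] at hv
  obtain ⟨_, ⟨i, rfl⟩, hv⟩ := hv
  rw [List.mem_ofFn] at hv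
  obtain ⟨j, rfl⟩ := hv
  exact Nat.le_of_lt_succ (ZMod.val_lt _)

theorem rhsCode_le (v : ℕ) (hv : v ∈ I.rhsCode) : v ≤ 1 := by
  simp only [rhsCode, List.mem_ofFn] at hv
  obtain ⟨i, rfl⟩ := hv
  exact Nat.le_of_lt_succ (ZMod.val_lt _)

end SparseInstance

/-! ### Input sizes, initial states and word length -/

namespace WordRAM

/-- The size of one array. -/
def lsize (l : List ℕ) : ℕ := (l.map (· + 1)).sum

theorem lsize_le {l : List ℕ} {N b : ℕ} (hl : l.length ≤ N) (hb : ∀ v ∈ l, v ≤ b) :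
    lsize l ≤ N * (b + 1) := by
  refine (List.sum_le_card_nsmul _ (b + 1) ?_).trans ?_
  · intro v hv
    rw [List.mem_map] at hv
    obtain ⟨u, hu, rfl⟩ := hv
    have := hb u hu
    omega
  · simp
    exact hl

theorem length_le_lsize (l : List ℕ) : l.length ≤ lsize l := by
  induction l with
  | nil => simp [lsize]
  | cons a l ih => simp [lsize] at ih ⊢; omega

theorem lsize_singleton (a : ℕ) : lsize [a] = a + 1 := by simp [lsize]

theorem size_eq (I : Input) : I.size = (I.map lsize).sum := rfl

end WordRAM

namespace WordRAM

theorem lsize_le_size {I : Input} {i : ℕ} {l : List ℕ} (h : I[i]? = some l) :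
    lsize l ≤ I.size := by
  rw [size_eq]
  exact List.single_le_sum (by simp) _ (List.mem_map.2 ⟨l, List.mem_of_getElem? h, rfl⟩)

theorem lt_lsize {l : List ℕ} {v : ℕ} (h : v ∈ l) : v < lsize l := by
  have : v + 1 ≤ lsize l :=
    List.single_le_sum (by simp) _ (List.mem_map.2 ⟨v, h, rfl⟩)
  omega

theorem view_initial {w : ℕ} {I : Input} {σ : State w} (hσ : IsInitial I σ)
    (hw : I.size < wsz w) {i : ℕ} {l : List ℕ} (hi : i < 50) (h : I[i]? = some l) :
    (view σ).reg i = l.length ∧ Holds ((view σ).mem i) l := by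
  obtain ⟨h1, h2⟩ := hσ i l h
  have hs := lsize_le_size h
  have hl := length_le_lsize l
  unfold wsz at hw
  constructor
  · have : ¬ IsTemp i := by simp [IsTemp]; omega
    simp only [view, h1, this, if_false, BitVec.toNat_ofNat]
    exact Nat.mod_eq_of_lt (by omega)
  · intro j v hj
    have hv := lt_lsize (List.mem_of_getElem? hj)
    have hjl : j < l.length := by
      by_contra hge
      rw [List.getElem?_eq_none (by omega)] at hj
      simp at hj
    have hj' : j < 2 ^ w := by omega
    simp only [view, h2 j v hj, hj', if_true, BitVec.toNat_ofNat]
    exact Nat.mod_eq_of_lt (by omega)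

theorem succeeds_of_tot {w t : ℕ} {P : Prog} {σ : State w} {good : State w → Prop}
    {Post : NS → Prop} (h : Tot w P t (view σ) fun _ => True)
    (h' : 2 / 3 ≤ ewp w P t (ind Post) (view σ)) (hg : ∀ σ' : State w, Post (view σ') → good σ') :
    Succeeds P σ t good := by
  classical
  refine succeeds_of_wpc ?_ ?_
  · refine (le_trans h (ewp_le σ)).trans (wpc_mono_fun _ _ fun σ' => ?_)
    rw [ind_of trivial]
  · refine (h'.trans (ewp_le σ)).trans (wpc_mono_fun _ _ fun σ' => ?_)
    by_cases hp : Post (view σ')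
    · rw [if_pos (hg _ hp), ind_of hp]
    · rw [ind, if_neg hp]; exact zero_le

/-- The word-length condition in usable form: a constant `c` in front of the logarithm means that
every quantity up to `X ^ c` fits into a word, apart from strictness. -/
theorem pow_le_of_logb_le {c w : ℕ} {X : ℝ} (hX : 0 < X) (h : c * Real.logb 2 X ≤ w) :
    X ^ c ≤ wsz w := by
  have : X ^ c = (2 : ℝ) ^ (c * Real.logb 2 X) := by
    rw [mul_comm, Real.rpow_mul (by norm_num), Real.rpow_logb (by norm_num) (by norm_num) hX,
      Real.rpow_natCast]
  rw [this, wsz]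
  push_cast
  rw [← Real.rpow_natCast]
  exact Real.rpow_le_rpow_of_exponent_le (by norm_num) h

end WordRAM

/-! ### Correctness and running time of exhaustive search -/

open WordRAM

theorem SparseInstance.satisfiable_iff {k s : ℕ} (I : SparseInstance k s) {A b : ℕ → ℕ}
    (hA : Holds A I.matCode) (hb : Holds b I.rhsCode) :
    I.Satisfiable ↔ ((List.range (2 ^ I.n)).any fun x => clausesTrue x I.F.codes &&
        (List.range I.m).all (rowTrue I.n A b x)) = true := by
  have hrow : ∀ (x : ℕ) (i : Fin I.m), I.A.mulVec (bitAssign I.n x) i = I.b i ↔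
      rowTrue I.n A b x i = true := by
    intro x i
    have hbi : b i = (I.b i).val := by
      refine hb _ _ ?_
      simp [SparseInstance.rhsCode]
    simp only [rowTrue, decide_eq_true_eq, hbi]
    rw [← ZMod.val_natCast, (ZMod.val_injective 2).eq_iff, Finset.sum_range]
    push_cast
    simp only [Matrix.mulVec, dotProduct, bitAssign]
    refine iff_of_eq (congrArg (· = I.b i) (Finset.sum_congr rfl fun j _ => ?_))
    rw [hA _ _ (I.matCode_getElem? i j)]
    simp
  have hall : ∀ x : ℕ, I.A.mulVec (bitAssign I.n x) = I.b ↔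
      (List.range I.m).all (rowTrue I.n A b x) = true := by
    intro x
    rw [funext_iff]
    simp only [hrow, List.all_eq_true, List.mem_range]
    exact ⟨fun h i hi => h ⟨i, hi⟩, fun h i => h i i.isLt⟩
  simp only [SparseInstance.Satisfiable, List.any_eq_true, List.mem_range, Bool.and_eq_true]
  constructor
  · rintro ⟨x, h1, h2⟩
    obtain ⟨y, hy, rfl⟩ := exists_bitAssign x
    exact ⟨y, hy, (I.F.sat_bitAssign y).1 h1, (hall y).1 h2⟩
  · rintro ⟨y, hy, h1, h2⟩
    exact ⟨bitAssign I.n y, (I.F.sat_bitAssign y).2 h1, (hall y).2 h2⟩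

/-- A polynomial bound for the length of the code of a formula. -/
theorem KCNF.length_code_le' {k n : ℕ} (F : KCNF k n) :
    F.code.length ≤ (k + 1) * 2 ^ k * (n + 1) ^ k := by
  refine F.length_code_le.trans ?_
  rw [mul_assoc, ← mul_pow]
  exact Nat.mul_le_mul_left _ (Nat.pow_le_pow_left (by omega) _)

theorem bruteT_le {k len n m c : ℕ} (hl : len ≤ c * (n + 1) ^ k) (hm : m ≤ n) :
    bruteT k len n m ≤
      (2 * ((c + 1) * ((k + 1) * 100 + 200) + 350) + 100) * (n + 1) ^ (k + 2) * 2 ^ n := by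
  have hN : 1 ≤ (n + 1) ^ k := Nat.one_le_pow _ _ (by omega)
  have h1 : (n + 1) ^ k ≤ (n + 1) ^ (k + 2) := Nat.pow_le_pow_right (by omega) (by omega)
  have h2 : (n + 1) ^ 2 ≤ (n + 1) ^ (k + 2) := Nat.pow_le_pow_right (by omega) (by omega)
  have h2n : 1 ≤ 2 ^ n := Nat.one_le_two_pow
  have aux : ∀ K M M' Y : ℕ, len ≤ c * M' → 1 ≤ M' → M' ≤ M → (n + 1) ^ 2 ≤ M → 1 ≤ Y →
      (Y + 1) * ((len + 1) * K + (m + 1) * ((n + 1) * 100 + 100) + 150) + 100 ≤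
        (2 * ((c + 1) * K + 350) + 100) * M * Y := by
    intro K M M' Y hl hM' h1 h2 hY
    have h3 : len + 1 ≤ (c + 1) * M := by nlinarith
    have h4 : (m + 1) * ((n + 1) * 100 + 100) ≤ 200 * M :=
      calc (m + 1) * ((n + 1) * 100 + 100) ≤ (n + 1) * ((n + 1) * 200) :=
            Nat.mul_le_mul (by omega) (by omega)
        _ = 200 * (n + 1) ^ 2 := by ring
        _ ≤ 200 * M := Nat.mul_le_mul_left _ h2
    have h5 := Nat.mul_le_mul_right K h3
    have h6 : (len + 1) * K + (m + 1) * ((n + 1) * 100 + 100) + 150 ≤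
        ((c + 1) * M * K + 350 * M) := by omega
    have h7 := Nat.mul_le_mul (show Y + 1 ≤ 2 * Y by omega) h6
    have h8 : 1 * 1 ≤ M * Y := Nat.mul_le_mul (hM'.trans h1) hY
    calc _ ≤ 2 * Y * ((c + 1) * M * K + 350 * M) + 100 * (M * Y) := by omega
      _ = _ := by ring
  exact aux _ _ _ _ hl hN h1 h2 h2n

/-- Exhaustive search shows that the infimum in the growth rate is taken over a nonempty set. -/
theorem exists_decider (k s : ℕ) : {β : ℝ | 0 < β ∧ ∃ (P : WordRAM.Prog) (C : ℝ) (d : ℕ),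
    WordRAM.Decides P SparseInstance.encode
      (fun I : SparseInstance k s => I.Satisfiable)
      (fun I => C * ((I.n : ℝ) + 1) ^ d * 2 ^ (β * I.n))}.Nonempty := by
  set C : ℕ := 2 * (((k + 1) * 2 ^ k + 1) * ((k + 1) * 100 + 200) + 350) + 100
  -- The exponent is `β = 1`, and the last `1` is the word-length constant: input size plus time
  -- already dominates every number that occurs. Nonemptiness matters because only then do elements
  -- of the set lie arbitrarily close to its infimum.
  refine ⟨1, one_pos, bruteP, C, k + 2, 1, ?_⟩
  intro I w hw σ hσ
  have hT : (bruteT k (codeL I.F.codes).length I.n I.m : ℝ) ≤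
      C * ((I.n : ℝ) + 1) ^ (k + 2) * 2 ^ (1 * (I.n : ℝ)) := by
    have hlen := I.F.length_code_le'
    rw [I.F.code_eq] at hlen
    have := bruteT_le hlen I.m_le
    rw [one_mul, Real.rpow_natCast]
    exact_mod_cast this
  refine ⟨_, hT, ?_⟩
  have hT' : (100 : ℝ) * 2 ^ I.n ≤ C * ((I.n : ℝ) + 1) ^ (k + 2) * 2 ^ (1 * (I.n : ℝ)) := by
    refine le_trans ?_ hT
    have : 100 * 2 ^ I.n ≤ bruteT k (codeL I.F.codes).length I.n I.m := by
      unfold bruteT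
      have : 2 ^ I.n * 100 ≤ (2 ^ I.n + 1) * (((codeL I.F.codes).length + 1) * ((k + 1) * 100 + 200) +
        (I.m + 1) * ((I.n + 1) * 100 + 100) + 150) := Nat.mul_le_mul (by omega) (by omega)
      omega
    exact_mod_cast this
  set T : ℝ := C * ((I.n : ℝ) + 1) ^ (k + 2) * 2 ^ (1 * (I.n : ℝ))
  have h2n : (1 : ℝ) ≤ 2 ^ I.n := one_le_pow₀ (by norm_num)
  have hX := pow_le_of_logb_le (by positivity) hw
  rw [pow_one] at hX
  have hnat : I.encode.size + 100 * 2 ^ I.n ≤ wsz w := by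
    have : (I.encode.size : ℝ) + 100 * 2 ^ I.n ≤ wsz w := by linarith
    exact_mod_cast this
  have h2n' : 1 ≤ 2 ^ I.n := Nat.one_le_two_pow
  have hn2 : I.n < 2 ^ I.n := Nat.lt_two_pow_self
  obtain ⟨-, v0⟩ := view_initial hσ (by omega) (i := 0) (by omega) (l := [I.n]) rfl
  obtain ⟨r1, v1⟩ := view_initial hσ (by omega) (i := 1) (by omega) (l := I.F.code) rfl
  obtain ⟨r2, v2⟩ := view_initial hσ (by omega) (i := 2) (by omega) (l := I.matCode) rfl
  obtain ⟨r3, v3⟩ := view_initial hσ (by omega) (i := 3) (by omega) (l := I.rhsCode) rfl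
  have l1 := (length_le_lsize _).trans (lsize_le_size (I := I.encode) (i := 1) (l := I.F.code) rfl)
  have l2 := (length_le_lsize _).trans (lsize_le_size (I := I.encode) (i := 2) (l := I.matCode) rfl)
  have l3 := (length_le_lsize _).trans (lsize_le_size (I := I.encode) (i := 3) (l := I.rhsCode) rfl)
  rw [I.length_matCode] at l2
  rw [I.length_rhsCode] at l3
  rw [I.F.code_eq] at l1 r1 v1
  have htot := tot_bruteP (w := w) (s := view σ) (Cs := I.F.codes) (k := k) (n := I.n) (m := I.m)
    (by omega) (by omega) I.F.codes_width (by omega) (by omega) (v0 0 _ rfl) r1 v1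
    (by rw [r3, I.length_rhsCode]) (fun i hi j hj => by
      rw [v2 _ _ (I.matCode_getElem? ⟨i, hi⟩ ⟨j, hj⟩)]
      exact Nat.le_of_lt_succ (ZMod.val_lt _))
  have hsat := I.satisfiable_iff v2 v3
  refine succeeds_of_tot (htot.mono le_rfl fun _ _ => trivial)
    (le_trans ?_ htot) fun σ' hσ' => ?_
  · exact ENNReal.div_le_of_le_mul (by norm_num)
  · have hw0 : w ≠ 0 := by
      rintro rfl
      simp [wsz] at hnat
      omega
    show (I.Satisfiable → σ'.reg 0 = 1) ∧ (¬ I.Satisfiable → σ'.reg 0 = 0)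
    rw [hsat]
    generalize ((List.range (2 ^ I.n)).any fun x => clausesTrue x I.F.codes &&
      (List.range I.m).all (rowTrue I.n ((view σ).mem 2) ((view σ).mem 3) x)) = b at hσ'
    have e : (σ'.reg 0).toNat = b.toNat := by simpa [view] using hσ'
    refine ⟨fun h => BitVec.eq_of_toNat_eq ?_, fun h => BitVec.eq_of_toNat_eq ?_⟩
    · rw [e, h]
      simp [Nat.mod_eq_of_lt (Nat.one_lt_two_pow hw0)]
    · rw [Bool.not_eq_true] at h
      rw [e, h]
      simp

open WordRAM

/-! ### The hash functions -/

/-- The number with binary digits `b`. -/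
def bval {l : ℕ} (b : Fin l → Bool) : ℕ := ∑ i : Fin l, 2 ^ (i : ℕ) * (b i).toNat

/-- The random choices for one equation: `s` words of `l` bits and the right-hand side. -/
abbrev RowKey (l s : ℕ) : Type := (Fin s → Fin l → Bool) × Bool

/-- The coefficients of an equation: the sum of the unit vectors at the chosen positions, where
positions beyond `n` are ignored. -/
def rowVec {l s : ℕ} (n : ℕ) (u : Fin s → Fin l → Bool) (j : Fin n) : ZMod 2 :=
  ∑ t, if bval (u t) = (j : ℕ) then 1 else 0

/-- The matrix of the hash function. -/
def hashMat {l s m : ℕ} (n : ℕ) (h : Fin m → RowKey l s) : Matrix (Fin m) (Fin n) (ZMod 2) :=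
  fun i => rowVec n (h i).1

/-- The right-hand side of the hash function. -/
def hashRhs {l s m : ℕ} (h : Fin m → RowKey l s) (i : Fin m) : ZMod 2 := ((h i).2.toNat : ℕ)

/-- Every column with a nonzero entry is named by one of the `s` words; repeated positions can only
cancel. -/
theorem hashMat_sparse {l s m n : ℕ} (h : Fin m → RowKey l s) (i : Fin m) :
    (Finset.univ.filter fun j => hashMat n h i j ≠ 0).card ≤ s := by
  have h1 : ∀ j ∈ Finset.univ.filter (fun j : Fin n => hashMat n h i j ≠ 0),
      ∃ t : Fin s, bval ((h i).1 t) = j := by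
    intro j hj
    by_contra hne
    push Not at hne
    refine (Finset.mem_filter.1 hj).2 ?_
    unfold hashMat rowVec
    exact Finset.sum_eq_zero fun t _ => if_neg (hne t)
  have h2 : (Finset.univ.filter fun j : Fin n => hashMat n h i j ≠ 0).image Fin.val ⊆
      Finset.univ.image fun t => bval ((h i).1 t) := by
    intro v hv
    obtain ⟨j, hj, rfl⟩ := Finset.mem_image.1 hv
    obtain ⟨t, ht⟩ := h1 j hj
    exact Finset.mem_image.2 ⟨t, Finset.mem_univ _, ht⟩
  rw [← Finset.card_image_of_injective _ Fin.val_injective]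
  refine (Finset.card_le_card h2).trans (Finset.card_image_le.trans ?_)
  simp

/-! ### Formulae with additional unit clauses -/

/-- The literal with a given code. -/
def litOf {n : ℕ} (l : Fin (2 * n)) : Fin n × ZMod 2 :=
  (⟨l / 2, by have := l.isLt; omega⟩, ((l : ℕ) : ZMod 2))

theorem litCode_litOf {n : ℕ} (l : Fin (2 * n)) : litCode (litOf l) = l := by
  simp only [litCode, litOf, ZMod.val_natCast]
  omega

theorem litCode_injective {n : ℕ} : Function.Injective (litCode (n := n)) := by
  rintro ⟨i, a⟩ ⟨j, b⟩ h
  have ha : a.val < 2 := ZMod.val_lt a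
  have hb : b.val < 2 := ZMod.val_lt b
  simp only [litCode] at h
  refine Prod.ext (Fin.ext (by simp only; omega)) (ZMod.val_injective 2 (by simp only; omega))

theorem litOf_litCode {n : ℕ} (l : Fin n × ZMod 2) : litOf ⟨litCode l, litCode_lt l⟩ = l :=
  litCode_injective (litCode_litOf _)

namespace KCNF
variable {k n : ℕ}

/-- Whether the unit clause with literal code `l` has to be added in order to fix the first `j`
variables to the bits of `p`. -/
def unitOk (F : KCNF k n) (j p l : ℕ) : Bool :=
  decide ([l] ∉ F.codes) && (decide (l / 2 < j) && litTrue p l)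

/-- The formula with the first `j` variables fixed to the bits of `p`. -/
def fix (F : KCNF k n) (hk : 1 ≤ k) (j p : ℕ) : KCNF k n where
  clauses := F.clauses ++
    ((List.finRange (2 * n)).filter fun l : Fin (2 * n) => F.unitOk j p l).map fun l => [litOf l]
  width := by
    intro C hC
    rw [List.mem_append] at hC
    rcases hC with hC | hC
    · exact F.width C hC
    · rw [List.mem_map] at hC
      obtain ⟨l, -, rfl⟩ := hC
      simpa using hk
  nodup := by
    refine List.Nodup.append F.nodup ?_ ?_
    · refine List.Nodup.map ?_ ((List.nodup_finRange _).filter _)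
      intro l l' h
      have h1 : litOf l = litOf l' := by simpa using h
      apply Fin.ext
      rw [← litCode_litOf l, ← litCode_litOf l', h1]
    · intro C hC hC'
      rw [List.mem_map] at hC'
      obtain ⟨l, hl, rfl⟩ := hC'
      have := (List.mem_filter.1 hl).2
      simp only [unitOk, Bool.and_eq_true, decide_eq_true_eq] at this
      apply this.1
      rw [codes, List.mem_map]
      exact ⟨_, hC, by simp [litCode_litOf]⟩

/-- The codes of the additional clauses with literal codes below `t`. -/
def unitCodes (F : KCNF k n) (j p t : ℕ) : List (List ℕ) :=
  ((List.range t).filter fun l => F.unitOk j p l).map fun l => [l]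

theorem codes_fix (F : KCNF k n) (hk : 1 ≤ k) (j p : ℕ) :
    (F.fix hk j p).codes = F.codes ++ F.unitCodes j p (2 * n) := by
  simp only [codes, fix, List.map_append, List.map_map, unitCodes]
  congr 1
  rw [← List.map_coe_finRange_eq_range, List.filter_map, List.map_map]
  refine List.map_congr_left fun l _ => ?_
  simp [litCode_litOf]

theorem mem_codes_singleton (F : KCNF k n) (l : Fin n × ZMod 2) :
    [litCode l] ∈ F.codes ↔ [l] ∈ F.clauses := by
  rw [codes, List.mem_map]
  constructor
  · rintro ⟨C, hC, h⟩
    have : C.map litCode = [l].map litCode := by simpa using h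
    rwa [(List.map_injective_iff.2 litCode_injective) this] at hC
  · intro h
    exact ⟨_, h, rfl⟩

theorem sat_fix (F : KCNF k n) (hk : 1 ≤ k) (j p : ℕ) (x : Fin n → ZMod 2) :
    (F.fix hk j p).Sat x ↔ F.Sat x ∧ ∀ i : Fin n, (i : ℕ) < j → x i = bitAssign n p i := by
  constructor
  · intro h
    refine ⟨fun C hC => h C (List.mem_append_left _ hC), fun i hi => ?_⟩
    set l : Fin n × ZMod 2 := (i, bitAssign n p i) with hl
    -- A unit clause already present in `F` must not be appended, because clauses may not repeat; it
    -- forces the value just the same.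
    have key : [l] ∈ (F.fix hk j p).clauses := by
      by_cases hm : [l] ∈ F.clauses
      · exact List.mem_append_left _ hm
      · refine List.mem_append_right _ (List.mem_map.2
          ⟨⟨litCode l, litCode_lt l⟩, List.mem_filter.2 ⟨List.mem_finRange _, ?_⟩, ?_⟩)
        · simp only [unitOk, Bool.and_eq_true, decide_eq_true_eq]
          refine ⟨by rwa [F.mem_codes_singleton], ?_, (bitAssign_eq_iff p l).1 rfl⟩
          have h2 : l.2.val < 2 := ZMod.val_lt _
          simp only [litCode]
          have : l.1 = i := rfl
          rw [this]
          omega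
        · rw [litOf_litCode]
    obtain ⟨l', hl', hx⟩ := h _ key
    rw [List.mem_singleton] at hl'
    rw [hl'] at hx
    exact hx
  · rintro ⟨h1, h2⟩ C hC
    rcases List.mem_append.1 hC with hC | hC
    · exact h1 C hC
    · obtain ⟨l, hl, rfl⟩ := List.mem_map.1 hC
      have := (List.mem_filter.1 hl).2
      simp only [unitOk, Bool.and_eq_true, decide_eq_true_eq] at this
      refine ⟨_, List.mem_singleton.2 rfl, ?_⟩
      rw [h2 (litOf l).1 this.2.1]
      rw [bitAssign_eq_iff, litCode_litOf]
      exact this.2.2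

/-- The query whether the hash bucket contains a solution that starts with the first `j` bits
of `p`. -/
def query (F : KCNF k n) (hk : 1 ≤ k) {l s m : ℕ} (hm : m ≤ n) (h : Fin m → RowKey l s)
    (j p : ℕ) : SparseInstance k s where
  n := n
  F := F.fix hk j p
  m := m
  m_le := hm
  A := hashMat n h
  sparse := hashMat_sparse h
  b := hashRhs h

open Classical in
/-- The number of solutions in the hash bucket that start with the first `j` bits of `p`. -/
noncomputable def bucket (F : KCNF k n) {l s m : ℕ} (h : Fin m → RowKey l s) (j p : ℕ) : ℕ :=
  (Finset.univ.filter fun x : Fin n → ZMod 2 => F.Sat x ∧ (hashMat n h).mulVec x = hashRhs h ∧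
    ∀ i : Fin n, (i : ℕ) < j → x i = bitAssign n p i).card

theorem query_satisfiable (F : KCNF k n) (hk : 1 ≤ k) {l s m : ℕ} (hm : m ≤ n)
    (h : Fin m → RowKey l s) (j p : ℕ) :
    (F.query hk hm h j p).Satisfiable ↔ F.bucket h j p ≠ 0 := by
  classical
  rw [bucket, Finset.card_ne_zero]
  simp only [SparseInstance.Satisfiable, query, sat_fix]
  constructor
  · rintro ⟨x, ⟨h1, h2⟩, h3⟩
    exact ⟨x, Finset.mem_filter.2 ⟨Finset.mem_univ _, h1, h3, h2⟩⟩
  · rintro ⟨x, hx⟩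
    simp only [Finset.mem_filter, Finset.mem_univ, true_and] at hx
    exact ⟨x, ⟨hx.1, hx.2.2⟩, hx.2.1⟩

theorem bitAssign_add {i j p a : ℕ} {n : ℕ} (q : Fin n) (hq : (q : ℕ) = i) (hi : i < j) :
    bitAssign n (p + 2 ^ j * a) q = bitAssign n p q := by
  subst hq
  simp only [bitAssign]
  have h3 : 2 ^ j * a = 2 ^ (q : ℕ) * (2 * (2 ^ (j - q - 1) * a)) := by
    conv_lhs => rw [show j = q + 1 + (j - q - 1) by omega]
    ring
  rw [h3, Nat.add_mul_div_left _ _ (by positivity), Nat.cast_add, Nat.cast_mul]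
  have : ((2 : ℕ) : ZMod 2) = 0 := rfl
  rw [this]; ring

theorem bitAssign_top {n j p a : ℕ} (q : Fin n) (hq : (q : ℕ) = j) (hp : p < 2 ^ j) :
    bitAssign n (p + 2 ^ j * a) q = (a : ZMod 2) := by
  subst hq
  simp only [bitAssign]
  rw [Nat.add_mul_div_left _ _ (by positivity), Nat.div_eq_of_lt hp, zero_add]

/-- The value of variable `j` decides: with `p < 2 ^ j`, the prefixes `p` and `p + 2 ^ j` of length
`j + 1` extend `p` by `0` and by `1`. -/
theorem bucket_split (F : KCNF k n) {l s m : ℕ} (h : Fin m → RowKey l s) {j p : ℕ} (hj : j < n)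
    (hp : p < 2 ^ j) :
    F.bucket h j p = F.bucket h (j + 1) p + F.bucket h (j + 1) (p + 2 ^ j) := by
  classical
  unfold bucket
  rw [← Finset.card_union_of_disjoint]
  · congr 1
    ext x
    simp only [Finset.mem_union, Finset.mem_filter, Finset.mem_univ, true_and]
    have e0 := bitAssign_top (a := 0) (⟨j, hj⟩ : Fin n) rfl hp
    have e1 := bitAssign_top (a := 1) (⟨j, hj⟩ : Fin n) rfl hp
    rw [mul_zero, add_zero] at e0
    rw [mul_one] at e1
    have hlow : ∀ i : Fin n, (i : ℕ) < j → bitAssign n (p + 2 ^ j) i = bitAssign n p i := by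
      intro i hi
      have := bitAssign_add (p := p) (a := 1) i rfl hi
      rwa [mul_one] at this
    constructor
    · rintro ⟨h1, h2, h3⟩
      have : x ⟨j, hj⟩ = 0 ∨ x ⟨j, hj⟩ = 1 := by
        generalize x ⟨j, hj⟩ = y
        revert y; decide
      rcases this with hx | hx
      · left
        refine ⟨h1, h2, fun i hi => ?_⟩
        rcases Nat.lt_succ_iff_lt_or_eq.1 hi with hi | hi
        · exact h3 i hi
        · have : i = ⟨j, hj⟩ := Fin.ext hi
          rw [this, hx, e0]; rfl
      · right
        refine ⟨h1, h2, fun i hi => ?_⟩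
        rcases Nat.lt_succ_iff_lt_or_eq.1 hi with hi | hi
        · rw [hlow i hi]; exact h3 i hi
        · have : i = ⟨j, hj⟩ := Fin.ext hi
          rw [this, hx, e1]; simp
    · rintro (⟨h1, h2, h3⟩ | ⟨h1, h2, h3⟩)
      · exact ⟨h1, h2, fun i hi => h3 i (by omega)⟩
      · exact ⟨h1, h2, fun i hi => by rw [h3 i (by omega), hlow i hi]⟩
  · rw [Finset.disjoint_left]
    intro x hx hx'
    simp only [Finset.mem_filter, Finset.mem_univ, true_and] at hx hx'
    have e0 := bitAssign_top (a := 0) (⟨j, hj⟩ : Fin n) rfl hp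
    have e1 := bitAssign_top (a := 1) (⟨j, hj⟩ : Fin n) rfl hp
    rw [mul_zero, add_zero] at e0
    rw [mul_one] at e1
    have h1 := hx.2.2 ⟨j, hj⟩ (by simp)
    have h2 := hx'.2.2 ⟨j, hj⟩ (by simp)
    rw [h1, e0, e1] at h2
    simp at h2

theorem bucket_leaf (F : KCNF k n) {l s m : ℕ} (h : Fin m → RowKey l s) (p : ℕ) :
    F.bucket h n p ≤ 1 := by
  classical
  unfold bucket
  rw [Finset.card_le_one]
  intro x hx y hy
  simp only [Finset.mem_filter, Finset.mem_univ, true_and] at hx hy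
  funext i
  rw [hx.2.2 i i.isLt, hy.2.2 i i.isLt]

end KCNF

namespace WordRAM

variable {w : ℕ}

/-! ### Writing down a query -/

/-- Write the instance for the query given by registers `24` and `25` to the arrays from `100`
on. -/
def buildP : Prog := blk [
  copyP 30 (.v 1) 1 101,
  assign 31 (.v 1),
  forP 32 (.v 10 + .v 10) (
    iteP (.bin .and (.bin .lt (.ld 4 (.v 32)) (.c 1))
        (.bin .and (.bin .lt (.bin .shr (.v 32) (.c 1)) (.v 24))
          (.bin .eq (bitE (.v 25) (.bin .shr (.v 32) (.c 1))) (.bin .and (.v 32) (.c 1)))))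
      (blk [
        storeP 101 (.v 31) (.c 1),
        storeP 101 (.v 31 + .c 1) (.v 32),
        assign 31 (.v 31 + .c 2)])
      .skip),
  copyP 30 (.v 19 * .v 10) 20 102,
  copyP 30 (.v 19) 21 103,
  storeP 100 (.c 0) (.v 10),
  assign 100 (.c 1),
  assign 101 (.v 31),
  assign 102 (.v 19 * .v 10),
  assign 103 (.v 19)]

/-- The time bound for `buildP`. -/
def buildT (len n m : ℕ) : ℕ :=
  (len + 1) * 60 + (2 * n + 1) * 160 + (m * n + 1) * 60 + (m + 1) * 60 + 200

/-- The formula `F` and the table of its unit clauses are in memory. -/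
structure HasFormula {k n : ℕ} (F : KCNF k n) (s : NS) : Prop where
  r1 : s.reg 1 = (codeL F.codes).length
  m1 : Holds (s.mem 1) (codeL F.codes)
  m4 : ∀ l < 2 * n, s.mem 4 l = if [l] ∈ F.codes then 1 else 0
  r10 : s.reg 10 = n

theorem HasFormula.of_fr {k n : ℕ} {F : KCNF k n} {s s' : NS} (h : HasFormula F s) {r a : ℕ}
    (hf : Fr r a s s') (hr : 11 ≤ r) (ha : 5 ≤ a) : HasFormula F s' :=
  ⟨by rw [hf.reg 1 (by omega), h.r1], by rw [hf.mem 1 (by omega)]; exact h.m1,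
    by rw [hf.mem 4 (by omega)]; exact h.m4, by rw [hf.reg 10 (by omega), h.r10]⟩

/-- A hash function is in memory. -/
structure HasHash {l s m : ℕ} (n : ℕ) (h : Fin m → RowKey l s) (σ : NS) : Prop where
  r19 : σ.reg 19 = m
  m20 : ∀ (i : Fin m) (j : Fin n), σ.mem 20 (i * n + j) = (hashMat n h i j).val
  m21 : ∀ i : Fin m, σ.mem 21 i = (hashRhs h i).val

theorem HasHash.of_fr {l s m n : ℕ} {h : Fin m → RowKey l s} {σ σ' : NS} (hh : HasHash n h σ)
    {r a : ℕ} (hf : Fr r a σ σ') (hr : 20 ≤ r) (ha : 22 ≤ a) : HasHash n h σ' :=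
  ⟨by rw [hf.reg 19 (by omega), hh.r19], by rw [hf.mem 20 (by omega)]; exact hh.m20,
    by rw [hf.mem 21 (by omega)]; exact hh.m21⟩

theorem HasHash.holds_matCode {k l s m n : ℕ} {F : KCNF k n} (hk : 1 ≤ k) (hm : m ≤ n)
    {h : Fin m → RowKey l s} {σ : NS} (hh : HasHash n h σ) (j p : ℕ) :
    Holds (σ.mem 20) (F.query hk hm h j p).matCode := by
  intro t v ht
  have hlt : t < (F.query hk hm h j p).matCode.length := by
    by_contra hge
    rw [List.getElem?_eq_none (by omega)] at ht
    simp at ht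
  rw [SparseInstance.length_matCode] at hlt
  have hlt' : t < m * n := hlt
  have hn : 0 < n := by
    rcases Nat.eq_zero_or_pos n with h0 | h0
    · subst h0; simp at hlt'
    · exact h0
  have e : t = t / n * n + t % n := by rw [mul_comm]; exact (Nat.div_add_mod t n).symm
  have h1 : t / n < m := (Nat.div_lt_iff_lt_mul hn).2 hlt'
  have h2 : t % n < n := Nat.mod_lt _ hn
  have h3 := (F.query hk hm h j p).matCode_getElem? ⟨t / n, h1⟩ ⟨t % n, h2⟩
  have h4 := hh.m20 ⟨t / n, h1⟩ ⟨t % n, h2⟩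
  have h5 : (F.query hk hm h j p).matCode[t / n * n + t % n]? =
    some (hashMat n h ⟨t / n, h1⟩ ⟨t % n, h2⟩).val := h3
  simp only at h4
  rw [← e] at h4 h5
  rw [h5] at ht
  rw [h4]
  simpa using ht

theorem HasHash.holds_rhsCode {k l s m n : ℕ} {F : KCNF k n} (hk : 1 ≤ k) (hm : m ≤ n)
    {h : Fin m → RowKey l s} {σ : NS} (hh : HasHash n h σ) (j p : ℕ) :
    Holds (σ.mem 21) (F.query hk hm h j p).rhsCode := by
  intro t v ht
  have hlt : t < (F.query hk hm h j p).rhsCode.length := by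
    by_contra hge
    rw [List.getElem?_eq_none (by omega)] at ht
    simp at ht
  rw [SparseInstance.length_rhsCode] at hlt
  have hlt' : t < m := hlt
  have h4 := hh.m21 ⟨t, hlt'⟩
  simp only at h4
  rw [h4]
  simp only [SparseInstance.rhsCode, List.getElem?_ofFn] at ht
  rw [dif_pos hlt] at ht
  exact Option.some.inj ht

theorem codeL_unitCodes_succ {k n : ℕ} (F : KCNF k n) (j p t : ℕ) :
    codeL (F.unitCodes j p (t + 1)) =
      codeL (F.unitCodes j p t) ++ if F.unitOk j p t then [1, t] else [] := by
  simp only [KCNF.unitCodes, List.range_succ, List.filter_append, List.map_append, codeL_append]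
  congr 1
  cases h : F.unitOk j p t <;> simp [codeL, h]

theorem length_codeL_unitCodes {k n : ℕ} (F : KCNF k n) (j p t : ℕ) :
    (codeL (F.unitCodes j p t)).length ≤ 2 * t := by
  induction t with
  | zero => simp [KCNF.unitCodes, codeL]
  | succ t ih =>
    rw [codeL_unitCodes_succ, List.length_append]
    split_ifs <;> simp <;> omega

theorem tot_buildP {k l s m n : ℕ} {F : KCNF k n} (hk : 1 ≤ k) (hm : m ≤ n)
    {h : Fin m → RowKey l s} {σ : NS} {j p : ℕ}
    (hw : (codeL F.codes).length + 4 * n + 2 < wsz w) (hw' : m * n + 1 < wsz w)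
    (hF : HasFormula F σ) (hh : HasHash n h σ) (h24 : σ.reg 24 = j) (h25 : σ.reg 25 = p) :
    Tot w buildP (buildT (codeL F.codes).length n m) σ fun σ' => Fr 30 100 σ σ' ∧
      ∀ (i : ℕ) (l : List ℕ), (F.query hk hm h j p).encode[i]? = some l →
        σ'.reg (100 + i) = l.length ∧ l.length < wsz w ∧ Holds (σ'.mem (100 + i)) l := by
  set len := (codeL F.codes).length with hlen
  have hmw : m + 1 < wsz w := by omega
  unfold buildT
  refine blk_tot (tot_copy (l := codeL F.codes) (by simp) (by simp) (by omega) (by simp) rfl hF.m1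
    (fun s' hr _ => ⟨by simp, by simp [hr, hF.r1]⟩) le_rfl) (by simp; ring_nf; omega) ?_
  rintro σ₁ ⟨a1, a2, a3⟩
  have f1 : Fr 30 100 σ σ₁ := ⟨fun i hi => a1 i (by omega), fun A hA => a2 A (by omega)⟩
  have r1 : σ₁.reg 1 = len := by rw [f1.reg 1 (by omega), hF.r1]
  refine blk_assign (by simp) ⟨by simp, by simp⟩ (by simp; ring_nf; omega) ?_
  refine blk_tot (tot_for (N := 2 * n) (Tb := 120) (by simp) (by omega) (by simp)
    (fun t s' => s'.reg 32 = t ∧ Fr 30 100 σ s' ∧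
      s'.reg 31 = (codeL F.codes ++ codeL (F.unitCodes j p t)).length ∧
      Holds (s'.mem 101) (codeL F.codes ++ codeL (F.unitCodes j p t))) ?_ ?_ ?_ le_rfl)
      (by simp; ring_nf; omega) ?_
  · rintro t ht s' ⟨g1, g2, g3⟩
    have : s'.reg 10 = n := by rw [g2.reg 10 (by omega), hF.r10]
    exact ⟨g1, by simp [this]; omega, by simp [this]; omega⟩
  · rintro t ht s' ⟨g1, g2, g3, g4⟩
    have hul := length_codeL_unitCodes F j p t
    have e4 : s'.mem 4 t = if [t] ∈ F.codes then 1 else 0 := by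
      rw [g2.mem 4 (by omega), hF.m4 t ht]
    have e24 : s'.reg 24 = j := by rw [g2.reg 24 (by omega), h24]
    have e25 : s'.reg 25 = p := by rw [g2.reg 25 (by omega), h25]
    have hval : (Ex.bin .and (.bin .lt (.ld 4 (.v 32)) (.c 1))
        (.bin .and (.bin .lt (.bin .shr (.v 32) (.c 1)) (.v 24))
          (.bin .eq (bitE (.v 25) (.bin .shr (.v 32) (.c 1))) (.bin .and (.v 32) (.c 1))))).val s' =
        (F.unitOk j p t).toNat := by
      simp only [Ex.val_bin, BinOp.nat, Ex.val_ld, Ex.val_v, Ex.val_c, val_bitE, g1, e4, e24, e25,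
        pow_one, Nat.and_one_is_mod, KCNF.unitOk, litTrue]
      by_cases c1 : [t] ∈ F.codes <;> by_cases c2 : t / 2 < j <;>
        by_cases c3 : p / 2 ^ (t / 2) % 2 = t % 2 <;> simp [c1, c2, c3]
    rw [List.length_append] at g3
    refine ewp_ite ⟨by simp, by simp; omega⟩ (by simp) ?_ ?_
    · intro hv
      rw [hval] at hv
      have hok : F.unitOk j p t = true := by
        cases h : F.unitOk j p t
        · simp [h] at hv
        · rfl
      refine blk_store ⟨by simp, by simp⟩ ⟨by simp, by simp; omega⟩ (by simp) ?_
      refine blk_store ⟨by simp, by simp; omega⟩ ⟨by simp, by simp⟩ (by simp) ?_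
      refine blk_assign (by simp) ⟨by simp, by simp; omega⟩ (by simp) ?_
      refine blk_nil (by simp) (ind_of ⟨by simpa using g1, by simp, ?_, ?_, ?_⟩).ge
      · exact (((g2.setM (by omega)).setM (by omega)).setR (by omega)).setR (by omega)
      · simp [g3, codeL_unitCodes_succ, hok]; omega
      · rw [codeL_unitCodes_succ, hok, if_pos rfl, ← List.append_assoc]
        have p1 := g4.push (i := s'.reg 31) (by simpa using g3) 1
        have p2 := p1.push (i := s'.reg 31 + 1) (by simp [g3]; omega) t
        simpa [g1] using p2
    · intro hv
      rw [hval] at hv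
      have hok : F.unitOk j p t = false := by
        cases h : F.unitOk j p t
        · rfl
        · simp [h] at hv
      refine blk_nil (by simp) (ind_of ⟨by simpa using g1, by simp, ?_, ?_, ?_⟩).ge
      · exact g2.setR (by omega)
      · simp [g3, codeL_unitCodes_succ, hok]
      · simpa [codeL_unitCodes_succ, hok] using g4
  · refine ⟨by simp, (f1.setR (by omega)).setR (by omega), ?_, ?_⟩
    · rw [show codeL (F.unitCodes j p 0) = [] from rfl]
      simp [r1, hlen]
    · simpa [KCNF.unitCodes, codeL] using a3
  rintro σ₂ ⟨-, f2, b31, b101⟩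
  have hul := length_codeL_unitCodes F j p (2 * n)
  have hcode : (F.query hk hm h j p).F.code = codeL F.codes ++ codeL (F.unitCodes j p (2 * n)) := by
    rw [← codeL_append, ← F.codes_fix hk, KCNF.code_eq]
    rfl
  rw [← hcode] at b31 b101
  have hcl : (F.query hk hm h j p).F.code.length ≤ len + 4 * n := by
    rw [hcode, List.length_append]; omega
  have e10 : σ₂.reg 10 = n := by rw [f2.reg 10 (by omega), hF.r10]
  have e19 : σ₂.reg 19 = m := by rw [f2.reg 19 (by omega), hh.r19]
  have hml : (F.query hk hm h j p).matCode.length = m * n := SparseInstance.length_matCode _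
  have hrl : (F.query hk hm h j p).rhsCode.length = m := SparseInstance.length_rhsCode _
  have hmc := (hh.of_fr f2 (by omega) (by omega)).holds_matCode (F := F) hk hm j p
  have hrc := (hh.of_fr f2 (by omega) (by omega)).holds_rhsCode (F := F) hk hm j p
  refine blk_tot (tot_copy (l := (F.query hk hm h j p).matCode) (by simp) (by simp)
    hw' (by simp) hml hmc (fun s' hr _ => by simp [hr, e10, e19]; omega) le_rfl)
    (by simp; ring_nf; omega) ?_
  rintro σ₃ ⟨c1, c2, c3⟩
  refine blk_tot (tot_copy (l := (F.query hk hm h j p).rhsCode) (by simp) (by simp)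
    hmw (by simp) hrl (by rw [c2 21 (by omega)]; exact hrc)
    (fun s' hr _ => ⟨by simp, by simp [hr, c1, e19]⟩) le_rfl)
    (by simp; ring_nf; omega) ?_
  rintro σ₄ ⟨d1, d2, d3⟩
  have f4 : Fr 30 100 σ σ₄ := f2.trans
    ⟨fun i hi => (d1 i (by omega)).trans (c1 i (by omega)),
      fun A hA => (d2 A (by omega)).trans (c2 A (by omega))⟩
  have k10 : σ₄.reg 10 = n := by rw [f4.reg 10 (by omega), hF.r10]
  have k19 : σ₄.reg 19 = m := by rw [f4.reg 19 (by omega), hh.r19]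
  have k31 : σ₄.reg 31 = (F.query hk hm h j p).F.code.length := by
    rw [d1 31 (by omega), c1 31 (by omega), b31]
  have k101 : σ₄.mem 101 = σ₂.mem 101 := by rw [d2 101 (by omega), c2 101 (by omega)]
  have k102 : σ₄.mem 102 = σ₃.mem 102 := by rw [d2 102 (by omega)]
  refine blk_store ⟨by simp, by simp; omega⟩ ⟨by simp, by simp⟩ (by simp; ring_nf; omega) ?_
  refine blk_assign (by simp) ⟨by simp, by simp; omega⟩ (by simp; ring_nf; omega) ?_
  refine blk_assign (by simp) ⟨by simp, by simp⟩ (by simp; ring_nf; omega) ?_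
  refine blk_assign (by simp) ⟨by simp, by simp [k10, k19]; omega⟩ (by simp; ring_nf; omega) ?_
  refine blk_assign (by simp) ⟨by simp, by simp⟩ (by simp; ring_nf; omega) ?_
  refine blk_nil (by simp; ring_nf; omega) (ind_of ⟨?_, ?_⟩).ge
  · exact ((((f4.setM (by omega)).setR (by omega)).setR (by omega)).setR (by omega)).setR (by omega)
  · intro i ll hi
    rw [SparseInstance.encode_eq] at hi
    match i, hi with
    | 0, hi =>
      obtain rfl : [n] = ll := Option.some.inj hi
      refine ⟨by simp, by simp; omega, ?_⟩
      intro q v hq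
      match q, hq with
      | 0, hq => simp at hq; simp [k10, hq]
    | 1, hi =>
      obtain rfl : (F.query hk hm h j p).F.code = ll := by simpa using hi
      exact ⟨by simp [k31], by omega, by simpa [k101] using b101⟩
    | 2, hi =>
      obtain rfl : (F.query hk hm h j p).matCode = ll := by simpa using hi
      exact ⟨by simp [k10, k19, hml], by omega, by simpa [k102] using c3⟩
    | 3, hi =>
      obtain rfl : (F.query hk hm h j p).rhsCode = ll := by simpa using hi
      exact ⟨by simp [k19, hrl], by omega, by simpa using d3⟩
    | i + 4, hi => simp at hi

end WordRAM

namespace WordRAM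

variable {w : ℕ}

/-! ### Majority votes -/

/-- Splitting `z = x + y` avoids any talk of conditional probability: `x` is collected with
certainty, `y` with probability at least `2 / 3`. -/
theorem ewp_two {p : Prog} {T : ℕ} {f : NS → ℝ≥0∞} {s : NS} {A G : NS → Prop} {x z : ℝ≥0}
    (hA : Tot w p T s A) (hG : 2 / 3 ≤ ewp w p T (ind G) s) (hGA : ∀ s', G s' → A s')
    (hxz : x ≤ z) (hx : ∀ s', A s' → x ≤ f s') (hz : ∀ s', G s' → z ≤ f s') :
    ((2 / 3 * z + 1 / 3 * x : ℝ≥0) : ℝ≥0∞) ≤ ewp w p T f s := by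
  obtain ⟨y, rfl⟩ := exists_add_of_le hxz
  have h1 : ewp w p T (fun s' => x * ind A s') s + ewp w p T (fun s' => y * ind G s') s ≤
      ewp w p T f s := by
    refine ewp_add.trans (ewp_mono le_rfl fun s' => ?_)
    by_cases hg : G s'
    · rw [ind_of hg, ind_of (hGA _ hg)]
      simpa using hz s' hg
    · by_cases ha : A s'
      · simpa [ind, hg, ha] using hx s' ha
      · simp [ind, hg, ha]
  refine le_trans ?_ h1
  have h2 : (x : ℝ≥0∞) * 1 ≤ ewp w p T (fun s' => x * ind A s') s :=
    (mul_le_mul_right hA _).trans ewp_const_mul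
  have h3 : (y : ℝ≥0∞) * (2 / 3) ≤ ewp w p T (fun s' => y * ind G s') s :=
    (mul_le_mul_right hG _).trans ewp_const_mul
  refine le_trans (le_of_eq ?_) (add_le_add h2 h3)
  have : ((2 / 3 : ℝ≥0) : ℝ≥0∞) = 2 / 3 := by
    rw [ENNReal.coe_div (by norm_num)]; rfl
  rw [← this, mul_one]
  norm_cast
  ext
  push_cast
  ring

/-- The probability that, with lead `d` of the right answers, these have a majority after `i` more
votes, each of which is right with probability `2/3`. -/
noncomputable def amp : ℕ → ℤ → ℝ≥0
  | 0, d => if 0 < d then 1 else 0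
  | i + 1, d => 2 / 3 * amp i (d + 1) + 1 / 3 * amp i (d - 1)

theorem amp_mono (i : ℕ) {d d' : ℤ} (h : d ≤ d') : amp i d ≤ amp i d' := by
  induction i generalizing d d' with
  | zero =>
    simp only [amp]
    split_ifs <;> simp; omega
  | succ i ih =>
    simp only [amp]
    exact add_le_add (mul_le_mul_right (ih (by omega)) _) (mul_le_mul_right (ih (by omega)) _)

/-- The quantity `(2 / 3) ^ d` is an exponential potential for the biased walk: its mean changes by
the factor `2 / 3 * (2 / 3) + 1 / 3 * (3 / 2) = 17 / 18` with every vote, and it is at least `1` as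
long as there is no majority. -/
theorem le_amp (i : ℕ) (d : ℤ) : 1 - (2 / 3 : ℝ) ^ d * (17 / 18) ^ i ≤ amp i d := by
  induction i generalizing d with
  | zero =>
    simp only [amp]
    split_ifs with h
    · have : (0 : ℝ) < (2 / 3) ^ d := by positivity
      simp; linarith
    · have : (1 : ℝ) ≤ (2 / 3) ^ d := by
        obtain ⟨e, he⟩ := Int.eq_ofNat_of_zero_le (show 0 ≤ -d by omega)
        rw [show d = -(e : ℤ) by omega, zpow_neg, zpow_natCast, ← inv_pow]
        exact one_le_pow₀ (by norm_num)
      simp; linarith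
  | succ i ih =>
    have h1 := ih (d + 1)
    have h2 := ih (d - 1)
    rw [zpow_add₀ (by norm_num), zpow_one] at h1
    rw [zpow_sub₀ (by norm_num), zpow_one] at h2
    simp only [amp]
    push_cast
    rw [pow_succ]
    linarith

/-- The arrays from `100` on hold the instance with code `E`. -/
def Encoded (w : ℕ) (E : Input) (σ : NS) : Prop :=
  ∀ (i : ℕ) (l : List ℕ), E[i]? = some l →
    σ.reg (100 + i) = l.length ∧ l.length < wsz w ∧ Holds (σ.mem (100 + i)) l

/-- The program `O` decides the instance `I` in time `T`, correctly with probability `2/3`. -/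
def OracleOk (w : ℕ) (O : Prog) (T : ℕ) {k s : ℕ} (I : SparseInstance k s) : Prop :=
  ∀ σ, Encoded w I.encode σ → Tot w O T σ (Fr 100 100 σ) ∧
    2 / 3 ≤ ewp w O T (ind fun σ' => Fr 100 100 σ σ' ∧
      (I.Satisfiable → σ'.reg 100 = 1) ∧ (¬ I.Satisfiable → σ'.reg 100 = 0)) σ

/-- One vote. -/
def voteP (O : Prog) : Prog := blk [buildP, O, iteP (.v 100) (assign 26 (.v 26 + .c 1)) .skip]

/-- Answer the query in registers `24`, `25` by a majority vote; register `26` counts the votes for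
satisfiability. -/
def queryP (O : Prog) : Prog := blk [assign 26 (.c 0), forP 27 (.v 16) (voteP O)]

open Classical in
theorem tot_voteP {k l s m n : ℕ} {F : KCNF k n} (hk : 1 ≤ k) (hm : m ≤ n)
    {h : Fin m → RowKey l s} {σ : NS} {j p v T₀ : ℕ} {O : Prog}
    (hw : (codeL F.codes).length + 4 * n + 2 < wsz w) (hw' : m * n + 1 < wsz w)
    (hv : v + 1 < wsz w)
    (hF : HasFormula F σ) (hh : HasHash n h σ) (h24 : σ.reg 24 = j) (h25 : σ.reg 25 = p)
    (h26 : σ.reg 26 = v) (hO : OracleOk w O T₀ (F.query hk hm h j p)) :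
    Tot w (voteP O) (buildT (codeL F.codes).length n m + T₀ + 20) σ (fun σ' =>
      (Fr 26 100 σ σ' ∧ σ'.reg 27 = σ.reg 27) ∧ (σ'.reg 26 = v + 1 ∨ σ'.reg 26 = v)) ∧
    2 / 3 ≤ ewp w (voteP O) (buildT (codeL F.codes).length n m + T₀ + 20) (ind fun σ' =>
      (Fr 26 100 σ σ' ∧ σ'.reg 27 = σ.reg 27) ∧
        σ'.reg 26 = if (F.query hk hm h j p).Satisfiable then v + 1 else v) σ := by
  have hb := tot_buildP hk hm hw hw' hF hh h24 h25
  have last : ∀ σ₂ : NS, Fr 30 100 σ σ₂ → ∀ Q : NS → Prop,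
      (∀ σ', Fr 26 100 σ σ' ∧ σ'.reg 27 = σ.reg 27 →
        σ'.reg 26 = (if σ₂.reg 100 ≠ 0 then v + 1 else v) → Q σ') →
      1 ≤ ewp w (blk [iteP (.v 100) (assign 26 (.v 26 + .c 1)) .skip]) 15 (ind Q) σ₂ := by
    intro σ₂ hσ₂ Q hQ
    have e26 : σ₂.reg 26 = v := by rw [hσ₂.reg 26 (by omega), h26]
    have e27 : σ₂.reg 27 = σ.reg 27 := hσ₂.reg 27 (by omega)
    refine blk_cons (T₁ := 12) (by omega) (ewp_ite ⟨by simp, by simp⟩ (by simp) ?_ ?_)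
    · intro hv0
      refine le_trans ?_ ((ewp_assign ⟨by simp, by simp [e26]; omega⟩ (by simp)).trans
        (ewp_mono (by simp) fun _ => le_rfl))
      refine blk_nil (by omega) (ind_of (hQ _ ⟨?_, ?_⟩ ?_)).ge
      · exact (hσ₂.mono (by omega) le_rfl).setR (by omega)
      · simpa using e27
      · rw [if_pos (by simpa using hv0)]; simp [e26]
    · intro hv0
      refine blk_nil (by simp) (blk_nil (by simp) (ind_of (hQ _ ⟨?_, ?_⟩ ?_)).ge)
      · exact (hσ₂.mono (by omega) le_rfl)
      · simpa using e27
      · rw [if_neg (by simpa using hv0)]; simp [e26]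
  constructor
  · refine blk_tot hb (by omega) ?_
    rintro σ₁ ⟨f1, he⟩
    refine blk_tot (hO σ₁ he).1 (by omega) ?_
    intro σ₂ f2
    refine (last σ₂ (f1.trans (f2.mono (by omega) le_rfl)) _ ?_).trans
      (ewp_mono (by omega) fun _ => le_rfl)
    intro σ' h1 h2
    refine ⟨h1, ?_⟩
    rw [h2]; split_ifs <;> simp
  · refine blk_tot hb (by omega) ?_
    rintro σ₁ ⟨f1, he⟩
    have := blk_prob (x := 1) (T := T₀ + 17) (ps := [iteP (.v 100) (assign 26 (.v 26 + .c 1)) .skip])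
      (f := ind fun σ' => (Fr 26 100 σ σ' ∧ σ'.reg 27 = σ.reg 27) ∧
        σ'.reg 26 = if (F.query hk hm h j p).Satisfiable then v + 1 else v)
      (hO σ₁ he).2 (by omega) ?_
    · rw [one_mul] at this
      exact this.trans (ewp_mono (by omega) fun _ => le_rfl)
    · rintro σ₂ ⟨f2, h1, h2⟩
      refine (last σ₂ (f1.trans (f2.mono (by omega) le_rfl)) _ ?_).trans
        (ewp_mono (by omega) fun _ => le_rfl)
      intro σ' g1 g2
      refine ⟨g1, ?_⟩
      rw [g2]
      by_cases hs : (F.query hk hm h j p).Satisfiable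
      · simp [hs, h1 hs]
      · simp [hs, h2 hs]

/-- The time bound for `queryP`. -/
def queryT (len n m T₀ r : ℕ) : ℕ := (r + 1) * (buildT len n m + T₀ + 50) + 10

/-- The quantitative loop invariant is the success probability of the remaining votes. A vote is
right with probability at least `2 / 3`, not exactly, so the argument compares with `amp` and uses
its monotonicity in the lead. -/
theorem tot_queryP {k l s m n : ℕ} {F : KCNF k n} (hk : 1 ≤ k) (hm : m ≤ n)
    {h : Fin m → RowKey l s} {σ : NS} {j p r T₀ : ℕ} {O : Prog}
    (hw : (codeL F.codes).length + 4 * n + 2 < wsz w) (hw' : m * n + 1 < wsz w)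
    (hr : r + 1 < wsz w)
    (hF : HasFormula F σ) (hh : HasHash n h σ) (h24 : σ.reg 24 = j) (h25 : σ.reg 25 = p)
    (h16 : σ.reg 16 = r) (hO : OracleOk w O T₀ (F.query hk hm h j p)) :
    Tot w (queryP O) (queryT (codeL F.codes).length n m T₀ r) σ (fun σ' =>
      Fr 26 100 σ σ' ∧ σ'.reg 26 ≤ r) ∧
    ((amp r 0 : ℝ≥0) : ℝ≥0∞) ≤ ewp w (queryP O) (queryT (codeL F.codes).length n m T₀ r)
      (ind fun σ' => (Fr 26 100 σ σ' ∧ σ'.reg 26 ≤ r) ∧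
        (r < 2 * σ'.reg 26 ↔ (F.query hk hm h j p).Satisfiable)) σ := by
  classical
  set Tb := buildT (codeL F.codes).length n m + T₀ + 20 with hTb
  have hT : queryT (codeL F.codes).length n m T₀ r = (r + 1) * (Tb + 30) + 10 := by
    rw [queryT, hTb]
  rw [hT]
  have vote : ∀ {σ' : NS}, Fr 26 100 σ σ' → ∀ {v : ℕ}, σ'.reg 26 = v → v < r → _ :=
    fun {σ'} hf {v} h26 hv => tot_voteP (σ := σ') (v := v) hk hm hw hw' (by omega)
      (hF.of_fr hf (by omega) (by omega)) (hh.of_fr hf (by omega) (by omega))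
      (by rw [hf.reg 24 (by omega), h24]) (by rw [hf.reg 25 (by omega), h25]) h26 hO
  constructor
  · refine blk_assign (by simp) ⟨by simp, by simp; omega⟩ (by simp) ?_
    refine blk_tot (tot_for (N := r) (Tb := Tb) (by simp) hr (by simp)
      (fun t s' => s'.reg 27 = t ∧ Fr 26 100 σ s' ∧ s'.reg 26 ≤ t) ?_ ?_ ?_ le_rfl)
      (by clear_value Tb; simp; ring_nf; omega) ?_
    · rintro t ht s' ⟨g1, g2, g3⟩
      exact ⟨g1, by simp, by simp [g2.reg, h16]⟩
    · rintro t ht s' ⟨g1, g2, g3⟩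
      refine (vote g2 rfl (by omega)).1.mono le_rfl ?_
      rintro s₂ ⟨⟨f1, f2⟩, f3⟩
      refine ⟨by omega, by simp, (g2.trans f1).setR (by omega), ?_⟩
      simp; omega
    · exact ⟨by simp, ((Fr.refl _ _ _).setR (by omega)).setR (by omega), by simp⟩
    · rintro s' ⟨g1, g2, g3⟩
      exact blk_nil (by clear_value Tb; simp; ring_nf; omega) (ind_of ⟨g2, g3⟩).ge
  · set ans : Prop := (F.query hk hm h j p).Satisfiable with hans
    let Rep : ℕ → ℕ → NS → Prop := fun t R s' => s'.reg 27 = t ∧ Fr 26 100 σ s' ∧ R ≤ t ∧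
      s'.reg 26 = if ans then R else t - R
    -- `R` counts the right votes among the first `t`, so the lead is `R - (t - R) = 2 R - t`. The
    -- supremum ranges over the `R` compatible with the state and is `0` if there is none.
    let V : ℕ → NS → ℝ≥0∞ := fun t s' =>
      ⨆ (R : ℕ) (_ : Rep t R s'), ((amp (r - t) (2 * R - t) : ℝ≥0) : ℝ≥0∞)
    refine blk_assign (by simp) ⟨by simp, by simp; omega⟩ (by simp) ?_
    have hfor := ewp_for (w := w) (i := 27) (N := r) (Tb := Tb) (e := .v 16) (p := voteP O)
      (f := ind fun σ' => (Fr 26 100 σ σ' ∧ σ'.reg 26 ≤ r) ∧ (r < 2 * σ'.reg 26 ↔ ans))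
      (by simp) hr (by simp) V ?_ ?_ ?_ (σ.setR 26 (Ex.val σ (.c 0)))
    · refine blk_cons (T₁ := (r + 1) * (Tb + (Ex.v 16).cost + 20)) (by clear_value Tb; simp; ring_nf; omega) ?_
      refine le_trans ?_ (hfor.trans (ewp_mono le_rfl fun s' =>
        blk_nil (by clear_value Tb; simp; ring_nf; omega) le_rfl))
      refine le_iSup₂_of_le 0 ⟨by simp, ((Fr.refl _ _ _).setR (by omega)).setR (by omega), le_rfl,
        by simp⟩ (by simp)
    · intro t ht s' hs'
      have : ∃ R, Rep t R s' := by
        by_contra hne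
        push Not at hne
        exact hs' (by simp [V, hne])
      obtain ⟨R, g1, g2, g3, g4⟩ := this
      exact ⟨g1, by simp, by simp [g2.reg, h16]⟩
    · intro t ht s'
      refine iSup₂_le ?_
      rintro R ⟨g1, g2, g3, g4⟩
      have hv : s'.reg 26 < r := by rw [g4]; split_ifs <;> omega
      obtain ⟨vt, vp⟩ := vote g2 rfl hv
      obtain ⟨i, hi⟩ : ∃ i, r - t = i + 1 := ⟨r - t - 1, by omega⟩
      have hi' : r - (t + 1) = i := by omega
      rw [hi, amp]
      refine ewp_two vt vp ?_ (amp_mono i (by omega)) ?_ ?_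
      · rintro s₂ ⟨f1, f2⟩
        refine ⟨f1, ?_⟩
        rw [f2]
        split_ifs <;> simp
      · rintro s₂ ⟨⟨f1, f2⟩, f3⟩
        rw [if_pos (by omega)]
        -- In the unlucky branch the vote may still have been right; this only increases the lead.
        have key : ∃ R', R' ≤ t + 1 ∧ R ≤ R' ∧ s₂.reg 26 = if ans then R' else t + 1 - R' := by
          rcases f3 with f3 | f3 <;> by_cases ha : ans <;> simp only [ha, if_true, if_false] at g4 ⊢
          · exact ⟨R + 1, by omega, by omega, by omega⟩
          · exact ⟨R, by omega, by omega, by omega⟩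
          · exact ⟨R, by omega, by omega, by omega⟩
          · exact ⟨R + 1, by omega, by omega, by omega⟩
        obtain ⟨R', k1, k2, k3⟩ := key
        refine le_iSup₂_of_le R' ⟨by simp, (g2.trans f1).setR (by omega), k1, by simpa using k3⟩ ?_
        rw [hi']
        refine ENNReal.coe_le_coe.2 (amp_mono i ?_)
        push_cast; omega
      · rintro s₂ ⟨⟨f1, f2⟩, f3⟩
        rw [if_pos (by omega)]
        refine le_iSup₂_of_le (R + 1) ⟨by simp, (g2.trans f1).setR (by omega), by omega, ?_⟩ ?_
        · by_cases ha : ans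
          · have h1 : s₂.reg 26 = s'.reg 26 + 1 := by rw [f3]; exact if_pos ha
            simp only [ha, if_true] at g4 ⊢
            simp [h1, g4]
          · have h1 : s₂.reg 26 = s'.reg 26 := by rw [f3]; exact if_neg ha
            simp only [ha, if_false] at g4 ⊢
            simp [h1, g4]
        · rw [hi']
          refine ENNReal.coe_le_coe.2 (amp_mono i ?_)
          push_cast; omega
    · intro s'
      refine iSup₂_le ?_
      rintro R ⟨g1, g2, g3, g4⟩
      rw [Nat.sub_self, amp]
      split_ifs with hR
      · rw [ind_of]
        · simp
        · refine ⟨⟨g2, ?_⟩, ?_⟩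
          · rw [g4]; split_ifs <;> omega
          · by_cases ha : ans <;> simp only [ha, if_true, if_false] at g4
            · simp only [ha, iff_true]; omega
            · simp only [ha, iff_false]; omega
      · simp

end WordRAM

/-! ### Averages -/

/-- The average of a function on a finite type. -/
noncomputable def avg {α : Type*} [Fintype α] (g : α → ℝ≥0) : ℝ≥0 := (∑ a, g a) / Fintype.card α

section avg
variable {α β : Type*} [Fintype α] [Fintype β]

theorem avg_mono {g g' : α → ℝ≥0} (h : ∀ a, g a ≤ g' a) : avg g ≤ avg g' := by
  unfold avg
  gcongr
  exact h _

theorem avg_const [Nonempty α] (x : ℝ≥0) : avg (fun _ : α => x) = x := by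
  unfold avg
  have : (Fintype.card α : ℝ≥0) ≠ 0 := by exact_mod_cast Fintype.card_ne_zero
  rw [Finset.sum_const, Finset.card_univ, nsmul_eq_mul]
  field_simp

theorem avg_mul_left (x : ℝ≥0) (g : α → ℝ≥0) : avg (fun a => x * g a) = x * avg g := by
  unfold avg
  rw [← Finset.mul_sum, mul_div_assoc]

theorem avg_prod (g : α × β → ℝ≥0) : avg g = avg fun a => avg fun b => g (a, b) := by
  unfold avg
  rw [Fintype.sum_prod_type, Fintype.card_prod, ← Finset.sum_div, div_div]
  push_cast
  rw [mul_comm]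

theorem avg_bool (g : Bool → ℝ≥0) : avg g = (g true + g false) / 2 := by
  simp [avg]

/-- The function that agrees with `x` below `j` and with `y` from `j` on. -/
def mixFrom {N : ℕ} (j : ℕ) (x y : Fin N → α) (i : Fin N) : α := if (i : ℕ) < j then x i else y i

/-- Revealing coordinate `j` first does not change the average. This is the principle of deferred
decisions in a single step. -/
theorem avg_mixFrom_succ [Nonempty α] {N j : ℕ} (hj : j < N) (g : (Fin N → α) → ℝ≥0)
    (x : Fin N → α) : avg (fun y => g (mixFrom j x y)) =
      avg fun a => avg fun y => g (mixFrom (j + 1) (Function.update x ⟨j, hj⟩ a) y) := by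
  classical
  have h1 : ∀ y, mixFrom j x y = mixFrom (j + 1) (Function.update x ⟨j, hj⟩ (y ⟨j, hj⟩)) y := by
    intro y
    funext i
    unfold mixFrom
    by_cases hi : i = ⟨j, hj⟩
    · subst hi; simp
    · have : (i : ℕ) ≠ j := fun h => hi (Fin.ext h)
      rw [Function.update_of_ne hi]
      split_ifs <;> first | rfl | omega
  have h2 : ∀ (a b : α) y, mixFrom (j + 1) (Function.update x ⟨j, hj⟩ a) (Function.update y ⟨j, hj⟩ b) =
      mixFrom (j + 1) (Function.update x ⟨j, hj⟩ a) y := by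
    intro a b y
    funext i
    unfold mixFrom
    by_cases hi : i = ⟨j, hj⟩
    · subst hi; simp
    · rw [Function.update_of_ne hi, Function.update_of_ne hi]
  rw [← avg_prod (fun q : α × (Fin N → α) => g (mixFrom (j + 1) (Function.update x ⟨j, hj⟩ q.1) q.2))]
  -- Exchanging the fresh value with coordinate `j` of `y` is an involution, and the right-hand
  -- integrand does not look at coordinate `j` of `y`.
  set φ : α × (Fin N → α) → α × (Fin N → α) := fun q => (q.2 ⟨j, hj⟩, Function.update q.2 ⟨j, hj⟩ q.1)
  have hφ : Function.Involutive φ := by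
    rintro ⟨a, y⟩
    simp [φ]
  have h3 : ∑ q : α × (Fin N → α), g (mixFrom (j + 1) (Function.update x ⟨j, hj⟩ q.1) q.2) =
      ∑ q : α × (Fin N → α), g (mixFrom (j + 1) (Function.update x ⟨j, hj⟩ (φ q).1) (φ q).2) :=
    (Equiv.sum_comp hφ.toPerm _).symm
  unfold avg
  rw [h3, Fintype.sum_prod_type, Fintype.card_prod]
  simp only [φ, h2, ← h1]
  rw [Finset.sum_const, Finset.card_univ, nsmul_eq_mul]
  have : (Fintype.card α : ℝ≥0) ≠ 0 := by exact_mod_cast Fintype.card_ne_zero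
  push_cast
  field_simp

end avg

namespace WordRAM

variable {w : ℕ}

/-! ### Sampling -/

/-- From `s`, the program halts within `T` steps with a state that represents, in the sense of `I`,
a uniformly distributed element of `α`. -/
def Samp (w : ℕ) (p : Prog) (T : ℕ) (s : NS) {α : Type} [Fintype α] (I : α → NS → Prop) : Prop :=
  ∀ (g : α → ℝ≥0) (f : NS → ℝ≥0∞), (∀ a s', I a s' → (g a : ℝ≥0∞) ≤ f s') →
    ((avg g : ℝ≥0) : ℝ≥0∞) ≤ ewp w p T f s

section
variable {α β : Type} [Fintype α] [Fintype β] {p : Prog} {T T' T₁ : ℕ} {s : NS}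

theorem Samp.mono {I J : α → NS → Prop} (h : Samp w p T s I) (hT : T ≤ T')
    (hI : ∀ a s', I a s' → J a s') : Samp w p T' s J := fun g f hf =>
  (h g f fun a s' ha => hf a s' (hI a s' ha)).trans (ewp_mono hT fun _ => le_rfl)

theorem samp_flip (hw : w ≠ 0) {r : ℕ} (hr : ¬ IsTemp r) :
    Samp w (.flip r) 1 s fun (b : Bool) s' => s' = s.setR r b.toNat := by
  intro g f hf
  refine le_trans ?_ (ewp_flip hw hr)
  rw [avg_bool, ENNReal.coe_div (by norm_num)]
  push_cast
  gcongr
  · exact hf true _ rfl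
  · exact hf false _ rfl

/-- After a sample of `α`, sample `β`. -/
theorem Samp.blk {ps : List Prog} {I : α → NS → Prop} {J : α × β → NS → Prop}
    (h : Samp w p T₁ s I) (hT : T₁ + 1 ≤ T)
    (h' : ∀ a s', I a s' → Samp w (blk ps) (T - (T₁ + 1)) s' fun b => J (a, b)) :
    Samp w (blk (p :: ps)) T s J := by
  intro g f hf
  rw [avg_prod]
  exact blk_cons hT (h _ _ fun a s' ha => h' a s' ha _ _ fun b s'' hb => hf _ _ hb)

/-- After a sample, finish without further coin tosses. -/
theorem Samp.blk_tot {ps : List Prog} {I J : α → NS → Prop} (h : Samp w p T₁ s I)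
    (hT : T₁ + 1 ≤ T) (h' : ∀ a s', I a s' → Tot w (WordRAM.blk ps) (T - (T₁ + 1)) s' (J a)) :
    Samp w (WordRAM.blk (p :: ps)) T s J := by
  intro g f hf
  exact blk_cons hT (h _ _ fun a s' ha => (h' a s' ha).ewp (hf a))

/-- Sample after a preparation without coin tosses. -/
theorem blk_tot_samp {ps : List Prog} {P : NS → Prop} {J : α → NS → Prop} (h : Tot w p T₁ s P)
    (hT : T₁ + 1 ≤ T) (h' : ∀ s', P s' → Samp w (blk ps) (T - (T₁ + 1)) s' J) :
    Samp w (blk (p :: ps)) T s J :=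
  fun g f hf => blk_tot h hT fun s' hs => h' s' hs g f hf

/-- The invariant value at round `j` is the average over the coordinates not yet drawn, those
already drawn being fixed to `x`. At `j = 0` the choice of `x` is irrelevant, and at `j = N` nothing
is left to average. -/
theorem samp_for [Nonempty α] {i N Tb : ℕ} {e : Ex} (hi : ¬ IsTemp i) (hw : N + 1 < wsz w)
    (hd : e.depth < 38) (Inv : ℕ → (Fin N → α) → NS → Prop)
    (hV : ∀ j ≤ N, ∀ x s, Inv j x s → s.reg i = j ∧ e.Safe (wsz w) s ∧ e.val s = N)
    (hb : ∀ j (hj : j < N) x s, Inv j x s → Samp w p Tb s fun (a : α) s' =>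
      s'.reg i = j ∧ Inv (j + 1) (Function.update x ⟨j, hj⟩ a) (s'.setR i (j + 1)))
    (h0 : ∃ x, Inv 0 x (s.setR i 0)) (hT : (N + 1) * (Tb + e.cost + 20) ≤ T) :
    Samp w (forP i e p) T s fun x => Inv N x := by
  intro g f hf
  have := ewp_for (p := p) (f := f) (Tb := Tb) hi hw hd
    (fun j s => ⨆ (x : Fin N → α) (_ : Inv j x s), ((avg fun y => g (mixFrom j x y) : ℝ≥0) : ℝ≥0∞))
    ?_ ?_ ?_ s
  · refine le_trans ?_ (this.trans (ewp_mono hT fun _ => le_rfl))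
    obtain ⟨x, hx⟩ := h0
    refine le_iSup₂_of_le x hx (le_of_eq ?_)
    congr 2
  · intro j hj s' hs'
    have : ∃ x, Inv j x s' := by
      by_contra hne
      push Not at hne
      exact hs' (by simp [hne])
    obtain ⟨x, hx⟩ := this
    exact hV j hj x s' hx
  · intro j hj s'
    refine iSup₂_le fun x hx => ?_
    rw [avg_mixFrom_succ hj]
    refine hb j hj x s' hx _ _ fun a s'' hs'' => ?_
    rw [if_pos hs''.1]
    exact le_iSup₂_of_le _ hs''.2 le_rfl
  · intro s'
    refine iSup₂_le fun x hx => ?_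
    have : ∀ y, mixFrom N x y = x := fun y => funext fun i => if_pos i.isLt
    simp only [this]
    rw [avg_const]
    exact hf x s' hx

end

end WordRAM

namespace WordRAM

variable {w : ℕ}

/-! ### Sampling a hash function -/

theorem tot_zero {i A N T : ℕ} {e : Ex} {s : NS} (hi : ¬ IsTemp i) (hw : N + 1 < wsz w)
    (hd : e.depth < 38)
    (he : ∀ s' : NS, (∀ r, r ≠ i → s'.reg r = s.reg r) → e.Safe (wsz w) s' ∧ e.val s' = N)
    (hT : (N + 1) * (e.cost + 40) ≤ T) :
    Tot w (forP i e (blk [storeP A (.v i) (.c 0)])) T s fun s' => (∀ r, r ≠ i → s'.reg r = s.reg r) ∧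
      (∀ C, C ≠ A → s'.mem C = s.mem C) ∧ ∀ t < N, s'.mem A t = 0 := by
  refine Tot.mono (T := T) (tot_for hi hw hd (Tb := 20) (fun j s' => s'.reg i = j ∧
    (∀ r, r ≠ i → s'.reg r = s.reg r) ∧ (∀ C, C ≠ A → s'.mem C = s.mem C) ∧
      ∀ t < j, s'.mem A t = 0) ?_ ?_ ?_ (by nlinarith)) le_rfl ?_
  · rintro j hj s' ⟨h1, h2, h3, h4⟩
    exact ⟨h1, he s' h2⟩
  · rintro j hj s' ⟨h1, h2, h3, h4⟩
    refine blk_store ?_ ?_ ?_ (blk_nil ?_ (ind_of ⟨?_, ?_, ?_, ?_, ?_⟩).ge)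
    · exact ⟨by simp, by simpa using hi⟩
    · exact ⟨by simp, by simp; omega⟩
    · simp
    · simp
    · simpa using h1
    · simp
    · intro r hr
      simp [hr, h2 r hr]
    · intro C hC
      simp [hC, h3 C hC]
    · intro t ht
      by_cases htj : t = j
      · simp [h1, htj]
      · simp [h1, htj, h4 t (by omega)]
  · exact ⟨by simp, fun r hr => by simp [hr], fun C _ => rfl, by simp⟩
  · rintro s' ⟨-, h2, h3, h4⟩
    exact ⟨h2, h3, h4⟩

/-- Put a random number with as many bits as register `13` says into register `34`. -/
def wordP : Prog := blk [assign 34 (.c 0),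
  forP 32 (.v 13) (blk [.flip 33, assign 34 (.v 34 + .bin .shl (.v 33) (.v 32))])]

/-- The number with the first `j` of the binary digits `b`. -/
def bvalTo {l : ℕ} (b : Fin l → Bool) (j : ℕ) : ℕ :=
  ∑ i : Fin l, if (i : ℕ) < j then 2 ^ (i : ℕ) * (b i).toNat else 0

theorem bvalTo_succ {l j : ℕ} (b : Fin l → Bool) (hj : j < l) (a : Bool) :
    bvalTo (Function.update b ⟨j, hj⟩ a) (j + 1) = bvalTo b j + a.toNat * 2 ^ j := by
  unfold bvalTo
  rw [← Finset.sum_erase_add _ _ (Finset.mem_univ (⟨j, hj⟩ : Fin l)),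
    ← Finset.sum_erase_add (a := (⟨j, hj⟩ : Fin l)) _ (fun i : Fin l =>
      if (i : ℕ) < j then 2 ^ (i : ℕ) * (b i).toNat else 0) (Finset.mem_univ _)]
  simp only [Function.update_self, lt_irrefl, if_false, add_zero, Nat.lt_succ_self, if_true]
  congr 1
  · refine Finset.sum_congr rfl fun i hi => ?_
    have hne := Finset.ne_of_mem_erase hi
    have hne' : (i : ℕ) ≠ j := fun h => hne (Fin.ext h)
    rw [Function.update_of_ne hne]
    split_ifs <;> first | rfl | omega
  · exact mul_comm _ _

theorem bvalTo_lt {l : ℕ} (b : Fin l → Bool) {j : ℕ} (hj : j ≤ l) : bvalTo b j < 2 ^ j := by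
  induction j generalizing b with
  | zero => simp [bvalTo]
  | succ j ih =>
    have h := bvalTo_succ b (show j < l by omega) (b ⟨j, by omega⟩)
    rw [Function.update_eq_self] at h
    have h1 := ih b (by omega)
    have h2 : (b ⟨j, by omega⟩).toNat ≤ 1 := Bool.toNat_le _
    have h3 := Nat.mul_le_mul_right (2 ^ j) h2
    rw [h, pow_succ]
    omega

theorem bvalTo_self {l : ℕ} (b : Fin l → Bool) : bvalTo b l = bval b := by
  unfold bvalTo bval
  exact Finset.sum_congr rfl fun i _ => if_pos i.isLt

theorem bval_lt {l : ℕ} (b : Fin l → Bool) : bval b < 2 ^ l := by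
  rw [← bvalTo_self]; exact bvalTo_lt b le_rfl

theorem samp_wordP {l : ℕ} {σ : NS} (hw0 : w ≠ 0) (hw : l + 1 < wsz w) (hw' : 2 ^ l < wsz w)
    (h13 : σ.reg 13 = l) :
    Samp w wordP ((l + 1) * 60 + 10) σ fun (b : Fin l → Bool) s' =>
      Fr 32 100 σ s' ∧ s'.reg 34 = bval b := by
  intro g f hf
  refine blk_assign (by simp) ⟨by simp, by simp; omega⟩ (by simp) ?_
  refine Samp.blk_tot (J := fun (b : Fin l → Bool) s' => Fr 32 100 σ s' ∧ s'.reg 34 = bval b)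
    (samp_for (α := Bool) (N := l) (Tb := 20) (by simp) hw (by simp)
      (fun j b s' => s'.reg 32 = j ∧ Fr 32 100 σ s' ∧ s'.reg 34 = bvalTo b j) ?_ ?_ ?_ le_rfl)
    (by simp; ring_nf; omega) ?_ g f hf
  · rintro j hj b s' ⟨g1, g2, g3⟩
    exact ⟨g1, by simp, by simp [g2.reg, h13]⟩
  · rintro j hj b s' ⟨g1, g2, g3⟩
    refine (samp_flip hw0 (by simp)).blk_tot (by simp) ?_
    rintro a s₁ rfl
    have h1 := bvalTo_succ b hj a
    have h2 := bvalTo_lt (Function.update b ⟨j, hj⟩ a) (show j + 1 ≤ l by omega)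
    have h3 : 2 ^ (j + 1) ≤ 2 ^ l := Nat.pow_le_pow_right (by omega) (by omega)
    refine blk_assign (by simp) ⟨by simp, by simp [g1, g3]; omega⟩ (by simp) (blk_nil (by simp)
      (ind_of ⟨?_, ?_, ?_, ?_⟩).ge)
    · simpa using g1
    · simp
    · exact ((g2.setR (by omega)).setR (by omega)).setR (by omega)
    · simp [g1, g3, h1]
  · exact ⟨fun _ => false, by simp, ((Fr.refl _ _ _).setR (by omega)).setR (by omega),
      by simp [bvalTo]⟩
  · rintro b s' ⟨g1, g2, g3⟩
    exact blk_nil (by simp; ring_nf; omega) (ind_of ⟨g2, by rw [g3, bvalTo_self]⟩).ge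

/-- Add a random unit vector to the row of the matrix with number in register `30`. -/
def unitP : Prog := blk [wordP,
  iteP (.bin .lt (.v 34) (.v 10))
    (storeP 20 (.v 30 * .v 10 + .v 34) (.c 1 - .ld 20 (.v 30 * .v 10 + .v 34))) .skip]

/-- Sample one equation. -/
def rowP (s : ℕ) : Prog := blk [forP 31 (.c s) unitP, .flip 33, storeP 21 (.v 30) (.v 33)]

/-- Sample a hash function. -/
def sampleP (s : ℕ) : Prog := blk [
  forP 30 (.v 19 * .v 10) (blk [storeP 20 (.v 30) (.c 0)]),
  forP 30 (.v 19) (rowP s)]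

/-- The time bound for `sampleP`. -/
def sampleT (l s n m : ℕ) : ℕ := (m * n + 1) * 60 + (m + 1) * ((s + 1) * ((l + 1) * 60 + 100) + 100) + 10

/-- The registers below `30` and all arrays except `20` and `21` agree. -/
structure FrHash (r : ℕ) (s s' : NS) : Prop where
  reg : ∀ i < r, s'.reg i = s.reg i
  mem : ∀ A, A < 100 → A ≠ 20 → A ≠ 21 → s'.mem A = s.mem A

theorem FrHash.refl (r : ℕ) (s : NS) : FrHash r s s := ⟨fun _ _ => rfl, fun _ _ _ _ => rfl⟩

theorem FrHash.setR {r i v : ℕ} {s s' : NS} (h : FrHash r s s') (hi : r ≤ i) :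
    FrHash r s (s'.setR i v) :=
  ⟨fun j hj => by rw [NS.setR_reg, if_neg (by omega), h.reg j hj], h.mem⟩

theorem FrHash.setM {r A i v : ℕ} {s s' : NS} (h : FrHash r s s') (hA : A = 20 ∨ A = 21) :
    FrHash r s (s'.setM A i v) :=
  ⟨h.reg, fun j hj h1 h2 => by rw [NS.setM_mem, if_neg (by omega), h.mem j hj h1 h2]⟩

theorem FrHash.trans_fr {r : ℕ} {s s' s'' : NS} (h : FrHash r s s') (h' : Fr r 100 s' s'') :
    FrHash r s s'' :=
  ⟨fun i hi => (h'.reg i hi).trans (h.reg i hi),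
    fun A hA h1 h2 => (h'.mem A hA).trans (h.mem A hA h1 h2)⟩

theorem FrHash.trans {r : ℕ} {s s' s'' : NS} (h : FrHash r s s') (h' : FrHash r s' s'') :
    FrHash r s s'' :=
  ⟨fun i hi => (h'.reg i hi).trans (h.reg i hi),
    fun A hA h1 h2 => (h'.mem A hA h1 h2).trans (h.mem A hA h1 h2)⟩

theorem FrHash.mono {r r' : ℕ} {s s' : NS} (h : FrHash r s s') (hr : r' ≤ r) : FrHash r' s s' :=
  ⟨fun i hi => h.reg i (by omega), h.mem⟩

/-- The sum of the unit vectors for the first `t` words. -/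
def rowTo {l s : ℕ} (n : ℕ) (u : Fin s → Fin l → Bool) (t : ℕ) (j : Fin n) : ZMod 2 :=
  ∑ t' : Fin s, if (t' : ℕ) < t ∧ bval (u t') = (j : ℕ) then 1 else 0

theorem rowTo_succ {l s n t : ℕ} (u : Fin s → Fin l → Bool) (ht : t < s) (a : Fin l → Bool)
    (j : Fin n) : rowTo n (Function.update u ⟨t, ht⟩ a) (t + 1) j =
      rowTo n u t j + if bval a = (j : ℕ) then 1 else 0 := by
  unfold rowTo
  rw [← Finset.sum_erase_add _ _ (Finset.mem_univ (⟨t, ht⟩ : Fin s)),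
    ← Finset.sum_erase_add (a := (⟨t, ht⟩ : Fin s)) _ (fun t' : Fin s =>
      if (t' : ℕ) < t ∧ bval (u t') = (j : ℕ) then (1 : ZMod 2) else 0) (Finset.mem_univ _)]
  simp only [Function.update_self, lt_irrefl, false_and, if_false, add_zero, Nat.lt_succ_self,
    true_and]
  congr 1
  refine Finset.sum_congr rfl fun i hi => ?_
  have hne := Finset.ne_of_mem_erase hi
  have hne' : (i : ℕ) ≠ t := fun h => hne (Fin.ext h)
  rw [Function.update_of_ne hne]
  have : ((i : ℕ) < t + 1) = ((i : ℕ) < t) := propext (by omega)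
  simp only [this]

theorem rowTo_self {l s n : ℕ} (u : Fin s → Fin l → Bool) : rowTo n u s = rowVec n u := by
  funext j
  simp [rowTo, rowVec]

theorem val_add_one (a : ZMod 2) : (a + 1).val = 1 - a.val := by
  revert a; decide

theorem index_inj {n i i' j j' : ℕ} (hj : j < n) (hj' : j' < n) (h : i * n + j = i' * n + j') :
    i = i' ∧ j = j' := by
  have h1 : (i * n + j) / n = i := by
    rw [mul_comm, Nat.mul_add_div (by omega), Nat.div_eq_of_lt hj, add_zero]
  have h2 : (i' * n + j') / n = i' := by
    rw [mul_comm, Nat.mul_add_div (by omega), Nat.div_eq_of_lt hj', add_zero]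
  have h3 : i = i' := by rw [← h1, ← h2, h]
  subst h3
  exact ⟨rfl, by omega⟩

theorem index_lt {m n i j : ℕ} (hi : i < m) (hj : j < n) : i * n + j < m * n := by
  have := Nat.mul_le_mul_right n (show i + 1 ≤ m by omega)
  rw [add_mul, one_mul] at this
  omega

/-- Replacing an entry `v` by `1 - v` is addition of `1` modulo `2`. A word that names no column
leaves the row as it is, in agreement with `rowVec`. -/
theorem samp_unitP {l s n m i t : ℕ} {σ : NS} {u : Fin s → Fin l → Bool} (hw0 : w ≠ 0)
    (hw : l + 1 < wsz w) (hw' : 2 ^ l < wsz w) (hmn : m * n + 1 < wsz w)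
    (hi : i < m) (ht : t < s) (h13 : σ.reg 13 = l) (h10 : σ.reg 10 = n) (h30 : σ.reg 30 = i)
    (hrow : ∀ j : Fin n, σ.mem 20 (i * n + j) = (rowTo n u t j).val) :
    Samp w unitP ((l + 1) * 60 + 70) σ fun (b : Fin l → Bool) s' => FrHash 32 σ s' ∧
      s'.mem 21 = σ.mem 21 ∧
      (∀ j : Fin n, s'.mem 20 (i * n + j) = (rowTo n (Function.update u ⟨t, ht⟩ b) (t + 1) j).val) ∧
      ∀ i' ≠ i, ∀ j < n, s'.mem 20 (i' * n + j) = σ.mem 20 (i' * n + j) := by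
  refine (samp_wordP hw0 hw hw' h13).blk_tot (by omega) ?_
  rintro b s₁ ⟨g1, g2⟩
  have hb := bval_lt b
  have e30 : s₁.reg 30 = i := by rw [g1.reg 30 (by omega), h30]
  have e10 : s₁.reg 10 = n := by rw [g1.reg 10 (by omega), h10]
  have e20 : s₁.mem 20 = σ.mem 20 := g1.mem 20 (by omega)
  have e21 : s₁.mem 21 = σ.mem 21 := g1.mem 21 (by omega)
  have f1 : FrHash 32 σ s₁ := (FrHash.refl _ _).trans_fr g1
  refine blk_cons (T₁ := 55) (by ring_nf; omega) (ewp_ite ⟨by simp, by simp; omega⟩ (by simp) ?_ ?_)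
  · intro hv
    have hlt : bval b < n := by
      by_contra hge
      simp [g2, e10, hge] at hv
    have hix := index_lt hi hlt
    have hval := hrow ⟨bval b, hlt⟩
    have hle : (rowTo n u t ⟨bval b, hlt⟩).val < 2 := ZMod.val_lt _
    simp only at hval
    refine le_trans ?_ ((ewp_store ⟨by simp, ?_⟩ ⟨by simp, ?_⟩).trans
      (ewp_mono (by simp) fun _ => le_rfl))
    · refine blk_nil (by ring_nf; omega) (ind_of ⟨?_, ?_, ?_, ?_⟩).ge
      · exact f1.setM (by omega)
      · simpa using e21
      · intro j
        rw [rowTo_succ]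
        by_cases hj : bval b = (j : ℕ)
        · have hj' : j = ⟨bval b, hlt⟩ := Fin.ext hj.symm
          subst hj'
          simp [e30, e10, g2, e20, hval, val_add_one]
        · have : i * n + (j : ℕ) ≠ i * n + bval b := by omega
          simp only [NS.setM_mem, if_true, Ex.val_add, Ex.val_mul, Ex.val_v, e30, e10, g2]
          rw [Function.update_of_ne this, e20, hrow, if_neg hj, add_zero]
      · intro i' hi' j hj
        have : i' * n + j ≠ i * n + bval b := fun h => hi' (index_inj hj hlt h).1
        simp only [NS.setM_mem, if_true, Ex.val_add, Ex.val_mul, Ex.val_v, e30, e10, g2]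
        rw [Function.update_of_ne this, e20]
    · simp [e30, e10, g2]; omega
    · simp [e30, e10, g2, e20, hval]; omega
  · intro hv
    have hge : n ≤ bval b := by
      by_contra hlt
      simp [g2, e10, not_le.1 hlt] at hv
    refine blk_nil (by simp) (blk_nil (by ring_nf; omega) (ind_of ⟨f1, e21, ?_, ?_⟩).ge)
    · intro j
      rw [rowTo_succ, if_neg (by omega), e20, hrow, add_zero]
    · intro i' _ j _
      rw [e20]

theorem samp_rowP {l s n m i : ℕ} {σ : NS} (hw0 : w ≠ 0)
    (hw : l + 1 < wsz w) (hw' : 2 ^ l < wsz w) (hmn : m * n + 1 < wsz w) (hs : s + 1 < wsz w)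
    (hi : i < m) (h13 : σ.reg 13 = l) (h10 : σ.reg 10 = n) (h30 : σ.reg 30 = i)
    (hrow : ∀ j < n, σ.mem 20 (i * n + j) = 0) :
    Samp w (rowP s) ((s + 1) * ((l + 1) * 60 + 100) + 30) σ fun (r : RowKey l s) s' =>
      FrHash 31 σ s' ∧
      (∀ j : Fin n, s'.mem 20 (i * n + j) = (rowVec n r.1 j).val) ∧
      (∀ i' ≠ i, ∀ j < n, s'.mem 20 (i' * n + j) = σ.mem 20 (i' * n + j)) ∧
      (∀ i' ≠ i, s'.mem 21 i' = σ.mem 21 i') ∧ s'.mem 21 i = r.2.toNat := by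
  refine Samp.blk (α := Fin s → Fin l → Bool) (β := Bool) (samp_for (α := Fin l → Bool) (N := s)
    (Tb := (l + 1) * 60 + 70) (by simp) hs (by simp)
    (fun t u s' => s'.reg 31 = t ∧ FrHash 31 σ s' ∧ s'.mem 21 = σ.mem 21 ∧
      (∀ j : Fin n, s'.mem 20 (i * n + j) = (rowTo n u t j).val) ∧
      ∀ i' ≠ i, ∀ j < n, s'.mem 20 (i' * n + j) = σ.mem 20 (i' * n + j)) ?_ ?_ ?_
      (T := (s + 1) * ((l + 1) * 60 + 100)) (by simp)) (by omega) ?_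
  · rintro t ht u s' ⟨g1, -⟩
    exact ⟨g1, by simp; omega, by simp⟩
  · rintro t ht u s' ⟨g1, g2, g3, g4, g5⟩
    refine (samp_unitP hw0 hw hw' hmn hi ht (by rw [g2.reg 13 (by omega), h13])
      (by rw [g2.reg 10 (by omega), h10]) (by rw [g2.reg 30 (by omega), h30]) g4).mono le_rfl ?_
    rintro b s₁ ⟨f1, f2, f3, f4⟩
    refine ⟨by rw [f1.reg 31 (by omega), g1], by simp, (g2.trans (f1.mono (by omega))).setR (by omega),
      by rw [NS.setR_mem, f2, g3], f3, fun i' hi' j hj => ?_⟩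
    rw [NS.setR_mem, f4 i' hi' j hj, g5 i' hi' j hj]
  · refine ⟨fun _ _ => false, by simp, (FrHash.refl _ _).setR (by omega), by simp, fun j => ?_, by simp⟩
    simp [rowTo, hrow j j.isLt]
  · rintro u s₁ ⟨-, g2, g3, g4, g5⟩
    refine (samp_flip hw0 (by simp)).blk_tot (by omega) ?_
    rintro b s₂ rfl
    have e30 : s₁.reg 30 = i := by rw [g2.reg 30 (by omega), h30]
    refine blk_store ⟨by simp, by simp⟩ ⟨by simp, by simp⟩ (by simp)
      (blk_nil (by simp) (ind_of ⟨?_, ?_, ?_, ?_, ?_⟩).ge)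
    · exact (g2.setR (by omega)).setM (by omega)
    · intro j
      simp [g4 j, rowTo_self]
    · intro i' hi' j hj
      simp [g5 i' hi' j hj]
    · intro i' hi'
      simp [e30, hi', g3]
    · simp [e30]

theorem samp_sampleP {l s n m : ℕ} {σ : NS} (hw0 : w ≠ 0)
    (hw : l + 1 < wsz w) (hw' : 2 ^ l < wsz w) (hmn : m * n + 1 < wsz w) (hm : m + 1 < wsz w)
    (hs : s + 1 < wsz w) (h13 : σ.reg 13 = l) (h10 : σ.reg 10 = n) (h19 : σ.reg 19 = m) :
    Samp w (sampleP s) (sampleT l s n m) σ fun (h : Fin m → RowKey l s) s' =>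
      FrHash 30 σ s' ∧ HasHash n h s' := by
  unfold sampleT
  refine blk_tot_samp (tot_zero (N := m * n) (by simp) hmn (by simp)
    (fun s' hr => ⟨by simp [hr, h10, h19]; omega, by simp [hr, h10, h19]⟩) le_rfl)
    (by simp; ring_nf; omega) ?_
  rintro s₁ ⟨a1, a2, a3⟩
  have f1 : FrHash 30 σ s₁ := ⟨fun i hi => a1 i (by omega), fun A _ h1 _ => a2 A h1⟩
  refine Samp.blk_tot (samp_for (α := RowKey l s) (N := m)
    (Tb := (s + 1) * ((l + 1) * 60 + 100) + 30) (by simp) hm (by simp)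
    (fun i h s' => s'.reg 30 = i ∧ FrHash 30 σ s' ∧
      (∀ i' : Fin m, i' < i → ∀ j : Fin n, s'.mem 20 (i' * n + j) = (rowVec n (h i').1 j).val) ∧
      (∀ i' : Fin m, i' < i → s'.mem 21 i' = (h i').2.toNat) ∧
      ∀ i' < m, i ≤ i' → ∀ j < n, s'.mem 20 (i' * n + j) = 0) ?_ ?_ ?_ le_rfl)
      (by simp; ring_nf; omega) ?_
  · rintro i hi h s' ⟨g1, g2, -⟩
    exact ⟨g1, by simp, by simp [g2.reg, h19]⟩
  · rintro i hi h s' ⟨g1, g2, g3, g4, g5⟩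
    refine (samp_rowP hw0 hw hw' hmn hs hi (by rw [g2.reg 13 (by omega), h13])
      (by rw [g2.reg 10 (by omega), h10]) g1 (fun j hj => g5 i hi le_rfl j hj)).mono le_rfl ?_
    rintro r s₂ ⟨f2, f3, f4, f5, f6⟩
    refine ⟨by rw [f2.reg 30 (by omega), g1], by simp, (g2.trans (f2.mono (by omega))).setR (by omega),
      ?_, ?_, ?_⟩
    · intro i' hi' j
      by_cases he : (i' : ℕ) = i
      · obtain rfl : i' = ⟨i, hi⟩ := Fin.ext he
        rw [Function.update_self, NS.setR_mem]
        exact f3 j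
      · rw [Function.update_of_ne (fun h => he (by rw [h])), NS.setR_mem, f4 _ he _ j.isLt,
          g3 i' (by omega) j]
    · intro i' hi'
      by_cases he : (i' : ℕ) = i
      · obtain rfl : i' = ⟨i, hi⟩ := Fin.ext he
        rw [Function.update_self, NS.setR_mem]
        exact f6
      · rw [Function.update_of_ne (fun h => he (by rw [h])), NS.setR_mem, f5 _ he,
          g4 i' (by omega)]
    · intro i' hi' hle j hj
      rw [NS.setR_mem, f4 i' (by omega) j hj, g5 i' hi' (by omega) j hj]
  · refine ⟨fun _ => (fun _ _ => false, false), by simp, f1.setR (by omega), by simp, by simp, ?_⟩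
    intro i' hi' _ j hj
    exact a3 _ (index_lt hi' hj)
  · rintro h s' ⟨-, g2, g3, g4, -⟩
    refine blk_nil (by simp; ring_nf; omega) (ind_of ⟨g2, ?_, ?_, ?_⟩).ge
    · rw [g2.reg 19 (by omega), h19]
    · intro i j
      exact g3 i i.isLt j
    · intro i
      rw [g4 i i.isLt, hashRhs]
      cases (h i).2 <;> rfl

end WordRAM

/-! ### Totals over independent trials -/

/-- The expected value of `A (x + Z a₁ + … + Z aₜ)` for independent uniformly distributed `aᵢ`. -/
noncomputable def trials {α : Type*} [Fintype α] (Z : α → ℕ) (A : ℕ → ℝ≥0) : ℕ → ℕ → ℝ≥0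
  | 0, x => A x
  | t + 1, x => avg fun a => trials Z A t (x + Z a)

/-- The total only grows, so a bound for `A` beyond the current total bounds its average. -/
theorem trials_le {α : Type*} [Fintype α] [Nonempty α] {Z : α → ℕ} {A : ℕ → ℝ≥0} {y : ℝ≥0}
    (t x : ℕ) (h : ∀ x' ≥ x, A x' ≤ y) : trials Z A t x ≤ y := by
  induction t generalizing x with
  | zero => exact h x le_rfl
  | succ t ih =>
    rw [trials, ← avg_const (α := α) y]
    exact avg_mono fun a => ih _ fun x' hx' => h x' (by omega)

namespace WordRAM

variable {w : ℕ}

theorem Samp.tot {α : Type} [Fintype α] [Nonempty α] {p : Prog} {T : ℕ} {s : NS}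
    {I : α → NS → Prop} {Q : NS → Prop} (h : Samp w p T s I) (hQ : ∀ a s', I a s' → Q s') :
    Tot w p T s Q := by
  have := h (fun _ => 1) (ind Q) fun a s' ha => by rw [ind_of (hQ a s' ha)]; rfl
  rwa [avg_const] at this

theorem Holds.of_append {m : ℕ → ℕ} {l l' : List ℕ} (h : Holds m (l ++ l')) : Holds m l := by
  intro j v hj
  refine h j v ?_
  have hjl : j < l.length := by
    by_contra hge
    rw [List.getElem?_eq_none (by omega)] at hj
    simp at hj
  rw [List.getElem?_append_left hjl, hj]

/-! ### Counting the solutions in the buckets of random hash functions -/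

/-- The static data for a level. -/
structure LevelOk (w : ℕ) (O : Prog) {k n : ℕ} (F : KCNF k n) (l s m L B r T₀ : ℕ)
    (σ : NS) : Prop where
  hk : 1 ≤ k
  hm : m ≤ n
  hF : HasFormula F σ
  r13 : σ.reg 13 = l
  r14 : σ.reg 14 = L
  r15 : σ.reg 15 = B
  r16 : σ.reg 16 = r
  r19 : σ.reg 19 = m
  w0 : w ≠ 0
  wlen : (codeL F.codes).length + 4 * n + 2 < wsz w
  wmn : m * n + 1 < wsz w
  wn : 2 ^ n + 1 < wsz w
  wl : 2 ^ l + 1 < wsz w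
  ws : s + 1 < wsz w
  wr : 2 * r + 1 < wsz w
  wB : B + 3 < wsz w
  wL : L + 1 < wsz w
  orc : ∀ (h : Fin m → RowKey l s) (j p : ℕ), OracleOk w O T₀ (F.query hk hm h j p)

/-- The state of the search: `i` trials were started, `c` solutions were found, and the stack `st`
holds the queries to be made. -/
structure Rep {l s m : ℕ} (n L : ℕ) (σ₀ : NS) (h : Fin m → RowKey l s) (i c : ℕ)
    (st : List (ℕ × ℕ)) (σ : NS) : Prop where
  fr : Fr 20 20 σ₀ σ
  r20 : σ.reg 20 = c
  r21 : σ.reg 21 = i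
  r22 : σ.reg 22 = st.length
  m22 : Holds (σ.mem 22) (st.map Prod.fst)
  m23 : Holds (σ.mem 23) (st.map Prod.snd)
  hash : st ≠ [] → HasHash n h σ
  ok : ∀ e ∈ st, e.1 ≤ n ∧ e.2 < 2 ^ e.1
  hi : i ≤ L

theorem HasHash.setR {l s m n r v : ℕ} {h : Fin m → RowKey l s} {σ : NS} (hh : HasHash n h σ)
    (hr : 20 ≤ r) : HasHash n h (σ.setR r v) :=
  hh.of_fr (r := 20) (a := 22) ((Fr.refl _ _ _).setR hr) le_rfl le_rfl

theorem HasHash.setM {l s m n A i v : ℕ} {h : Fin m → RowKey l s} {σ : NS} (hh : HasHash n h σ)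
    (hA : 22 ≤ A) : HasHash n h (σ.setM A i v) :=
  hh.of_fr (r := 20) (a := 22) ((Fr.refl _ _ _).setM hA) le_rfl le_rfl

theorem Rep.of_fr {l s m n L i c : ℕ} {σ₀ σ σ' : NS} {h : Fin m → RowKey l s}
    {st : List (ℕ × ℕ)} (hR : Rep n L σ₀ h i c st σ) {r a : ℕ} (hf : Fr r a σ σ')
    (hr : 23 ≤ r) (ha : 24 ≤ a) : Rep n L σ₀ h i c st σ' where
  fr := hR.fr.trans (hf.mono (by omega) (by omega))
  r20 := by rw [hf.reg 20 (by omega), hR.r20]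
  r21 := by rw [hf.reg 21 (by omega), hR.r21]
  r22 := by rw [hf.reg 22 (by omega), hR.r22]
  m22 := by rw [hf.mem 22 (by omega)]; exact hR.m22
  m23 := by rw [hf.mem 23 (by omega)]; exact hR.m23
  hash := fun h0 => (hR.hash h0).of_fr hf (by omega) (by omega)
  ok := hR.ok
  hi := hR.hi

theorem Rep.setR {l s m n L i c r v : ℕ} {σ₀ σ : NS} {h : Fin m → RowKey l s}
    {st : List (ℕ × ℕ)} (hR : Rep n L σ₀ h i c st σ) (hr : 23 ≤ r) :
    Rep n L σ₀ h i c st (σ.setR r v) :=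
  hR.of_fr (r := 23) (a := 100) ((Fr.refl _ _ _).setR hr) le_rfl (by omega)

/-- The number of solutions found after the query for `(j, p)` has been answered. -/
def nextC (n c j : ℕ) (b : Bool) : ℕ := if b = true ∧ ¬ j < n then c + 1 else c

/-- The stack after the query for `(j, p)` has been answered. -/
def nextSt (n : ℕ) (st : List (ℕ × ℕ)) (j p : ℕ) (b : Bool) : List (ℕ × ℕ) :=
  if b = true ∧ j < n then st ++ [(j + 1, p), (j + 1, p + 2 ^ j)] else st

/-- Use the answer to a query. -/
def answerP : Prog := iteP (.bin .lt (.v 16) (.v 26 + .v 26))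
  (iteP (.bin .lt (.v 24) (.v 10))
    (blk [storeP 22 (.v 22) (.v 24 + .c 1), storeP 23 (.v 22) (.v 25),
      storeP 22 (.v 22 + .c 1) (.v 24 + .c 1),
      storeP 23 (.v 22 + .c 1) (.v 25 + .bin .shl (.c 1) (.v 24)),
      assign 22 (.v 22 + .c 2)])
    (assign 20 (.v 20 + .c 1)))
  .skip

/-- Take a query from the stack and answer it. -/
def popP (O : Prog) : Prog := blk [assign 22 (.v 22 - .c 1), assign 24 (.ld 22 (.v 22)),
  assign 25 (.ld 23 (.v 22)), queryP O, answerP]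

theorem tot_answerP {l s m n L i c r j p v : ℕ} {σ₀ σ : NS} {h : Fin m → RowKey l s}
    {st : List (ℕ × ℕ)} (hw : 2 * r + 1 < wsz w) (hwn : 2 ^ n + 1 < wsz w)
    (hwc : c + 1 < wsz w) (hws : st.length + 2 < wsz w) (hR : Rep n L σ₀ h i c st σ)
    (hh : HasHash n h σ) (h10 : σ.reg 10 = n) (h16 : σ.reg 16 = r) (h24 : σ.reg 24 = j)
    (h25 : σ.reg 25 = p) (h26 : σ.reg 26 = v) (hv : v ≤ r) (hj : j ≤ n) (hp : p < 2 ^ j) :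
    Tot w answerP 150 σ fun σ' =>
      Rep n L σ₀ h i (nextC n c j (decide (r < 2 * v))) (nextSt n st j p (decide (r < 2 * v))) σ' ∧
        σ'.reg 23 = σ.reg 23 := by
  have hjn : j < 2 ^ n := hj.trans_lt Nat.lt_two_pow_self
  have hpn : 2 ^ j ≤ 2 ^ n := Nat.pow_le_pow_right (by omega) hj
  refine ewp_ite ⟨by simp, by simp [h26]; omega⟩ (by simp) ?_ ?_
  · intro hval
    have hb : r < 2 * v := by
      by_contra hb
      simp [h16, h26] at hval
      omega
    simp only [nextC, nextSt, hb, decide_true, true_and]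
    refine ewp_ite ⟨by simp, by simp; omega⟩ (by simp) ?_ ?_
    · intro hval'
      have hjn' : j < n := by
        by_contra hb
        simp [h24, h10, hb] at hval'
      have hpj : 2 ^ (j + 1) ≤ 2 ^ n := Nat.pow_le_pow_right (by omega) hjn'
      rw [pow_succ] at hpj
      rw [if_neg (by simp [hjn']), if_pos hjn']
      refine blk_store ⟨by simp, by simp⟩ ⟨by simp, by simp [h24]; omega⟩ (by simp) ?_
      refine blk_store ⟨by simp, by simp⟩ ⟨by simp, by simp⟩ (by simp) ?_
      refine blk_store ⟨by simp, by simp [hR.r22]; omega⟩ ⟨by simp, by simp [h24]; omega⟩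
        (by simp) ?_
      refine blk_store ⟨by simp, by simp [hR.r22]; omega⟩ ⟨by simp, by simp [h24, h25]; omega⟩
        (by simp) ?_
      refine blk_assign (by simp) ⟨by simp, by simp [hR.r22]; omega⟩ (by simp) ?_
      refine blk_nil (by simp) (ind_of ⟨⟨?_, ?_, ?_, ?_, ?_, ?_, ?_, ?_, hR.hi⟩, ?_⟩).ge
      · exact ((((hR.fr.setM (by omega)).setM (by omega)).setM (by omega)).setM (by omega)).setR
          (by omega)
      · simpa using hR.r20
      · simpa using hR.r21
      · simp [hR.r22]
      · have p1 := hR.m22.push (i := σ.reg 22) (by simp [hR.r22]) (j + 1)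
        have p2 := p1.push (i := σ.reg 22 + 1) (by simp [hR.r22]) (j + 1)
        simpa [h24] using p2
      · have p1 := hR.m23.push (i := σ.reg 22) (by simp [hR.r22]) p
        have p2 := p1.push (i := σ.reg 22 + 1) (by simp [hR.r22]) (p + 2 ^ j)
        simpa [h24, h25] using p2
      · intro _
        exact ((((hh.setM (by omega)).setM (by omega)).setM (by omega)).setM (by omega)).setR
          (by omega)
      · intro e he
        rw [List.mem_append] at he
        rcases he with he | he
        · exact hR.ok e he
        · simp only [List.mem_cons, List.not_mem_nil, or_false] at he
          rcases he with rfl | rfl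
          · exact ⟨hjn', by simp only [pow_succ]; omega⟩
          · exact ⟨hjn', by simp only [pow_succ]; omega⟩
      · simp
    · intro hval'
      have hjn' : ¬ j < n := by
        intro hb
        simp [h24, h10, hb] at hval'
      rw [if_pos hjn', if_neg hjn']
      refine le_trans ?_ ((ewp_assign ⟨by simp, by simp [hR.r20]; omega⟩ (by simp)).trans
        (ewp_mono (by simp) fun _ => le_rfl))
      refine (ind_of ⟨⟨hR.fr.setR (by omega), ?_, ?_, ?_, hR.m22, hR.m23,
        fun _ => hh.setR (by omega), hR.ok, hR.hi⟩, ?_⟩).ge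
      · simp [hR.r20]
      · simpa using hR.r21
      · simpa using hR.r22
      · simp
  · intro hval
    have hb : ¬ r < 2 * v := by
      intro hb
      simp [h16, h26] at hval
      omega
    refine blk_nil (by simp) (ind_of ⟨?_, rfl⟩).ge
    simpa [nextC, nextSt, hb] using hR

section
variable {k l s m n L B r T₀ : ℕ} {O : Prog} {F : KCNF k n} {σ₀ : NS}

/-- Even a wrong majority leaves a well-formed search state, with some bit `b` in place of the true
answer; thus halting and memory bounds do not depend on the votes, and only the success probability
does. -/
theorem tot_popP (hL : LevelOk w O F l s m L B r T₀ σ₀) {i c j p : ℕ} {σ : NS}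
    {h : Fin m → RowKey l s} {st : List (ℕ × ℕ)} (hc : c ≤ B) (hst : st.length ≤ B)
    (hR : Rep n L σ₀ h i c (st ++ [(j, p)]) σ) :
    Tot w (popP O) (queryT (codeL F.codes).length n m T₀ r + 180) σ (fun σ' => ∃ b,
      Rep n L σ₀ h i (nextC n c j b) (nextSt n st j p b) σ' ∧ σ'.reg 23 = σ.reg 23) ∧
    ((amp r 0 : ℝ≥0) : ℝ≥0∞) ≤ ewp w (popP O) (queryT (codeL F.codes).length n m T₀ r + 180)
      (ind fun σ' => Rep n L σ₀ h i (nextC n c j (decide (F.bucket h j p ≠ 0)))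
        (nextSt n st j p (decide (F.bucket h j p ≠ 0))) σ' ∧ σ'.reg 23 = σ.reg 23) σ := by
  obtain ⟨hj, hp⟩ := hR.ok (j, p) (by simp)
  have hwB := hL.wB
  have hwn := hL.wn
  have e22 : σ.reg 22 = st.length + 1 := by simpa using hR.r22
  have ej : σ.mem 22 st.length = j := hR.m22 _ _ (by simp)
  have ep : σ.mem 23 st.length = p := hR.m23 _ _ (by simp)
  have hh := hR.hash (by simp)
  set σ₁ := ((σ.setR 22 st.length).setR 24 j).setR 25 p with hσ₁
  have hR1 : Rep n L σ₀ h i c st σ₁ := by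
    refine ⟨((hR.fr.setR (by omega)).setR (by omega)).setR (by omega), ?_, ?_, ?_, ?_, ?_,
      fun _ => ((hh.setR (by omega)).setR (by omega)).setR (by omega), ?_, hR.hi⟩
    · simpa [hσ₁] using hR.r20
    · simpa [hσ₁] using hR.r21
    · simp [hσ₁]
    · have := hR.m22; rw [List.map_append] at this; exact this.of_append
    · have := hR.m23; rw [List.map_append] at this; exact this.of_append
    · exact fun e he => hR.ok e (List.mem_append_left _ he)
  have hh1 : HasHash n h σ₁ := ((hh.setR (by omega)).setR (by omega)).setR (by omega)
  have hF1 : HasFormula F σ₁ := hL.hF.of_fr hR1.fr (by omega) (by omega)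
  have hwr := hL.wr
  have hq := tot_queryP (O := O) (T₀ := T₀) (r := r) (σ := σ₁) (j := j) (p := p) hL.hk hL.hm hL.wlen
    hL.wmn (by omega) hF1 hh1 (by simp [hσ₁]) (by simp [hσ₁])
    (by rw [hR1.fr.reg 16 (by omega), hL.r16]) (hL.orc h j p)
  have h23 : σ₁.reg 23 = σ.reg 23 := by simp [hσ₁]
  have pre : ∀ (x : ℝ≥0∞) f, x ≤ ewp w (blk [queryP O, answerP])
      (queryT (codeL F.codes).length n m T₀ r + 155) f σ₁ →
      x ≤ ewp w (popP O) (queryT (codeL F.codes).length n m T₀ r + 180) f σ := by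
    intro x f hx
    generalize queryT (codeL F.codes).length n m T₀ r = TQ at hx ⊢
    refine blk_assign (by simp) ⟨by simp, by simp [e22]; omega⟩ (by simp) ?_
    refine blk_assign (by simp) ⟨by simp, by simp⟩ (by simp) ?_
    refine blk_assign (by simp) ⟨by simp, by simp⟩ (by simp) ?_
    have : ((σ.setR 22 ((Ex.v 22 - Ex.c 1).val σ)).setR 24
        ((Ex.ld 22 (Ex.v 22)).val (σ.setR 22 ((Ex.v 22 - Ex.c 1).val σ)))).setR 25
        ((Ex.ld 23 (Ex.v 22)).val ((σ.setR 22 ((Ex.v 22 - Ex.c 1).val σ)).setR 24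
        ((Ex.ld 22 (Ex.v 22)).val (σ.setR 22 ((Ex.v 22 - Ex.c 1).val σ))))) = σ₁ := by
      simp [hσ₁, e22, ej, ep]
    rw [this]
    exact hx.trans (ewp_mono (by simp) fun _ => le_rfl)
  have tail : ∀ σ₂, Fr 26 100 σ₁ σ₂ → σ₂.reg 26 ≤ r → Tot w (blk [answerP]) 152 σ₂ fun σ' =>
      Rep n L σ₀ h i (nextC n c j (decide (r < 2 * σ₂.reg 26)))
        (nextSt n st j p (decide (r < 2 * σ₂.reg 26))) σ' ∧ σ'.reg 23 = σ.reg 23 := by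
    intro σ₂ f2 hv
    have hR2 := hR1.of_fr f2 (by omega) (by omega)
    refine blk_tot (tot_answerP (r := r) (j := j) (p := p) hwr hwn (by omega) (by omega) hR2
      (hh1.of_fr f2 (by omega) (by omega))
      (by rw [hR2.fr.reg 10 (by omega), hL.hF.r10]) (by rw [hR2.fr.reg 16 (by omega), hL.r16])
      (by rw [f2.reg 24 (by omega)]; simp [hσ₁]) (by rw [f2.reg 25 (by omega)]; simp [hσ₁])
      rfl hv hj hp) (by omega) ?_
    rintro σ₃ ⟨g1, g2⟩
    refine blk_nil (by omega) (ind_of ⟨g1, ?_⟩).ge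
    rw [g2, f2.reg 23 (by omega), h23]
  constructor
  · refine pre _ _ (blk_tot hq.1 (by omega) ?_)
    rintro σ₂ ⟨f2, hv⟩
    refine (tail σ₂ f2 hv).mono (by omega) ?_
    rintro σ₃ g
    exact ⟨_, g⟩
  · have := blk_prob (x := 1) (T := queryT (codeL F.codes).length n m T₀ r + 155) (ps := [answerP])
      (f := ind fun σ' => Rep n L σ₀ h i (nextC n c j (decide (F.bucket h j p ≠ 0)))
        (nextSt n st j p (decide (F.bucket h j p ≠ 0))) σ' ∧ σ'.reg 23 = σ.reg 23)
      hq.2 (by omega) ?_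
    · rw [one_mul] at this
      exact pre _ _ this
    · rintro σ₂ ⟨⟨f2, hv⟩, hans⟩
      rw [F.query_satisfiable] at hans
      have := tail σ₂ f2 hv
      simp only [hans] at this
      exact this.mono (by omega) fun _ h => h

/-- Start a new trial. -/
def startP (s : ℕ) : Prog := blk [sampleP s, storeP 22 (.c 0) (.c 0), storeP 23 (.c 0) (.c 0),
  assign 22 (.c 1), assign 21 (.v 21 + .c 1)]

theorem samp_startP (hL : LevelOk w O F l s m L B r T₀ σ₀) {i c : ℕ} {σ : NS}
    {h₀ : Fin m → RowKey l s} (hi : i < L) (hR : Rep n L σ₀ h₀ i c [] σ) :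
    Samp w (startP s) (sampleT l s n m + 50) σ fun (h : Fin m → RowKey l s) σ' =>
      Rep n L σ₀ h (i + 1) c [(0, 0)] σ' ∧ σ'.reg 23 = σ.reg 23 := by
  have hwl := hL.wl
  have hl2 : l < 2 ^ l := Nat.lt_two_pow_self
  have hwn := hL.wn
  have hwL := hL.wL
  have hn2 : n < 2 ^ n := Nat.lt_two_pow_self
  have hm := hL.hm
  refine (samp_sampleP hL.w0 (by omega) (by omega) hL.wmn (by omega) hL.ws
    (by rw [hR.fr.reg 13 (by omega), hL.r13]) (by rw [hR.fr.reg 10 (by omega), hL.hF.r10])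
    (by rw [hR.fr.reg 19 (by omega), hL.r19])).blk_tot (by omega) ?_
  rintro h σ₁ ⟨f1, hh⟩
  have e21 : σ₁.reg 21 = i := by rw [f1.reg 21 (by omega), hR.r21]
  generalize sampleT l s n m = TS
  refine blk_store ⟨by simp, by simp; omega⟩ ⟨by simp, by simp; omega⟩ (by simp) ?_
  refine blk_store ⟨by simp, by simp; omega⟩ ⟨by simp, by simp; omega⟩ (by simp) ?_
  refine blk_assign (by simp) ⟨by simp, by simp; omega⟩ (by simp) ?_
  refine blk_assign (by simp) ⟨by simp, by simp [e21]; omega⟩ (by simp) ?_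
  refine blk_nil (by simp) (ind_of ⟨⟨?_, ?_, ?_, ?_, ?_, ?_, ?_, ?_, hi⟩, ?_⟩).ge
  · have : Fr 20 20 σ₀ σ₁ := hR.fr.trans
      ⟨fun r hr => f1.reg r (by omega), fun A hA => f1.mem A (by omega) (by omega) (by omega)⟩
    exact (((this.setM (by omega)).setM (by omega)).setR (by omega)).setR (by omega)
  · simp [f1.reg 20 (by omega), hR.r20]
  · simp [e21]
  · simp
  · simpa using (Holds.nil (σ₁.mem 22)).push (i := 0) rfl 0
  · simpa using (Holds.nil (σ₁.mem 23)).push (i := 0) rfl 0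
  · intro _
    exact (((hh.setM (by omega)).setM (by omega)).setR (by omega)).setR (by omega)
  · simp
  · simp [f1.reg 23 (by omega)]

end

end WordRAM

/-! ### The budget of a level and its potential -/

namespace WordRAM

variable {w : ℕ}

theorem amp_le_one (i : ℕ) (d : ℤ) : amp i d ≤ 1 := by
  induction i generalizing d with
  | zero => simp only [amp]; split_ifs <;> simp
  | succ i ih =>
    simp only [amp]
    refine (add_le_add (mul_le_mul_right (ih _) _) (mul_le_mul_right (ih _) _)).trans (le_of_eq ?_)
    ext; push_cast; norm_num

/-- One step of the search. -/
def searchP (O : Prog) (s : ℕ) : Prog :=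
  iteP (.v 22) (popP O) (iteP (.bin .lt (.v 21) (.v 14)) (startP s) .skip)

/-- Count the solutions in the buckets of random hash functions. -/
def levelP (O : Prog) (s : ℕ) : Prog := blk [assign 20 (.c 0), assign 21 (.c 0), assign 22 (.c 0),
  forP 23 (.v 15) (searchP O s)]

/-- The time bound for `levelP`. -/
def levelT (len l s n m B r T₀ : ℕ) : ℕ :=
  (B + 1) * (sampleT l s n m + queryT len n m T₀ r + 250) + 50

section
variable {k l s m n L B r T₀ : ℕ} {O : Prog} {F : KCNF k n} {σ₀ : NS}

/-- The number of solutions that the queries on the stack lead to. -/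
noncomputable def stackSum (F : KCNF k n) (h : Fin m → RowKey l s) (st : List (ℕ × ℕ)) : ℕ :=
  (st.map fun e => F.bucket h e.1 e.2).sum

/-- A bound for the number of queries that the queries on the stack lead to. -/
noncomputable def stackPot (F : KCNF k n) (h : Fin m → RowKey l s) (st : List (ℕ × ℕ)) : ℕ :=
  (st.map fun e => 1 + 2 * (n - e.1) * F.bucket h e.1 e.2).sum

/-- With correct answers, the solutions found plus those still below the stack are conserved, so a
finished trial has counted its bucket exactly. -/
theorem next_sum (h : Fin m → RowKey l s) (st : List (ℕ × ℕ)) (c : ℕ) {j p : ℕ} (hj : j ≤ n)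
    (hp : p < 2 ^ j) :
    nextC n c j (decide (F.bucket h j p ≠ 0)) +
        stackSum F h (nextSt n st j p (decide (F.bucket h j p ≠ 0))) =
      c + stackSum F h (st ++ [(j, p)]) := by
  unfold nextC nextSt stackSum
  by_cases hZ : F.bucket h j p = 0
  · simp [hZ]
  · by_cases hjn : j < n
    · have := F.bucket_split h hjn hp
      simp [hZ, hjn]; omega
    · obtain rfl : j = n := by omega
      have := F.bucket_leaf h p
      have h1 : F.bucket h j p = 1 := by omega
      simp [h1]; omega

/-- A prefix of length `j` whose bucket has size `Z > 0` carries potential `1 + 2 (n - j) Z`, its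
two extensions together carry `2 + 2 (n - j - 1) Z`, and the difference is `2 Z - 1 ≥ 1`. An empty
bucket and a leaf give up their own `1`. -/
theorem next_pot (h : Fin m → RowKey l s) (st : List (ℕ × ℕ)) {j p : ℕ}
    (hp : p < 2 ^ j) :
    stackPot F h (nextSt n st j p (decide (F.bucket h j p ≠ 0))) + 1 ≤
      stackPot F h (st ++ [(j, p)]) := by
  unfold nextSt stackPot
  by_cases hZ : F.bucket h j p = 0
  · simp [hZ]
  · by_cases hjn : j < n
    · have := F.bucket_split h hjn hp
      obtain ⟨d, rfl⟩ : ∃ d, n = j + 1 + d := ⟨n - j - 1, by omega⟩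
      have e1 : j + 1 + d - (j + 1) = d := by omega
      have e2 : j + 1 + d - j = d + 1 := by omega
      rw [if_pos ⟨by simpa using hZ, hjn⟩]
      simp only [List.map_append, List.sum_append, List.map_cons, List.map_nil, List.sum_cons,
        List.sum_nil, e1, e2]
      nlinarith [Nat.pos_of_ne_zero hZ]
    · simp [hjn]

theorem length_nextSt (st : List (ℕ × ℕ)) (j p : ℕ) (b : Bool) :
    (nextSt n st j p b).length ≤ st.length + 2 := by
  unfold nextSt; split_ifs <;> simp

theorem nextC_le (c j : ℕ) (b : Bool) : nextC n c j b ≤ c + 1 := by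
  unfold nextC; split_ifs <;> omega

theorem Rep.init (L n : ℕ) (h : Fin m → RowKey l s) (σ₀ : NS) :
    Rep n L σ₀ h 0 0 [] ((((σ₀.setR 20 0).setR 21 0).setR 22 0).setR 23 0) where
  fr := ((((Fr.refl _ _ _).setR (by omega)).setR (by omega)).setR (by omega)).setR (by omega)
  r20 := by simp
  r21 := by simp
  r22 := by simp
  m22 := Holds.nil _
  m23 := Holds.nil _
  hash := fun h => absurd rfl h
  ok := by simp
  hi := Nat.zero_le _

theorem levelP_pre (w0 : 3 < wsz w) {T : ℕ} {f : NS → ℝ≥0∞} {x : ℝ≥0∞}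
    (h : x ≤ ewp w (forP 23 (.v 15) (searchP O s)) T f
      (((σ₀.setR 20 0).setR 21 0).setR 22 0)) :
    x ≤ ewp w (levelP O s) (T + 20) f σ₀ := by
  refine blk_assign (by simp) ⟨by simp, by simp; omega⟩ (by simp) ?_
  refine blk_assign (by simp) ⟨by simp, by simp; omega⟩ (by simp) ?_
  refine blk_assign (by simp) ⟨by simp, by simp; omega⟩ (by simp) ?_
  refine blk_cons (T₁ := T) (by simp) ?_
  exact h.trans (ewp_mono le_rfl fun s' => blk_nil (by simp) le_rfl)

/-- A pop removes one entry and adds at most two, so stack length and count are at most the number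
of steps made, whatever the answers are. This rules out overflow. -/
theorem tot_searchP (hL : LevelOk w O F l s m L B r T₀ σ₀) {i c q : ℕ} {σ : NS}
    {h : Fin m → RowKey l s} {st : List (ℕ × ℕ)} (hq : q < B) (hc : c ≤ q) (hst : st.length ≤ q)
    (hR : Rep n L σ₀ h i c st σ) :
    Tot w (searchP O s) (sampleT l s n m + queryT (codeL F.codes).length n m T₀ r + 200) σ
      fun σ' => σ'.reg 23 = σ.reg 23 ∧ ∃ (h' : Fin m → RowKey l s) (i' c' : ℕ) (st' : _),
        Rep n L σ₀ h' i' c' st' σ' ∧ c' ≤ q + 1 ∧ st'.length ≤ q + 1 := by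
  have hwB := hL.wB
  refine ewp_ite ⟨by simp, by simp⟩ (by simp) ?_ ?_
  · intro hv
    have hne : st ≠ [] := by rintro rfl; simp [hR.r22] at hv
    obtain ⟨st, ⟨j, p⟩, rfl⟩ : ∃ st' e, st = st' ++ [e] :=
      ⟨st.dropLast, st.getLast hne, (List.dropLast_append_getLast hne).symm⟩
    rw [List.length_append] at hst
    simp only [List.length_singleton] at hst
    refine (tot_popP hL (by omega) (by omega) hR).1.mono (by simp; omega) ?_
    rintro σ' ⟨b, g1, g2⟩
    have := length_nextSt (n := n) st j p b
    have := nextC_le (n := n) c j b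
    exact ⟨g2, h, _, _, _, g1, by omega, by omega⟩
  · intro hv
    have hnil : st = [] := by
      have := hR.r22
      rw [show σ.reg 22 = 0 by simpa using hv] at this
      exact List.length_eq_zero_iff.1 this.symm
    subst hnil
    refine ewp_ite ⟨by simp, by simp; omega⟩ (by simp) ?_ ?_
    · intro hv'
      have hi : i < L := by
        by_contra hge
        simp [hR.r21, hR.fr.reg 14, hL.r14, hge] at hv'
      refine ((samp_startP hL hi hR).mono (by simp; omega) fun _ _ h => h).tot ?_
      rintro h' σ' ⟨g1, g2⟩
      exact ⟨g2, h', _, _, _, g1, by omega, by simp⟩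
    · intro _
      exact blk_nil (by simp) (ind_of ⟨rfl, h, _, _, _, hR, by omega, by simp⟩).ge

theorem tot_levelP (hL : LevelOk w O F l s m L B r T₀ σ₀) :
    Tot w (levelP O s) (levelT (codeL F.codes).length l s n m B r T₀) σ₀ fun σ' =>
      Fr 20 20 σ₀ σ' ∧ σ'.reg 20 ≤ B := by
  have hwB := hL.wB
  unfold levelT
  generalize hTb : sampleT l s n m + queryT (codeL F.codes).length n m T₀ r + 200 = Tb
  have e : (B + 1) * (sampleT l s n m + queryT (codeL F.codes).length n m T₀ r + 250) =
    (B + 1) * (Tb + 50) := by rw [← hTb]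
  rw [e]
  refine (levelP_pre (T := (B + 1) * (Tb + 50)) (x := 1) (by omega) ?_).trans
    (ewp_mono (by omega) fun _ => le_rfl)
  refine Tot.mono (tot_for (N := B) (Tb := Tb) (by simp) (by omega) (by simp)
    (fun q σ => σ.reg 23 = q ∧ ∃ (h : Fin m → RowKey l s) (i c : ℕ) (st : _),
      Rep n L σ₀ h i c st σ ∧ c ≤ q ∧ st.length ≤ q) ?_ ?_ ?_ (by simp)) le_rfl ?_
  · rintro q hq σ ⟨g1, h, i, c, st, hR, -⟩
    exact ⟨g1, by simp, by simp [hR.fr.reg 15, hL.r15]⟩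
  · rintro q hq σ ⟨g1, h, i, c, st, hR, hc, hst⟩
    refine (tot_searchP hL hq hc hst hR).mono (le_of_eq hTb) ?_
    rintro σ' ⟨f1, h', i', c', st', hR', hc', hst'⟩
    exact ⟨by omega, by simp, h', i', c', st', hR'.setR (by omega), hc', hst'⟩
  · exact ⟨by simp, fun _ => (fun _ _ => false, false), 0, 0, [], Rep.init _ _ _ _, le_rfl, by simp⟩
  · rintro σ' ⟨-, h, i, c, st, hR, hc, -⟩
    exact ⟨hR.fr, by rw [hR.r20]; exact hc⟩

/-- A lower bound by the event that all answers within the budget are right, at the price of the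
factor `amp r 0 ^ B`. In that event a completed level ends with the true total, while an incomplete
one forces the total `x` that full trials would have had to satisfy `B ≤ 2 L + 2 n x`. -/
theorem ewp_levelP (hL : LevelOk w O F l s m L B r T₀ σ₀) (A : ℕ → ℝ≥0) (f : NS → ℝ≥0∞)
    (hfin : ∀ σ', Fr 20 20 σ₀ σ' → σ'.reg 20 ≤ B → σ'.reg 22 = 0 → σ'.reg 21 = L →
      (A (σ'.reg 20) : ℝ≥0∞) ≤ f σ')
    (hunf : ∀ σ', Fr 20 20 σ₀ σ' → σ'.reg 20 ≤ B → ¬ (σ'.reg 22 = 0 ∧ σ'.reg 21 = L) →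
      ∀ x, B ≤ 2 * L + 2 * n * x → (A x : ℝ≥0∞) ≤ f σ') :
    ((amp r 0 ^ B * trials (fun h : Fin m → RowKey l s => F.bucket h 0 0) A L 0 : ℝ≥0) : ℝ≥0∞) ≤
      ewp w (levelP O s) (levelT (codeL F.codes).length l s n m B r T₀) f σ₀ := by
  have hwB := hL.wB
  unfold levelT
  generalize hTb : sampleT l s n m + queryT (codeL F.codes).length n m T₀ r + 200 = Tb
  have e : (B + 1) * (sampleT l s n m + queryT (codeL F.codes).length n m T₀ r + 250) =
    (B + 1) * (Tb + 50) := by rw [← hTb]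
  rw [e]
  refine (levelP_pre (T := (B + 1) * (Tb + 50)) (by omega) ?_).trans
    (ewp_mono (by omega) fun _ => le_rfl)
  set Z : (Fin m → RowKey l s) → ℕ := fun h => F.bucket h 0 0 with hZ
  -- Each trial pays one step for its start and one for its root query, which gives `2 * i`. The
  -- bound is claimed only while work remains, because afterwards the loop idles without progress.
  let Inv : ℕ → (Fin m → RowKey l s) → ℕ → ℕ → List (ℕ × ℕ) → NS → Prop := fun q h i c st σ =>
    σ.reg 23 = q ∧ Rep n L σ₀ h i c st σ ∧ c ≤ q ∧ st.length ≤ q ∧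
      (i < L ∨ st ≠ [] → q + stackPot F h st ≤ 2 * i + 2 * n * (c + stackSum F h st))
  -- The current hash function enters through the exact number of solutions below the stack; the
  -- trials that have not begun are averaged.
  let val : ℕ → (Fin m → RowKey l s) → ℕ → ℕ → List (ℕ × ℕ) → ℝ≥0 := fun q h i c st =>
    amp r 0 ^ (B - q) * trials Z A (L - i) (c + stackSum F h st)
  have hfor := ewp_for (w := w) (i := 23) (N := B) (Tb := Tb) (e := .v 15) (p := searchP O s)
    (f := f) (by simp) (by omega) (by simp)
    (fun q σ => ⨆ (h) (i) (c) (st) (_ : Inv q h i c st σ), (val q h i c st : ℝ≥0∞)) ?_ ?_ ?_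
    (((σ₀.setR 20 0).setR 21 0).setR 22 0)
  · refine le_trans ?_ (hfor.trans (ewp_mono (by simp) fun _ => le_rfl))
    refine le_iSup_of_le (fun _ => (fun _ _ => false, false)) (le_iSup_of_le 0 (le_iSup_of_le 0
      (le_iSup_of_le [] (le_iSup_of_le ⟨by simp, Rep.init _ _ _ _, le_rfl, by simp, ?_⟩ ?_))))
    · simp [stackPot]
    · simp [val, stackSum]
  · intro q hq σ hσ
    have : ∃ h i c st, Inv q h i c st σ := by
      by_contra hne
      push Not at hne
      exact hσ (by simp [hne])
    obtain ⟨h, i, c, st, g1, hR, -⟩ := this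
    exact ⟨g1, by simp, by simp [hR.fr.reg 15, hL.r15]⟩
  · intro q hq σ
    refine iSup_le fun h => iSup_le fun i => iSup_le fun c => iSup_le fun st => iSup_le ?_
    rintro ⟨g1, hR, hc, hst, hpot⟩
    have up : ∀ {h' : Fin m → RowKey l s} {i' c' st'} {x : ℝ≥0∞} {σ' : NS}, σ'.reg 23 = σ.reg 23 →
        Inv (q + 1) h' i' c' st' (σ'.setR 23 (q + 1)) → x ≤ val (q + 1) h' i' c' st' →
        x ≤ if σ'.reg 23 = q then ⨆ (h) (i) (c) (st) (_ : Inv (q + 1) h i c st (σ'.setR 23 (q + 1))),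
          (val (q + 1) h i c st : ℝ≥0∞) else 0 := by
      intro h' i' c' st' x σ' h23 hI hx
      rw [if_pos (by omega)]
      exact hx.trans (le_iSup_of_le h' (le_iSup_of_le i' (le_iSup_of_le c' (le_iSup_of_le st'
        (le_iSup_of_le hI le_rfl)))))
    have hpow : amp r 0 ^ (B - q) = amp r 0 ^ (B - (q + 1)) * amp r 0 := by
      rw [← pow_succ]; congr 1; omega
    have hpow' : amp r 0 ^ (B - q) ≤ amp r 0 ^ (B - (q + 1)) := by
      rw [hpow]; exact mul_le_of_le_one_right' (amp_le_one _ _)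
    refine ewp_ite ⟨by simp, by simp⟩ (by simp; omega) ?_ ?_
    · intro hv
      have hne : st ≠ [] := by rintro rfl; simp [hR.r22] at hv
      obtain ⟨st, ⟨j, p⟩, rfl⟩ : ∃ st' e, st = st' ++ [e] :=
        ⟨st.dropLast, st.getLast hne, (List.dropLast_append_getLast hne).symm⟩
      have hst' := hst
      rw [List.length_append] at hst'
      simp only [List.length_singleton] at hst'
      obtain ⟨hj, hp⟩ : j ≤ n ∧ p < 2 ^ j := hR.ok (j, p) (by simp)
      have hs := next_sum (F := F) h st c hj hp
      have hp' := next_pot (F := F) h st (j := j) hp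
      have hpt := hpot (Or.inr (by simp))
      have hl := length_nextSt (n := n) st j p (decide (F.bucket h j p ≠ 0))
      have hc' := nextC_le (n := n) c j (decide (F.bucket h j p ≠ 0))
      have hpop := (tot_popP hL (by omega) (by omega) hR).2
      have := ewp_of_ind (x := ((amp r 0 ^ (B - (q + 1)) *
        trials Z A (L - i) (c + stackSum F h (st ++ [(j, p)])) : ℝ≥0) : ℝ≥0∞)) hpop (f := fun s' =>
          if s'.reg 23 = q then ⨆ (h) (i) (c) (st) (_ : Inv (q + 1) h i c st (s'.setR 23 (q + 1))),
          (val (q + 1) h i c st : ℝ≥0∞) else 0) ?_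
      · refine le_trans (le_of_eq ?_) (this.trans (ewp_mono (by simp; omega) fun _ => le_rfl))
        rw [← ENNReal.coe_mul]
        simp only [val, hpow]
        congr 1
        ring
      · rintro σ' ⟨f1, f2⟩
        refine up f2 ⟨by simp, f1.setR (by omega), by omega, by omega, fun _ => ?_⟩ ?_
        · rw [hs]; omega
        · simp only [val]
          rw [hs]
    · intro hv
      have hnil : st = [] := by
        have := hR.r22
        rw [show σ.reg 22 = 0 by simpa using hv] at this
        exact List.length_eq_zero_iff.1 this.symm
      subst hnil
      refine ewp_ite ⟨by simp, by simp; omega⟩ (by simp; omega) ?_ ?_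
      · intro hv'
        have hi : i < L := by
          by_contra hge
          simp [hR.r21, hR.fr.reg 14, hL.r14, hge] at hv'
        have hsamp := (samp_startP hL hi hR).mono (T' := Tb - (3 + 7)) (by omega) (fun _ _ h => h)
        have hpt := hpot (Or.inl hi)
        obtain ⟨t, ht⟩ : ∃ t, L - i = t + 1 := ⟨L - i - 1, by omega⟩
        have ht' : L - (i + 1) = t := by omega
        have := hsamp (fun h' => amp r 0 ^ (B - (q + 1)) * trials Z A t (c + Z h')) (fun s' =>
          if s'.reg 23 = q then ⨆ (h) (i) (c) (st) (_ : Inv (q + 1) h i c st (s'.setR 23 (q + 1))),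
          (val (q + 1) h i c st : ℝ≥0∞) else 0) ?_
        · refine le_trans ?_ (this.trans (ewp_mono (by simp; omega) fun _ => le_rfl))
          rw [avg_mul_left, ENNReal.coe_le_coe]
          simp only [val, ht, trials, stackSum, List.map_nil, List.sum_nil, add_zero]
          exact mul_le_mul_left hpow' _
        · rintro h' σ' ⟨f1, f2⟩
          refine up f2 ⟨by simp, f1.setR (by omega), by omega, by simp, fun _ => ?_⟩ ?_
          · simp only [stackPot, stackSum, List.map_nil, List.sum_nil, List.map_cons,
              List.sum_cons, add_zero, Nat.sub_zero] at hpt ⊢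
            nlinarith
          · simp [val, ht', stackSum, hZ]
      · intro hv'
        have hi : ¬ i < L := by
          intro hlt
          simp [hR.r21, hR.fr.reg 14, hL.r14, hlt] at hv'
        refine blk_nil (by simp; omega) ?_
        refine up rfl ⟨by simp, hR.setR (by omega), by omega, by simp, fun h => ?_⟩ ?_
        · rcases h with h | h
          · exact absurd h hi
          · exact absurd rfl h
        · simp only [val]
          rw [ENNReal.coe_le_coe]
          exact mul_le_mul_left hpow' _
  · intro σ
    refine iSup_le fun h => iSup_le fun i => iSup_le fun c => iSup_le fun st => iSup_le ?_
    rintro ⟨g1, hR, hc, hst, hpot⟩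
    simp only [val, Nat.sub_self, pow_zero, one_mul]
    have hi := hR.hi
    by_cases hdone : st = [] ∧ i = L
    · obtain ⟨rfl, rfl⟩ := hdone
      simp only [Nat.sub_self, trials, stackSum, List.map_nil, List.sum_nil, add_zero]
      have := hfin σ hR.fr (by rw [hR.r20]; exact hc) (by simpa using hR.r22) hR.r21
      rwa [hR.r20] at this
    · have hpt := hpot (by
        by_cases h0 : st = []
        · left
          have : i ≠ L := fun h => hdone ⟨h0, h⟩
          omega
        · exact Or.inr h0)
      have hu := hunf σ hR.fr (by rw [hR.r20]; exact hc) (by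
        rintro ⟨h1, h2⟩
        rw [hR.r22] at h1
        rw [hR.r21] at h2
        exact hdone ⟨List.length_eq_zero_iff.1 h1, h2⟩)
      by_cases htop : f σ = ⊤
      · rw [htop]; exact le_top
      · rw [← ENNReal.coe_toNNReal htop, ENNReal.coe_le_coe]
        -- Every final total is at least what is already found or below the stack, so the bound on
        -- the budget passes from the current total to `x`.
        refine trials_le _ _ fun x hx => ?_
        rw [← ENNReal.coe_le_coe, ENNReal.coe_toNNReal htop]
        refine hu x ?_
        have := Nat.mul_le_mul_left (2 * n) hx
        omega

end

end WordRAM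

theorem trials_mul {α : Type*} [Fintype α] (Z : α → ℕ) (A : ℕ → ℝ≥0) (y : ℝ≥0) (t x : ℕ) :
    trials Z (fun x => y * A x) t x = y * trials Z A t x := by
  induction t generalizing x with
  | zero => rfl
  | succ t ih => simp only [trials, ih, avg_mul_left]

namespace WordRAM

variable {w : ℕ}

/-! ### Trying all sizes of the hash values -/

/-- One level of the main loop. Register `17` says whether a result was found, register `18` is
the result. -/
def roundP (O : Prog) (s : ℕ) : Prog := iteP (.v 17) .skip (blk [levelP O s,
  iteP (.bin .and (.bin .lt (.v 22) (.c 1)) (.bin .eq (.v 21) (.v 14)))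
    (blk [assign 17 (.c 1), assign 18 (.bin .shl (.v 20) (.v 19))]) .skip])

/-- The main loop. -/
def outerP (O : Prog) (s : ℕ) : Prog := forP 19 (.v 10 + .c 1) (roundP O s)

/-- The time bound for `outerP`. -/
def outerT (len l s n B r T₀ : ℕ) : ℕ := (n + 2) * (levelT len l s n n B r T₀ + 80)

theorem levelT_mono {len l s n m m' B r T₀ : ℕ} (h : m ≤ m') :
    levelT len l s n m B r T₀ ≤ levelT len l s n m' B r T₀ := by
  unfold levelT sampleT queryT buildT
  gcongr

section
variable {k l s n L B r T₀ : ℕ} {O : Prog} {F : KCNF k n} {σ₀ : NS}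

theorem roundP_tail {m : ℕ} {σ : NS} (hw : 1 < wsz w) (hB : B * 2 ^ n < wsz w) (hm : m ≤ n)
    (h14 : σ.reg 14 = L) (h19 : σ.reg 19 = m) (h20 : σ.reg 20 ≤ B) {f : NS → ℝ≥0∞} {x : ℝ≥0∞}
    (h1 : σ.reg 22 = 0 → σ.reg 21 = L → x ≤ f ((σ.setR 17 1).setR 18 (σ.reg 20 * 2 ^ m)))
    (h2 : ¬ (σ.reg 22 = 0 ∧ σ.reg 21 = L) → x ≤ f σ) :
    x ≤ ewp w (blk [iteP (.bin .and (.bin .lt (.v 22) (.c 1)) (.bin .eq (.v 21) (.v 14)))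
      (blk [assign 17 (.c 1), assign 18 (.bin .shl (.v 20) (.v 19))]) .skip]) 49 f σ := by
  have hval : (Ex.bin .and (.bin .lt (.v 22) (.c 1)) (.bin .eq (.v 21) (.v 14))).val σ =
      if σ.reg 22 = 0 ∧ σ.reg 21 = L then 1 else 0 := by
    simp only [Ex.val_bin, BinOp.nat, Ex.val_v, Ex.val_c, h14, Nat.lt_one_iff]
    by_cases a : σ.reg 22 = 0 <;> by_cases b : σ.reg 21 = L <;> simp [a, b]
  refine blk_cons (T₁ := 45) (by simp) (ewp_ite ⟨by simp, by simp; omega⟩ (by simp) ?_ ?_)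
  · intro hv
    rw [hval] at hv
    have h : σ.reg 22 = 0 ∧ σ.reg 21 = L := by
      by_contra h
      simp [h] at hv
    refine blk_assign (by simp) ⟨by simp, by simp; omega⟩ (by simp) ?_
    have hlt : σ.reg 20 * 2 ^ m < wsz w :=
      (Nat.mul_le_mul h20 (Nat.pow_le_pow_right (by omega) hm)).trans_lt hB
    refine blk_assign (by simp) ⟨by simp, by simpa [h19] using hlt⟩ (by simp) ?_
    refine blk_nil (by simp) (blk_nil (by simp) ?_)
    simpa [h19] using h1 h.1 h.2
  · intro hv
    rw [hval] at hv
    have h : ¬ (σ.reg 22 = 0 ∧ σ.reg 21 = L) := by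
      intro h
      simp [h] at hv
    exact blk_nil (by simp) (blk_nil (by simp) (h2 h))

theorem Fr.setR_result {σ σ' : NS} (h : Fr 17 20 σ₀ σ) (h' : Fr 20 20 σ σ') (v : ℕ) :
    Fr 17 20 σ₀ ((σ'.setR 17 1).setR 18 v) :=
  ((h.trans (h'.mono (by omega) le_rfl)).setR (by omega)).setR (by omega)

theorem tot_outerP (hn : n + 2 < wsz w) (hB : B * 2 ^ n < wsz w) (h10 : σ₀.reg 10 = n)
    (hL : ∀ m ≤ n, ∀ σ, Fr 17 20 σ₀ σ → σ.reg 19 = m → LevelOk w O F l s m L B r T₀ σ) :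
    Tot w (outerP O s) (outerT (codeL F.codes).length l s n B r T₀) σ₀ fun σ' => Fr 17 20 σ₀ σ' := by
  refine Tot.mono (tot_for (N := n + 1) (Tb := levelT (codeL F.codes).length l s n n B r T₀ + 55)
    (by simp) (by omega) (by simp)
    (fun m σ => σ.reg 19 = m ∧ Fr 17 20 σ₀ σ) ?_ ?_ ?_ (by simp [outerT])) le_rfl ?_
  · rintro m hm σ ⟨g1, g2⟩
    exact ⟨g1, by simp [g2.reg 10, h10]; omega, by simp [g2.reg 10, h10]⟩
  · rintro m hm σ ⟨g1, g2⟩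
    have hl := hL m (by omega) σ g2 g1
    have hmono := levelT_mono (len := (codeL F.codes).length) (l := l) (s := s) (n := n) (B := B)
      (r := r) (T₀ := T₀) (show m ≤ n by omega)
    refine ewp_ite ⟨by simp, by simp⟩ (by simp) ?_ ?_
    · intro _
      exact blk_nil (by simp) (ind_of ⟨g1, by simp, g2.setR (by omega)⟩).ge
    · intro _
      refine blk_tot (tot_levelP hl) (by simp; omega) ?_
      rintro σ₁ ⟨f1, f2⟩
      refine (roundP_tail (n := n) (m := m) (by omega) hB (by omega) (by rw [f1.reg 14 (by omega), hl.r14])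
        (by rw [f1.reg 19 (by omega), g1]) f2 ?_ ?_).trans
        (ewp_mono (by simp; omega) fun _ => le_rfl)
      · intro _ _
        refine (ind_of ⟨?_, by simp, ?_⟩).ge
        · simp [f1.reg 19, g1]
        · exact (g2.setR_result f1 _).setR (by omega)
      · intro _
        refine (ind_of ⟨?_, by simp, ?_⟩).ge
        · simp [f1.reg 19, g1]
        · exact (g2.trans (f1.mono (by omega) le_rfl)).setR (by omega)
  · exact ⟨by simp, (Fr.refl _ _ _).setR (by omega)⟩
  · rintro σ' ⟨-, h⟩
    exact h

/-- Each level up to `M` succeeds with probability at least `y`, where success means that its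
hypothetical full total is accurate and all answers are right. A successful level either stops with
a good result or runs out of budget and hands over to the next; at level `M` accuracy excludes
running out. No independence beyond sequential composition is used. -/
theorem ewp_outerP (hn : n + 2 < wsz w) (hB : B * 2 ^ n < wsz w) (h10 : σ₀.reg 10 = n)
    (h17 : σ₀.reg 17 = 0)
    (hL : ∀ m ≤ n, ∀ σ, Fr 17 20 σ₀ σ → σ.reg 19 = m → LevelOk w O F l s m L B r T₀ σ)
    (G : ℕ → Prop) (A : ℕ → ℕ → ℝ≥0) {M : ℕ} (hM : M ≤ n) {y : ℝ≥0}
    (hA1 : ∀ m ≤ M, ∀ x, A m x ≤ 1) (hAG : ∀ m ≤ M, ∀ x, A m x ≠ 0 → G (x * 2 ^ m))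
    (hAB : ∀ x, A M x ≠ 0 → 2 * L + 2 * n * x < B)
    (hy : ∀ m ≤ M, y ≤ amp r 0 ^ B *
      trials (fun h : Fin m → RowKey l s => F.bucket h 0 0) (A m) L 0) :
    ((y ^ (M + 1) : ℝ≥0) : ℝ≥0∞) ≤ ewp w (outerP O s)
      (outerT (codeL F.codes).length l s n B r T₀) (ind fun σ' => Fr 17 20 σ₀ σ' ∧ G (σ'.reg 18))
      σ₀ := by
  classical
  have hy1 : y ≤ 1 := (hy 0 (Nat.zero_le _)).trans (mul_le_one' (pow_le_one' (amp_le_one _ _) _)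
    (trials_le _ _ fun x _ => hA1 0 (Nat.zero_le _) x))
  -- While no result is recorded, `M + 1 - m` levels still have to succeed. Once one is recorded, it
  -- counts if it is good; beyond level `M` nothing is promised without a result.
  let V : ℕ → NS → ℝ≥0∞ := fun m σ => if σ.reg 19 = m ∧ Fr 17 20 σ₀ σ then
    (if σ.reg 17 = 0 then (if m ≤ M then ((y ^ (M + 1 - m) : ℝ≥0) : ℝ≥0∞) else 0)
      else if G (σ.reg 18) then 1 else 0) else 0
  have hfor := ewp_for (w := w) (i := 19) (N := n + 1)
    (Tb := levelT (codeL F.codes).length l s n n B r T₀ + 55) (e := .v 10 + .c 1) (p := roundP O s)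
    (f := ind fun σ' => Fr 17 20 σ₀ σ' ∧ G (σ'.reg 18)) (by simp) (by omega) (by simp) V ?_ ?_ ?_ σ₀
  · refine le_trans (le_of_eq ?_) (hfor.trans (ewp_mono (by simp [outerT]) fun _ => le_rfl))
    simp only [V]
    rw [if_pos ⟨by simp, (Fr.refl _ _ _).setR (by omega)⟩, if_pos (by simpa using h17),
      if_pos (Nat.zero_le _), Nat.sub_zero]
  · intro m hm σ hσ
    have : σ.reg 19 = m ∧ Fr 17 20 σ₀ σ := by
      by_contra h
      exact hσ (if_neg h)
    exact ⟨this.1, by simp [this.2.reg 10, h10]; omega, by simp [this.2.reg 10, h10]⟩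
  · intro m hm σ
    simp only [V]
    by_cases g : σ.reg 19 = m ∧ Fr 17 20 σ₀ σ
    swap
    · rw [if_neg g]; exact zero_le
    rw [if_pos g]
    by_cases h17 : σ.reg 17 = 0
    · rw [if_pos h17]
      by_cases hmM : m ≤ M
      swap
      · rw [if_neg hmM]; exact zero_le
      rw [if_pos hmM]
      obtain ⟨g1, g2⟩ := g
      have hl := hL m (by omega) σ g2 g1
      have hmono := levelT_mono (len := (codeL F.codes).length) (l := l) (s := s) (n := n) (B := B)
        (r := r) (T₀ := T₀) (show m ≤ n by omega)
      refine ewp_ite ⟨by simp, by simp⟩ (by simp) (fun h => absurd h17 (by simpa using h))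
        fun _ => ?_
      refine le_trans ?_ (blk_cons (T₁ := levelT (codeL F.codes).length l s n m B r T₀)
        (by simp; omega) (ewp_levelP hl (fun x => y ^ (M - m) * A m x) _ ?_ ?_))
      · rw [trials_mul, ENNReal.coe_le_coe, show M + 1 - m = (M - m) + 1 by omega, pow_succ]
        calc y ^ (M - m) * y ≤ y ^ (M - m) * (amp r 0 ^ B *
              trials (fun h : Fin m → RowKey l s => F.bucket h 0 0) (A m) L 0) :=
              mul_le_mul_right (hy m hmM) _
          _ = _ := by ring
      · intro σ' f1 hc h22 h21
        refine (roundP_tail (n := n) (m := m) (by omega) hB (by omega)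
          (by rw [f1.reg 14 (by omega), hl.r14]) (by rw [f1.reg 19 (by omega), g1]) hc ?_
          (fun h => absurd ⟨h22, h21⟩ h)).trans (ewp_mono (by simp; omega) fun _ => le_rfl)
        intro _ _
        by_cases hA0 : A m (σ'.reg 20) = 0
        · simp [hA0]
        · have e : (((σ'.setR 17 1).setR 18 (σ'.reg 20 * 2 ^ m)).reg 19 = m) := by
            simp [f1.reg 19, g1]
          rw [if_pos e, if_pos ⟨by simp, (g2.setR_result f1 _).setR (by omega)⟩,
            if_neg (by simp), if_pos (by simpa using hAG m hmM _ hA0)]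
          exact_mod_cast mul_le_one' (pow_le_one' hy1 _) (hA1 m hmM _)
      · intro σ' f1 hc hun x hx
        refine (roundP_tail (n := n) (m := m) (by omega) hB (by omega)
          (by rw [f1.reg 14 (by omega), hl.r14]) (by rw [f1.reg 19 (by omega), g1]) hc
          (fun h1 h2 => absurd ⟨h1, h2⟩ hun) fun _ => ?_).trans
          (ewp_mono (by simp; omega) fun _ => le_rfl)
        by_cases hmM' : m < M
        · have e : σ'.reg 19 = m := by rw [f1.reg 19 (by omega), g1]
          rw [if_pos e, if_pos ⟨by simp, (g2.trans (f1.mono (by omega) le_rfl)).setR (by omega)⟩,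
            if_pos (by simp [f1.reg 17, h17]), if_pos (by omega),
            show M + 1 - (m + 1) = M - m by omega, ENNReal.coe_le_coe]
          exact mul_le_of_le_one_right' (hA1 m hmM x)
        -- At level `M` an accurate total needs fewer than `B` steps, so for the totals compatible
        -- with an incomplete run the promise is `0`.
        · obtain rfl : m = M := by omega
          have : A m x = 0 := by
            by_contra h0
            have := hAB x h0
            omega
          simp [this]
    · rw [if_neg h17]
      by_cases hG : G (σ.reg 18)
      swap
      · rw [if_neg hG]; exact zero_le
      rw [if_pos hG]
      obtain ⟨g1, g2⟩ := g
      refine ewp_ite ⟨by simp, by simp⟩ (by simp) (fun _ => ?_)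
        fun h => absurd (by simpa using h) h17
      refine blk_nil (by simp) ?_
      rw [if_pos g1, if_pos ⟨by simp, g2.setR (by omega)⟩, if_neg (by simpa using h17),
        if_pos (by simpa using hG)]
  · intro σ
    simp only [V]
    split_ifs with g h17 hmM hG <;> try exact zero_le
    · omega
    · rw [ind_of ⟨g.2, hG⟩]

end

end WordRAM

open WordRAM

/-! ### Moments of the bucket sizes -/

theorem bval_bijective (l : ℕ) :
    Function.Bijective fun b : Fin l → Bool => (⟨bval b, bval_lt b⟩ : Fin (2 ^ l)) := by
  have h : (fun b : Fin l → Bool => (⟨bval b, bval_lt b⟩ : Fin (2 ^ l))) =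
      (Equiv.arrowCongr (Equiv.refl (Fin l)) finTwoEquiv.symm).trans finFunctionFinEquiv := by
    funext b
    apply Fin.ext
    simp only [Equiv.trans_apply, finFunctionFinEquiv_apply, bval]
    refine Finset.sum_congr rfl fun i _ => ?_
    simp only [Equiv.arrowCongr_apply, Equiv.refl_symm, Equiv.coe_refl, Function.comp_apply, id]
    cases b i <;> simp [finTwoEquiv]
  rw [h]
  exact Equiv.bijective _

theorem card_bval_eq {l j : ℕ} (hj : j < 2 ^ l) :
    (Finset.univ.filter fun b : Fin l → Bool => bval b = j).card = 1 := by
  rw [Finset.card_eq_one]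
  obtain ⟨b, hb⟩ := (bval_bijective l).2 ⟨j, hj⟩
  refine ⟨b, ?_⟩
  ext b'
  simp only [Finset.mem_filter, Finset.mem_univ, true_and, Finset.mem_singleton]
  constructor
  · intro h
    apply (bval_bijective l).1
    rw [hb]
    exact Fin.ext h
  · rintro rfl
    exact congrArg Fin.val hb

/-- The nontrivial character of `ZMod 2`. -/
def sgn (a : ZMod 2) : ℝ := if a = 0 then 1 else -1

theorem zmod_two_cases (a : ZMod 2) : a = 0 ∨ a = 1 := by revert a; decide

theorem sgn_add (a b : ZMod 2) : sgn (a + b) = sgn a * sgn b := by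
  rcases zmod_two_cases a with rfl | rfl <;> rcases zmod_two_cases b with rfl | rfl <;>
    simp [sgn, show (1 + 1 : ZMod 2) = 0 from rfl]

theorem sgn_sum {ι : Type*} (S : Finset ι) (a : ι → ZMod 2) :
    sgn (∑ i ∈ S, a i) = ∏ i ∈ S, sgn (a i) := by
  classical
  induction S using Finset.induction_on with
  | empty => simp [sgn]
  | insert i S hi ih => rw [Finset.sum_insert hi, Finset.prod_insert hi, sgn_add, ih]

theorem indicator_eq_sgn (a : ZMod 2) : (if a = 0 then (1 : ℝ) else 0) = (1 + sgn a) / 2 := by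
  unfold sgn; split_ifs <;> norm_num

/-- The number of nonzero entries. -/
def wt {n : ℕ} (z : Fin n → ZMod 2) : ℕ := (Finset.univ.filter fun j => z j ≠ 0).card

theorem wt_le {n : ℕ} (z : Fin n → ZMod 2) : wt z ≤ n :=
  (Finset.card_le_univ _).trans (Fintype.card_fin n).le

theorem sum_pow_wt (n : ℕ) (y : ℝ) : ∑ z : Fin n → ZMod 2, y ^ wt z = (1 + y) ^ n := by
  have h1 : ∀ z : Fin n → ZMod 2, y ^ wt z = ∏ j, if z j ≠ 0 then y else 1 := by
    intro z
    rw [Finset.prod_ite, Finset.prod_const, Finset.prod_const_one, mul_one, wt]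
  have h2 : ∑ a : ZMod 2, (if a ≠ 0 then y else 1) = 1 + y := by
    rw [show (Finset.univ : Finset (ZMod 2)) = {0, 1} from rfl, Finset.sum_pair (by decide)]
    simp
  simp only [h1]
  have := Finset.prod_univ_sum (fun _ : Fin n => (Finset.univ : Finset (ZMod 2)))
    (fun (_ : Fin n) a => if a ≠ 0 then y else (1 : ℝ))
  rw [Fintype.piFinset_univ] at this
  rw [← this]
  simp only [h2, Finset.prod_const, Finset.card_univ, Fintype.card_fin]

/-- Exponential Markov inequality: `y ^ (wt z - t) ≥ 1` whenever `wt z ≤ t`, and summing `y ^ wt z`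
over all vectors gives `(1 + y) ^ n`. -/
theorem card_wt_le (n : ℕ) {y : ℝ} (hy0 : 0 < y) (hy1 : y ≤ 1) (t : ℝ) :
    ((Finset.univ.filter fun z : Fin n → ZMod 2 => (wt z : ℝ) ≤ t).card : ℝ) ≤
      (1 + y) ^ n * y ^ (-t) := by
  rw [← sum_pow_wt, Finset.sum_mul, Finset.card_eq_sum_ones, Finset.sum_filter]
  push_cast
  refine Finset.sum_le_sum fun z _ => ?_
  split_ifs with h
  · rw [← Real.rpow_natCast, ← Real.rpow_add hy0]
    exact Real.one_le_rpow_of_pos_of_le_one_of_nonpos hy0 hy1 (by linarith)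
  · positivity

section rows
variable {l s n : ℕ}

theorem rowVec_dotProduct (u : Fin s → Fin l → Bool) (z : Fin n → ZMod 2) :
    rowVec n u ⬝ᵥ z = ∑ t, ∑ j : Fin n, if bval (u t) = (j : ℕ) then z j else 0 := by
  simp only [dotProduct, rowVec, Finset.sum_mul]
  rw [Finset.sum_comm]
  simp only [ite_mul, one_mul, zero_mul]

theorem sgn_word (b : Fin l → Bool) (z : Fin n → ZMod 2) :
    sgn (∑ j : Fin n, if bval b = (j : ℕ) then z j else 0) =
      1 - 2 * ∑ j ∈ Finset.univ.filter (fun j => z j ≠ 0), if bval b = (j : ℕ) then (1 : ℝ) else 0 := by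
  by_cases h : bval b < n
  · have e : ∀ j : Fin n, (bval b = (j : ℕ)) = (j = ⟨bval b, h⟩) := fun j =>
      propext ⟨fun h' => Fin.ext h'.symm, fun h' => by rw [h']⟩
    simp only [e]
    rw [Finset.sum_ite_eq', Finset.sum_ite_eq', if_pos (Finset.mem_univ _)]
    simp only [Finset.mem_filter, Finset.mem_univ, true_and, sgn]
    by_cases h0 : z ⟨bval b, h⟩ = 0 <;> simp [h0]
    norm_num
  · have e : ∀ j : Fin n, ¬ bval b = (j : ℕ) := fun j => by have := j.isLt; omega
    simp [e, sgn]

/-- Each position below `n` is named by exactly one word, and only the words naming a nonzero entry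
of `z` have sign `-1`. -/
theorem sum_sgn_word (hl : n ≤ 2 ^ l) (z : Fin n → ZMod 2) :
    ∑ b : Fin l → Bool, sgn (∑ j : Fin n, if bval b = (j : ℕ) then z j else 0) =
      2 ^ l - 2 * wt z := by
  simp only [sgn_word]
  rw [Finset.sum_sub_distrib, ← Finset.mul_sum, Finset.sum_comm]
  have : ∀ j : Fin n, ∑ b : Fin l → Bool, (if bval b = (j : ℕ) then (1 : ℝ) else 0) = 1 := by
    intro j
    rw [← Finset.sum_filter, Finset.sum_const, card_bval_eq (j.isLt.trans_le hl)]
    simp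
  simp [this, wt]

/-- The indicator of `0` in `ZMod 2` is the mean of the two characters. The nontrivial character
turns the sum over independent words into the `s`-th power of the sum over one word. -/
theorem sum_orthogonal (hl : n ≤ 2 ^ l) (z : Fin n → ZMod 2) :
    ∑ u : Fin s → Fin l → Bool, (if rowVec n u ⬝ᵥ z = 0 then (1 : ℝ) else 0) =
      ((2 ^ l) ^ s + (2 ^ l - 2 * wt z) ^ s) / 2 := by
  have e : ∀ u : Fin s → Fin l → Bool, (if rowVec n u ⬝ᵥ z = 0 then (1 : ℝ) else 0) =
      (1 + ∏ t, sgn (∑ j : Fin n, if bval (u t) = (j : ℕ) then z j else 0)) / 2 := fun u => by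
    rw [indicator_eq_sgn, rowVec_dotProduct, sgn_sum]
  simp only [e]
  rw [← Finset.sum_div, Finset.sum_add_distrib]
  have := Finset.prod_univ_sum (fun _ : Fin s => (Finset.univ : Finset (Fin l → Bool)))
    (fun (_ : Fin s) b => sgn (∑ j : Fin n, if bval b = (j : ℕ) then z j else 0))
  rw [Fintype.piFinset_univ] at this
  rw [← this, sum_sgn_word hl]
  simp

/-- The equation holds for `x`. -/
def RowAgrees (x : Fin n → ZMod 2) (r : RowKey l s) : Prop :=
  rowVec n r.1 ⬝ᵥ x = ((r.2.toNat : ℕ) : ZMod 2)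

instance (x : Fin n → ZMod 2) (r : RowKey l s) : Decidable (RowAgrees x r) := by
  unfold RowAgrees; infer_instance

/-- Both equations hold exactly if the row is orthogonal to `x - y` and the right-hand side is the
common value, and one of its two values is. -/
theorem sum_rowAgrees_and (hl : n ≤ 2 ^ l) (x y : Fin n → ZMod 2) :
    ∑ r : RowKey l s, (if RowAgrees x r ∧ RowAgrees y r then (1 : ℝ) else 0) =
      ((2 ^ l) ^ s + (2 ^ l - 2 * wt (x - y)) ^ s) / 2 := by
  rw [← sum_orthogonal hl, Fintype.sum_prod_type]
  refine Finset.sum_congr rfl fun u _ => ?_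
  simp only [RowAgrees, Fintype.sum_bool, dotProduct_sub, sub_eq_zero, Bool.toNat_true,
    Bool.toNat_false, Nat.cast_one, Nat.cast_zero]
  rcases zmod_two_cases (rowVec n u ⬝ᵥ x) with h | h <;>
    rcases zmod_two_cases (rowVec n u ⬝ᵥ y) with h' | h' <;> simp [h, h']

theorem sum_rowAgrees (hl : n ≤ 2 ^ l) (x : Fin n → ZMod 2) :
    ∑ r : RowKey l s, (if RowAgrees x r then (1 : ℝ) else 0) = (2 ^ l) ^ s := by
  have := sum_rowAgrees_and (s := s) hl x x
  simp only [and_self, sub_self] at this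
  rw [this]
  simp [wt]

theorem card_rowKey : (Fintype.card (RowKey l s) : ℝ) = 2 * (2 ^ l) ^ s := by
  simp [mul_comm]

end rows

theorem sum_forall_rows {α : Type*} [Fintype α] {m : ℕ} (P : α → Prop) [DecidablePred P] :
    ∑ h : Fin m → α, (if ∀ i, P (h i) then (1 : ℝ) else 0) =
      (∑ r, if P r then (1 : ℝ) else 0) ^ m := by
  have := Finset.prod_univ_sum (fun _ : Fin m => (Finset.univ : Finset α))
    (fun (_ : Fin m) r => if P r then (1 : ℝ) else 0)
  rw [Fintype.piFinset_univ] at this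
  rw [Finset.prod_const, Finset.card_univ, Fintype.card_fin] at this
  rw [this]
  refine Finset.sum_congr rfl fun h _ => ?_
  rw [Finset.prod_ite_zero]
  simp

namespace KCNF
variable {k n l s m : ℕ} (F : KCNF k n)

theorem bucket_zero (h : Fin m → RowKey l s) (S : Finset (Fin n → ZMod 2))
    (hS : ∀ x, x ∈ S ↔ F.Sat x) :
    (F.bucket h 0 0 : ℝ) = ∑ x ∈ S, if ∀ i, RowAgrees x (h i) then (1 : ℝ) else 0 := by
  classical
  unfold bucket
  rw [← Finset.sum_filter, Finset.sum_const, nsmul_eq_mul, mul_one]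
  congr 2
  ext x
  rw [Finset.mem_filter, Finset.mem_filter, hS, funext_iff]
  simp [hashRhs, RowAgrees, Matrix.mulVec, hashMat]

theorem sum_bucket (hl : n ≤ 2 ^ l) (S : Finset (Fin n → ZMod 2)) (hS : ∀ x, x ∈ S ↔ F.Sat x) :
    (∑ h : Fin m → RowKey l s, (F.bucket h 0 0 : ℝ)) / Fintype.card (Fin m → RowKey l s) =
      S.card / 2 ^ m := by
  simp only [F.bucket_zero _ S hS]
  rw [Finset.sum_comm]
  simp only [sum_forall_rows, sum_rowAgrees hl]
  rw [Finset.sum_const, nsmul_eq_mul, Fintype.card_fun, Fintype.card_fin]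
  push_cast [card_rowKey]
  rw [mul_pow]
  field_simp

/-- The second moment is a sum over pairs of solutions, with one factor per row. A pair at distance
at most `t` contributes at most `2 ^ (-m)`, and each solution has at most `K` such partners; every
other pair contributes at most `((1 + ρ) / 4) ^ m`. The condition `2 * n ≤ 2 ^ l` makes the
correlations nonnegative. -/
theorem sum_bucket_sq (hl : 2 * n ≤ 2 ^ l) (S : Finset (Fin n → ZMod 2))
    (hS : ∀ x, x ∈ S ↔ F.Sat x) {K t ρ : ℝ} (hρ : 0 ≤ ρ)
    (hK : ((Finset.univ.filter fun z : Fin n → ZMod 2 => (wt z : ℝ) ≤ t).card : ℝ) ≤ K)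
    (hfar : ∀ d : ℕ, d ≤ n → t < d → (1 - 2 * d / 2 ^ l : ℝ) ^ s ≤ ρ) :
    (∑ h : Fin m → RowKey l s, (F.bucket h 0 0 : ℝ) ^ 2) / Fintype.card (Fin m → RowKey l s) ≤
      (S.card / 2 ^ m) * K + (S.card / 2 ^ m) ^ 2 * (1 + ρ) ^ m := by
  have hl1 : n ≤ 2 ^ l := by omega
  have hlR : 2 * (n : ℝ) ≤ 2 ^ l := by exact_mod_cast hl
  have e1 : ∀ h : Fin m → RowKey l s, (F.bucket h 0 0 : ℝ) ^ 2 =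
      ∑ x ∈ S, ∑ y ∈ S, if ∀ i, RowAgrees x (h i) ∧ RowAgrees y (h i) then (1 : ℝ) else 0 := by
    intro h
    rw [F.bucket_zero _ S hS, sq, Finset.sum_mul_sum]
    refine Finset.sum_congr rfl fun x _ => Finset.sum_congr rfl fun y _ => ?_
    simp only [forall_and, mul_ite, mul_one, mul_zero]
    by_cases h1 : ∀ i, RowAgrees x (h i) <;> by_cases h2 : ∀ i, RowAgrees y (h i) <;> simp [h1, h2]
  have e2 : (∑ h : Fin m → RowKey l s, (F.bucket h 0 0 : ℝ) ^ 2) /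
      Fintype.card (Fin m → RowKey l s) =
      ∑ x ∈ S, ∑ y ∈ S, ((1 + (1 - 2 * (wt (x - y) : ℝ) / 2 ^ l) ^ s) / 4) ^ m := by
    simp only [e1]
    rw [Finset.sum_comm, Finset.sum_div]
    refine Finset.sum_congr rfl fun x _ => ?_
    rw [Finset.sum_comm, Finset.sum_div]
    refine Finset.sum_congr rfl fun y _ => ?_
    rw [sum_forall_rows (fun r => RowAgrees x r ∧ RowAgrees y r), sum_rowAgrees_and hl1,
      Fintype.card_fun, Fintype.card_fin]
    push_cast [card_rowKey]
    rw [← div_pow]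
    congr 1
    rw [show (1 - 2 * (wt (x - y) : ℝ) / 2 ^ l) = (2 ^ l - 2 * wt (x - y)) / 2 ^ l by field_simp,
      div_pow]
    field_simp
    ring
  rw [e2]
  have hbase : ∀ z : Fin n → ZMod 2, 0 ≤ (1 - 2 * (wt z : ℝ) / 2 ^ l) ∧
      (1 - 2 * (wt z : ℝ) / 2 ^ l) ≤ 1 := by
    intro z
    have hz : (wt z : ℝ) ≤ n := by exact_mod_cast wt_le z
    have h2 : (0 : ℝ) < 2 ^ l := by positivity
    constructor
    · rw [sub_nonneg, div_le_one h2]; linarith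
    · have : 0 ≤ 2 * (wt z : ℝ) / 2 ^ l := by positivity
      linarith
  have hterm : ∀ z : Fin n → ZMod 2, ((1 + (1 - 2 * (wt z : ℝ) / 2 ^ l) ^ s) / 4) ^ m ≤
      (if (wt z : ℝ) ≤ t then (1 / 2) ^ m else 0) + ((1 + ρ) / 4) ^ m := by
    intro z
    obtain ⟨b0, b1⟩ := hbase z
    have hp0 : 0 ≤ (1 - 2 * (wt z : ℝ) / 2 ^ l) ^ s := pow_nonneg b0 _
    split_ifs with h
    · have hp1 : (1 - 2 * (wt z : ℝ) / 2 ^ l) ^ s ≤ 1 := pow_le_one₀ b0 b1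
      have : ((1 + (1 - 2 * (wt z : ℝ) / 2 ^ l) ^ s) / 4) ^ m ≤ (1 / 2) ^ m :=
        pow_le_pow_left₀ (by linarith) (by linarith) _
      have h3 : 0 ≤ ((1 + ρ) / 4) ^ m := by positivity
      linarith
    · rw [zero_add]
      have := hfar (wt z) (wt_le z) (not_le.1 h)
      exact pow_le_pow_left₀ (by linarith) (by linarith) _
  have hrow : ∀ x ∈ S, ∑ y ∈ S, ((1 + (1 - 2 * (wt (x - y) : ℝ) / 2 ^ l) ^ s) / 4) ^ m ≤
      K * (1 / 2) ^ m + S.card * ((1 + ρ) / 4) ^ m := by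
    intro x _
    refine (Finset.sum_le_sum fun y _ => hterm (x - y)).trans ?_
    rw [Finset.sum_add_distrib, Finset.sum_const, nsmul_eq_mul]
    refine add_le_add ?_ le_rfl
    -- The neighbours of `x` in `S` are bounded by all vectors of small weight, after the
    -- substitution `z = x - y`.
    calc ∑ y ∈ S, (if (wt (x - y) : ℝ) ≤ t then ((1 : ℝ) / 2) ^ m else 0)
        ≤ ∑ y : Fin n → ZMod 2, (if (wt (x - y) : ℝ) ≤ t then ((1 : ℝ) / 2) ^ m else 0) :=
          Finset.sum_le_univ_sum_of_nonneg fun y => by split_ifs <;> positivity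
      _ = ∑ z : Fin n → ZMod 2, (if (wt z : ℝ) ≤ t then ((1 : ℝ) / 2) ^ m else 0) :=
          Equiv.sum_comp (Equiv.subLeft x) fun z => if (wt z : ℝ) ≤ t then ((1 : ℝ) / 2) ^ m else 0
      _ = _ * (1 / 2) ^ m := by rw [← Finset.sum_filter, Finset.sum_const, nsmul_eq_mul]
      _ ≤ K * (1 / 2) ^ m := by gcongr
  refine (Finset.sum_le_sum hrow).trans (le_of_eq ?_)
  rw [Finset.sum_const, nsmul_eq_mul, show (4 : ℝ) = 2 * 2 by norm_num, div_pow, div_pow, mul_pow]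
  field_simp
  ring

end KCNF

/-! ### Chebyshev's inequality -/

theorem coe_avg {α : Type*} [Fintype α] (g : α → ℝ≥0) :
    ((avg g : ℝ≥0) : ℝ) = (∑ a, (g a : ℝ)) / Fintype.card α := by
  simp [avg]

/-- Chebyshev's inequality by induction on the number of trials. The parabola `1 - (x - a) ^ 2 / τ`
lies below `A`, and averaging over one more trial shifts its centre by `μ` and costs at most `v /
τ`. -/
theorem le_trials {α : Type*} [Fintype α] [Nonempty α] (Z : α → ℕ) (A : ℕ → ℝ≥0) {μ v a τ : ℝ}
    (hμ : (∑ x, (Z x : ℝ)) / Fintype.card α = μ)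
    (hv : (∑ x, (Z x : ℝ) ^ 2) / Fintype.card α ≤ μ ^ 2 + v) (hτ : 0 < τ)
    (hA : ∀ x : ℕ, 1 - (x - a) ^ 2 / τ ≤ A x) (t x : ℕ) :
    1 - ((x + t * μ - a) ^ 2 + t * v) / τ ≤ trials Z A t x := by
  induction t generalizing x with
  | zero => simpa [trials] using hA x
  | succ t ih =>
    rw [trials, coe_avg]
    have hc : (0 : ℝ) < Fintype.card α := by exact_mod_cast Fintype.card_pos
    refine le_trans ?_ (div_le_div_of_nonneg_right (Finset.sum_le_sum fun y _ => ih (x + Z y)) hc.le)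
    rw [le_div_iff₀ hc]
    rw [div_eq_iff hc.ne'] at hμ
    rw [div_le_iff₀ hc] at hv
    set c : ℝ := x + t * μ - a with hcdef
    have e : ∀ y, 1 - ((((x + Z y : ℕ) : ℝ) + t * μ - a) ^ 2 + t * v) / τ =
        (1 - (c ^ 2 + t * v) / τ) - (2 * c / τ) * Z y - (1 / τ) * (Z y : ℝ) ^ 2 := by
      intro y
      rw [hcdef]
      push_cast
      ring
    simp only [e]
    rw [Finset.sum_sub_distrib, Finset.sum_sub_distrib, Finset.sum_const, ← Finset.mul_sum,
      ← Finset.mul_sum, hμ, Finset.card_univ, nsmul_eq_mul]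
    have h2 := mul_le_mul_of_nonneg_left hv (show 0 ≤ 1 / τ by positivity)
    refine le_trans (le_of_eq ?_) (sub_le_sub_left h2 _)
    rw [show (x : ℝ) + ((t + 1 : ℕ) : ℝ) * μ - a = c + μ by rw [hcdef]; push_cast; ring]
    push_cast
    ring

open WordRAM

/-! ### The success probability of a level -/

section bounds
variable {δ : ℝ}

theorem logb_six_div_pos (hδ0 : 0 < δ) (hδ1 : δ < 1) : 2 < Real.logb 2 (6 / δ) := by
  rw [Real.lt_logb_iff_rpow_lt (by norm_num) (by positivity), lt_div_iff₀ hδ0]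
  norm_num
  linarith

/-- It comes down to `1 / 6 < log 2 / 4`. -/
theorem pow_le_two_rpow (hδ0 : 0 < δ) (m : ℕ) :
    (1 + δ / 6) ^ m ≤ (2 : ℝ) ^ (δ * m / 4) := by
  have h1 : 1 + δ / 6 ≤ (2 : ℝ) ^ (δ / 4) := by
    rw [Real.rpow_def_of_pos (by norm_num)]
    have h2 := Real.add_one_le_exp (Real.log 2 * (δ / 4))
    have h3 := Real.log_two_gt_d9
    nlinarith
  calc (1 + δ / 6) ^ m ≤ ((2 : ℝ) ^ (δ / 4)) ^ m := pow_le_pow_left₀ (by positivity) h1 _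
    _ = _ := by rw [← Real.rpow_natCast, ← Real.rpow_mul (by norm_num)]; congr 1; ring

/-- The radius `δ n / (5 lg (6 / δ))` turns the power of `δ / 6` into exactly `2 ^ (δ n / 5)`, and
`1 / 4 + 1 / 5 ≤ 1 / 2`. -/
theorem near_le (hδ0 : 0 < δ) (hδ1 : δ < 1) (n : ℕ) :
    (1 + δ / 6) ^ n * (δ / 6) ^ (-(δ / (5 * Real.logb 2 (6 / δ)) * n)) ≤ (2 : ℝ) ^ (δ * n / 2) := by
  have hlg := logb_six_div_pos hδ0 hδ1
  have e : (δ / 6) ^ (-(δ / (5 * Real.logb 2 (6 / δ)) * n)) = (2 : ℝ) ^ (δ * n / 5) := by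
    rw [Real.rpow_neg (by positivity), ← Real.inv_rpow (by positivity), inv_div]
    nth_rewrite 1 [← Real.rpow_logb (b := 2) (x := 6 / δ) (by norm_num) (by norm_num) (by positivity)]
    rw [← Real.rpow_mul (by norm_num)]
    congr 1
    have : Real.logb 2 (6 / δ) ≠ 0 := by linarith
    field_simp
  rw [e]
  refine (mul_le_mul_of_nonneg_right (pow_le_two_rpow hδ0 n) (by positivity)).trans ?_
  rw [← Real.rpow_add (by norm_num)]
  refine Real.rpow_le_rpow_of_exponent_le (by norm_num) ?_
  have : 0 ≤ δ * n := by positivity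
  linarith

/-- With `γ = δ / (5 lg (6 / δ))`, the bound `2 ^ l ≤ 4 n` gives `2 d / 2 ^ l ≥ γ / 2`, and the
lower bound on `s` gives `s γ / 2 ≥ 12 lg (6 / δ)`; already `log 2 * lg (6 / δ)` would be enough for
`δ / 6`. -/
theorem far_le (hδ0 : 0 < δ) (hδ1 : δ < 1) {s n l d : ℕ} (hl : 2 * n ≤ 2 ^ l) (hl' : 2 ^ l ≤ 4 * n)
    (hs : 120 * Real.logb 2 (6 / δ) ^ 2 / δ ≤ (s : ℝ)) (hdn : d ≤ n)
    (hd : δ / (5 * Real.logb 2 (6 / δ)) * n < d) :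
    (1 - 2 * d / 2 ^ l : ℝ) ^ s ≤ δ / 6 := by
  have hlg := logb_six_div_pos hδ0 hδ1
  set lg := Real.logb 2 (6 / δ) with hlgdef
  have h2 : (0 : ℝ) < 2 ^ l := by positivity
  have hlR : 2 * (n : ℝ) ≤ 2 ^ l := by exact_mod_cast hl
  have hlR' : (2 : ℝ) ^ l ≤ 4 * n := by exact_mod_cast hl'
  have hn : (0 : ℝ) < n := by nlinarith
  have hdR : (d : ℝ) ≤ n := by exact_mod_cast hdn
  set γ := δ / (5 * lg) with hγ
  have hγ0 : 0 < γ := by positivity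
  have hx : γ / 2 ≤ 2 * (d : ℝ) / 2 ^ l := by
    rw [le_div_iff₀ h2]
    calc γ / 2 * 2 ^ l ≤ γ / 2 * (4 * n) := by gcongr
      _ = 2 * (γ * n) := by ring
      _ ≤ 2 * d := by linarith
  have hx1 : 2 * (d : ℝ) / 2 ^ l ≤ 1 := by rw [div_le_one h2]; linarith
  have h3 : (1 - 2 * d / 2 ^ l : ℝ) ≤ Real.exp (-(γ / 2)) := by
    have := Real.add_one_le_exp (-(γ / 2))
    linarith
  calc (1 - 2 * d / 2 ^ l : ℝ) ^ s ≤ Real.exp (-(γ / 2)) ^ s :=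
        pow_le_pow_left₀ (by linarith) h3 _
    _ = Real.exp (s * (-(γ / 2))) := by rw [← Real.exp_nat_mul]
    _ ≤ Real.exp (Real.log (δ / 6)) := by
        refine Real.exp_le_exp.2 ?_
        have h4 : 12 * lg ≤ s * (γ / 2) := by
          calc 12 * lg = (120 * lg ^ 2 / δ) * (γ / 2) := by
                rw [hγ]
                have : lg ≠ 0 := by linarith
                field_simp
                norm_num
            _ ≤ s * (γ / 2) := by gcongr
        have h5 : Real.log (δ / 6) = -(Real.log 2 * lg) := by
          rw [hlgdef, Real.logb, mul_div_cancel₀ _ (by positivity), ← Real.log_inv, inv_div]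
        have h6 := Real.log_two_lt_d9
        rw [h5]
        nlinarith
    _ = δ / 6 := Real.exp_log (by positivity)

end bounds

namespace KCNF
variable {k n l s m : ℕ} (F : KCNF k n)

theorem exists_solutions : ∃ S : Finset (Fin n → ZMod 2), (∀ x, x ∈ S ↔ F.Sat x) ∧
    S.card = F.numSat := by
  classical
  refine ⟨Finset.univ.filter fun x => F.Sat x, by simp, ?_⟩
  rw [numSat, Nat.card_eq_fintype_card, Fintype.card_subtype]

theorem numSat_le : F.numSat ≤ 2 ^ n := by
  obtain ⟨S, -, h⟩ := F.exists_solutions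
  rw [← h]
  refine (Finset.card_le_univ S).trans ?_
  simp [ZMod.card]

open Classical in
/-- The indicator function of the numbers close to `a`. -/
noncomputable def _root_.closeTo (ε a : ℝ) (x : ℕ) : ℝ≥0 := if |(x : ℝ) - a| ≤ ε * a then 1 else 0

theorem _root_.closeTo_le_one (ε a : ℝ) (x : ℕ) : closeTo ε a x ≤ 1 := by
  unfold closeTo; split_ifs <;> simp

theorem _root_.of_closeTo_ne_zero {ε a : ℝ} {x : ℕ} (h : closeTo ε a x ≠ 0) :
    |(x : ℝ) - a| ≤ ε * a := by
  by_contra h'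
  exact h (if_neg h')

/-- With `Q = 2 ^ (δ n / 2)` the variance of the total is at most `L μ Q (1 + μ)`. Since `2 ^ m ≤ 2
N` means `μ ≥ 1 / 2`, this is at most `3 L μ ^ 2 Q`, to be compared with the squared tolerance `(ε L
μ) ^ 2`; the constant `60` is `3 * 20`. -/
theorem le_trials_bucket {δ : ℝ} (hδ0 : 0 < δ) (hδ1 : δ < 1)
    (hs : 120 * Real.logb 2 (6 / δ) ^ 2 / δ ≤ (s : ℝ)) (hm : m ≤ n)
    (hl : 2 * n ≤ 2 ^ l) (hl' : 2 ^ l ≤ 4 * n) {ε : ℝ} (hε : 0 < ε) {L : ℕ}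
    (hL : 60 * ((n : ℝ) + 1) * 2 ^ (δ * n / 2) ≤ ε ^ 2 * L) (hN : 2 ^ m ≤ 2 * F.numSat) :
    1 - 1 / (20 * ((n : ℝ) + 1)) ≤ trials (fun h : Fin m → RowKey l s => F.bucket h 0 0)
      (closeTo ε (L * (F.numSat / 2 ^ m))) L 0 := by
  obtain ⟨S, hS, hcard⟩ := F.exists_solutions
  set μ : ℝ := F.numSat / 2 ^ m with hμ
  set Q : ℝ := 2 ^ (δ * n / 2) with hQ
  have hQ0 : 0 < Q := by positivity
  have hμ2 : 1 / 2 ≤ μ := by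
    rw [hμ, le_div_iff₀ (by positivity)]
    have : (2 : ℝ) ^ m ≤ 2 * F.numSat := by exact_mod_cast hN
    linarith
  have hLpos : (0 : ℝ) < L := by
    have : 0 < 60 * ((n : ℝ) + 1) * Q := by positivity
    have h2 : 0 < ε ^ 2 * L := this.trans_le hL
    exact pos_of_mul_pos_right h2 (by positivity)
  have hsq := F.sum_bucket_sq (s := s) (m := m) hl S hS (ρ := δ / 6)
    (t := δ / (5 * Real.logb 2 (6 / δ)) * n) (by positivity)
    ((card_wt_le n (y := δ / 6) (by positivity) (by linarith) _).trans (near_le hδ0 hδ1 n))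
    (fun d hdn hd => far_le hδ0 hδ1 hl hl' hs hdn hd)
  have hfar : (1 + δ / 6) ^ m ≤ Q := by
    refine (pow_le_two_rpow hδ0 m).trans (Real.rpow_le_rpow_of_exponent_le (by norm_num) ?_)
    have h1 : (m : ℝ) ≤ n := by exact_mod_cast hm
    have h2 : δ * m ≤ δ * n := by gcongr
    have h3 : 0 ≤ δ * (n : ℝ) := by positivity
    linarith
  have hmean := F.sum_bucket (s := s) (m := m) (show n ≤ 2 ^ l by omega) S hS
  rw [hcard] at hsq hmean
  have hv : (∑ h : Fin m → RowKey l s, (F.bucket h 0 0 : ℝ) ^ 2) /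
      -- The second moment itself serves as the bound `v` for the variance; the summand `μ ^ 2` is
      -- given away.
      Fintype.card (Fin m → RowKey l s) ≤ μ ^ 2 + (μ * Q + μ ^ 2 * Q) := by
    refine hsq.trans ?_
    have h1 : μ ^ 2 * (1 + δ / 6) ^ m ≤ μ ^ 2 * Q := by gcongr
    have h2 : 0 ≤ μ ^ 2 := by positivity
    linarith
  have hτ : 0 < (ε * (L * μ)) ^ 2 := by positivity
  have key := le_trials (fun h : Fin m → RowKey l s => F.bucket h 0 0)
    (closeTo ε (L * μ)) (a := L * μ) hmean hv hτ (fun x => ?_) L 0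
  · refine le_trans ?_ key
    have e : (((0 : ℕ) : ℝ) + L * μ - L * μ) ^ 2 + L * (μ * Q + μ ^ 2 * Q) =
        L * μ * Q * (1 + μ) := by push_cast; ring
    rw [e]
    refine sub_le_sub_left ?_ _
    rw [div_le_div_iff₀ hτ (by positivity), one_mul]
    calc L * μ * Q * (1 + μ) * (20 * ((n : ℝ) + 1)) ≤
          L * μ * Q * (3 * μ) * (20 * ((n : ℝ) + 1)) := by gcongr; linarith
      _ = L * μ ^ 2 * (60 * ((n : ℝ) + 1) * Q) := by ring
      _ ≤ L * μ ^ 2 * (ε ^ 2 * L) := by gcongr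
      _ = (ε * (L * μ)) ^ 2 := by ring
  · unfold closeTo
    split_ifs with h
    · have : 0 ≤ ((x : ℝ) - L * μ) ^ 2 / (ε * (L * μ)) ^ 2 := by positivity
      push_cast
      linarith
    · have h1 : ε * (L * μ) < |(x : ℝ) - L * μ| := not_le.1 h
      have h2 : 1 ≤ ((x : ℝ) - L * μ) ^ 2 / (ε * (L * μ)) ^ 2 := by
        rw [le_div_iff₀ hτ, one_mul, ← sq_abs ((x : ℝ) - L * μ)]
        exact pow_le_pow_left₀ (by positivity) h1.le 2
      push_cast
      linarith

/-! ### All levels together -/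

theorem _root_.trials_const {α : Type*} [Fintype α] [Nonempty α] {Z : α → ℕ} {c : ℕ}
    (hZ : ∀ a, Z a = c) (A : ℕ → ℝ≥0) (t x : ℕ) : trials Z A t x = A (x + t * c) := by
  induction t generalizing x with
  | zero => simp [trials]
  | succ t ih =>
    simp only [trials, hZ, ih, avg_const]
    congr 1; ring

theorem bucket_of_fin_zero (h : Fin 0 → RowKey l s) : F.bucket h 0 0 = F.numSat := by
  obtain ⟨S, hS, hcard⟩ := F.exists_solutions
  have := F.bucket_zero h S hS
  rw [← hcard]
  have h2 : (F.bucket h 0 0 : ℝ) = S.card := by simpa using this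
  exact_mod_cast h2

/-- The result is close to the number of solutions times `L`. -/
def IsGood (ε : ℝ) (L res : ℕ) : Prop :=
  (1 - ε) * (F.numSat * L) ≤ res ∧ (res : ℝ) ≤ (1 + ε) * (F.numSat * L)

/-- The conditions on the parameters. -/
structure ParamsOk (δ ε : ℝ) (n l L B r : ℕ) : Prop where
  hr : (B : ℝ) * (n + 1) * (17 / 18) ^ r ≤ 1 / 10
  h : (L = 1 ∧ B = (2 * n + 3) * 2 ^ n) ∨
    (2 * n ≤ 2 ^ l ∧ 2 ^ l ≤ 4 * n ∧ 0 < L ∧ B = (4 * n + 3) * L ∧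
      60 * ((n : ℝ) + 1) * 2 ^ (δ * n / 2) ≤ ε ^ 2 * L)

/-- By Bernoulli's inequality, all votes of all levels are right with probability at least `9 / 10`
and all levels are accurate with probability at least `19 / 20`. The product of these two bounds
exceeds `2 / 3`. -/
theorem _root_.prob_bound {n M B r : ℕ} (hM : M ≤ n) (hr : (B : ℝ) * (n + 1) * (17 / 18) ^ r ≤ 1 / 10) :
    2 / 3 ≤ (amp r 0 ^ B * (1 - 1 / (20 * ((n : ℝ≥0) + 1)))) ^ (M + 1) := by
  have hsub : (1 : ℝ) / (20 * ((n : ℝ) + 1)) ≤ 1 := by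
    rw [div_le_one (by positivity)]
    have : (0 : ℝ) ≤ n := by positivity
    linarith
  set x : ℝ≥0 := 1 - 1 / (20 * ((n : ℝ≥0) + 1)) with hx
  have hxR : (x : ℝ) = 1 - 1 / (20 * ((n : ℝ) + 1)) := by
    rw [hx, NNReal.coe_sub]
    · push_cast; ring
    · rw [← NNReal.coe_le_coe]; push_cast; exact hsub
  have hx1 : x ≤ 1 := tsub_le_self
  have h1 : (amp r 0 ^ B * x) ^ (n + 1) ≤ (amp r 0 ^ B * x) ^ (M + 1) :=
    pow_le_pow_right_of_le_one' (mul_le_one' (pow_le_one' (amp_le_one _ _) _) hx1) (by omega)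
  refine le_trans ?_ h1
  have hκ := le_amp r 0
  rw [zpow_zero, one_mul] at hκ
  have hq0 : (0 : ℝ) ≤ (17 / 18) ^ r := by positivity
  have hq1 : ((17 : ℝ) / 18) ^ r ≤ 1 := pow_le_one₀ (by norm_num) (by norm_num)
  have hA : (9 / 10 : ℝ) ≤ (amp r 0 : ℝ) ^ (B * (n + 1)) := by
    have hb := one_add_mul_le_pow (show (-2 : ℝ) ≤ -(17 / 18) ^ r by linarith) (B * (n + 1))
    have hp : (1 + -((17 : ℝ) / 18) ^ r) ^ (B * (n + 1)) ≤ (amp r 0 : ℝ) ^ (B * (n + 1)) :=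
      pow_le_pow_left₀ (by linarith) (by linarith) _
    push_cast at hb
    linarith
  have hX : (19 / 20 : ℝ) ≤ (x : ℝ) ^ (n + 1) := by
    have hb := one_add_mul_le_pow (a := -(1 / (20 * ((n : ℝ) + 1)))) (by linarith) (n + 1)
    rw [← sub_eq_add_neg 1, ← hxR] at hb
    have e : ((n + 1 : ℕ) : ℝ) * -(1 / (20 * ((n : ℝ) + 1))) = -(1 / 20) := by
      push_cast; field_simp
    rw [e] at hb
    linarith
  rw [← NNReal.coe_le_coe]
  push_cast
  rw [mul_pow, ← pow_mul]
  have := mul_le_mul hA hX (by norm_num) (by positivity)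
  linarith

/-- In the main case the last relevant level is `M = ⌈lg N⌉`: below and at it the mean is at least
`1 / 2`, at it the mean is at most `1`. The promise `A m` is the indicator of an accurate total. -/
theorem exists_levels {δ ε : ℝ} (hδ0 : 0 < δ) (hδ1 : δ < 1) (hε0 : 0 < ε) (hε1 : ε < 1)
    (hs : 120 * Real.logb 2 (6 / δ) ^ 2 / δ ≤ (s : ℝ)) {L B r : ℕ} (hP : ParamsOk δ ε n l L B r) :
    ∃ M ≤ n, ∃ (A : ℕ → ℕ → ℝ≥0) (y : ℝ≥0), (∀ m ≤ M, ∀ x, A m x ≤ 1) ∧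
      (∀ m ≤ M, ∀ x, A m x ≠ 0 → F.IsGood ε L (x * 2 ^ m)) ∧
      (∀ x, A M x ≠ 0 → 2 * L + 2 * n * x < B) ∧
      (∀ m ≤ M, y ≤ amp r 0 ^ B *
        trials (fun h : Fin m → RowKey l s => F.bucket h 0 0) (A m) L 0) ∧
      2 / 3 ≤ y ^ (M + 1) := by
  -- If there is no solution or counting is exact, level `0` suffices: without equations every
  -- bucket is the whole solution set, so the total is `L * F.numSat` with certainty. Relative
  -- accuracy leaves no room for error when there is no solution.
  by_cases hdet : F.numSat = 0 ∨ L = 1 ∧ B = (2 * n + 3) * 2 ^ n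
  · refine ⟨0, Nat.zero_le _, fun _ x => if x = L * F.numSat then 1 else 0,
      amp r 0 ^ B * (1 - 1 / (20 * ((n : ℝ≥0) + 1))), ?_, ?_, ?_, ?_, prob_bound (Nat.zero_le _) hP.hr⟩
    · intro m _ x; dsimp only; split_ifs <;> simp
    · intro m hm x hx
      obtain rfl : m = 0 := by omega
      have hx : x = L * F.numSat := by
        by_contra h
        exact hx (if_neg h)
      subst hx
      have : (0 : ℝ) ≤ F.numSat * L := by positivity
      constructor <;> push_cast <;> nlinarith
    · intro x hx
      have hx : x = L * F.numSat := by
        by_contra h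
        exact hx (if_neg h)
      subst hx
      rcases hdet with h0 | ⟨h1, h2⟩
      · rw [h0, mul_zero, mul_zero, add_zero]
        rcases hP.h with ⟨h1, h2⟩ | ⟨-, -, h1, h2, -⟩
        · rw [h1, h2]
          have : 1 ≤ 2 ^ n := Nat.one_le_two_pow
          nlinarith
        · rw [h2]; nlinarith
      · rw [h1, h2]
        have h3 := F.numSat_le
        have : 1 ≤ 2 ^ n := Nat.one_le_two_pow
        nlinarith [Nat.mul_le_mul_left n h3]
    · intro m hm
      obtain rfl : m = 0 := by omega
      rw [trials_const (fun h => F.bucket_of_fin_zero h), zero_add]; dsimp only; rw [if_pos rfl]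
      gcongr
      exact tsub_le_self
  · push Not at hdet
    obtain ⟨hN, hmode⟩ := hdet
    obtain ⟨hl, hl', hL0, hB, hLε⟩ := hP.h.resolve_left fun h => hmode h.1 h.2
    have hNpos : 0 < F.numSat := Nat.pos_of_ne_zero hN
    have hup : F.numSat ≤ 2 ^ Nat.clog 2 F.numSat := Nat.le_pow_clog (by norm_num) _
    have hlow : ∀ m ≤ Nat.clog 2 F.numSat, 2 ^ m ≤ 2 * F.numSat := by
      intro m hm
      refine (Nat.pow_le_pow_right (by norm_num) hm).trans ?_
      by_cases h1 : F.numSat = 1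
      · simp [h1]
      · have h2 := Nat.pow_pred_clog_lt_self (b := 2) (by norm_num) (show 1 < F.numSat by omega)
        have h3 : 0 < Nat.clog 2 F.numSat := Nat.clog_pos (by norm_num) (by omega)
        obtain ⟨c, hc⟩ : ∃ c, Nat.clog 2 F.numSat = c + 1 := ⟨_, (Nat.succ_pred_eq_of_pos h3).symm⟩
        rw [hc, pow_succ]
        rw [hc, Nat.pred_succ] at h2
        omega
    have hMn : Nat.clog 2 F.numSat ≤ n :=
      (Nat.clog_le_iff_le_pow (by norm_num)).2 F.numSat_le
    refine ⟨Nat.clog 2 F.numSat, hMn, fun m => closeTo ε (L * (F.numSat / 2 ^ m)),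
      amp r 0 ^ B * (1 - 1 / (20 * ((n : ℝ≥0) + 1))), fun _ _ x => closeTo_le_one _ _ x, ?_, ?_, ?_,
      prob_bound hMn hP.hr⟩
    · intro m _ x hx
      have h := abs_le.1 (of_closeTo_ne_zero hx)
      have h2 : (0 : ℝ) < 2 ^ m := by positivity
      have e : (L : ℝ) * (F.numSat / 2 ^ m) * 2 ^ m = F.numSat * L := by field_simp
      constructor
      · push_cast
        nlinarith [mul_le_mul_of_nonneg_right h.1 h2.le]
      · push_cast
        nlinarith [mul_le_mul_of_nonneg_right h.2 h2.le]
    · intro x hx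
      have h := (abs_le.1 (of_closeTo_ne_zero hx)).2
      have h1 : (F.numSat : ℝ) / 2 ^ Nat.clog 2 F.numSat ≤ 1 := by
        rw [div_le_one (by positivity)]
        exact_mod_cast hup
      have h2 : (L : ℝ) * (F.numSat / 2 ^ Nat.clog 2 F.numSat) ≤ L :=
        mul_le_of_le_one_right (by positivity) h1
      have h0 : (0 : ℝ) ≤ (L : ℝ) * (F.numSat / 2 ^ Nat.clog 2 F.numSat) := by positivity
      -- An accurate total at level `M` is at most `(1 + ε) L`, hence `2 L + 2 n x ≤ (4 n + 2) L <
      -- B`.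
      have h3 : (x : ℝ) ≤ 2 * L := by nlinarith
      have h4 : x ≤ 2 * L := by exact_mod_cast h3
      rw [hB]
      have := Nat.mul_le_mul_left (2 * n) h4
      nlinarith
    · intro m hm
      refine mul_le_mul_right ?_ _
      have := F.le_trials_bucket (s := s) hδ0 hδ1 hs (hm.trans hMn) hl hl' hε0 hLε (hlow m hm)
      rw [← NNReal.coe_le_coe, NNReal.coe_sub]
      · push_cast
        exact this
      · rw [← NNReal.coe_le_coe]
        push_cast
        rw [div_le_one (by positivity)]
        have : (0 : ℝ) ≤ n := by positivity
        linarith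

end KCNF

namespace WordRAM

variable {w : ℕ}

/-! ### Preparation -/

/-- Put the least `l` with `2 * n ≤ 2 ^ l` into register `13`. -/
def lenP : Prog := blk [assign 13 (.c 0), forP 30 (.v 10 + .v 10)
  (iteP (.bin .lt (.bin .shl (.c 1) (.v 13)) (.v 10 + .v 10)) (assign 13 (.v 13 + .c 1)) .skip)]

/-- The register grows only while `2 ^ l < 2 n`, which gives the upper bound `4 n`; after `2 n`
rounds either growth has stopped or `l ≥ 2 n`. It remains `0` when `n = 0`, so that case is kept
apart. -/
theorem tot_lenP {n : ℕ} {σ : NS} (hw : 4 * n + 3 < wsz w) (h10 : σ.reg 10 = n) :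
    Tot w lenP ((2 * n + 1) * 60 + 20) σ fun σ' => Fr 13 100 σ σ' ∧ 2 * n ≤ 2 ^ σ'.reg 13 ∧
      (σ'.reg 13 = 0 ∨ 2 ^ σ'.reg 13 ≤ 4 * n) := by
  refine blk_assign (by simp) ⟨by simp, by simp; omega⟩ (by simp) ?_
  refine blk_tot (tot_for (N := 2 * n) (Tb := 35) (by simp) (by omega) (by simp)
    (fun j σ' => σ'.reg 30 = j ∧ Fr 13 100 σ σ' ∧ (2 * n ≤ 2 ^ σ'.reg 13 ∨ j ≤ σ'.reg 13) ∧
      (σ'.reg 13 = 0 ∨ 2 ^ σ'.reg 13 ≤ 4 * n)) ?_ ?_ ?_ le_rfl) (by simp) ?_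
  · rintro j hj σ' ⟨g1, g2, -⟩
    have e10 : σ'.reg 10 = n := by rw [g2.reg 10 (by omega), h10]
    exact ⟨g1, by simp [e10]; omega, by simp [e10]; omega⟩
  · rintro j hj σ' ⟨g1, g2, g3, g4⟩
    have e10 : σ'.reg 10 = n := by rw [g2.reg 10 (by omega), h10]
    have hlt : 2 ^ σ'.reg 13 ≤ 4 * n + 1 := by
      rcases g4 with g4 | g4
      · rw [g4]; omega
      · omega
    have hlt' : σ'.reg 13 < 2 ^ σ'.reg 13 := Nat.lt_two_pow_self
    refine ewp_ite ⟨by simp, by simp [e10]; omega⟩ (by simp) ?_ ?_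
    · intro hv
      have h : 2 ^ σ'.reg 13 < 2 * n := by
        by_contra h
        simp [e10] at hv
        omega
      refine le_trans ?_ ((ewp_assign ⟨by simp, by simp; omega⟩ (by simp)).trans
        (ewp_mono (by simp) fun _ => le_rfl))
      refine (ind_of ⟨by simpa using g1, by simp, (g2.setR (by omega)).setR (by omega), ?_, ?_⟩).ge
      · right; simp; omega
      · right; simp [pow_succ]; omega
    · intro hv
      have h : 2 * n ≤ 2 ^ σ'.reg 13 := by
        by_contra h
        simp [e10] at hv
        omega
      refine blk_nil (by simp) (ind_of ⟨g1, by simp, g2.setR (by omega), ?_, ?_⟩).ge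
      · left; simpa using h
      · simpa using g4
  · exact ⟨by simp, ((Fr.refl _ _ _).setR (by omega)).setR (by omega), by simp, by simp⟩
  · rintro σ' ⟨-, g2, g3, g4⟩
    refine blk_nil (by simp) (ind_of ⟨g2, ?_, g4⟩).ge
    rcases g3 with g3 | g3
    · exact g3
    · exact g3.trans Nat.lt_two_pow_self.le

/-- Make the table of unit clauses in array `4`. -/
def flagsP : Prog := blk [
  forP 30 (.v 10 + .v 10) (blk [storeP 4 (.v 30) (.c 0)]),
  assign 31 (.c 0),
  walkP 30 31 (blk [
    iteP (.bin .eq (.ld 1 (.v 31)) (.c 1)) (storeP 4 (.ld 1 (.v 31 + .c 1)) (.c 1)) .skip,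
    assign 31 (.v 31 + (.ld 1 (.v 31) + .c 1))])]

theorem tot_flagsP {n : ℕ} {σ : NS} {Cs : List (List ℕ)} (hw : 4 * n + 3 < wsz w)
    (hwl : (codeL Cs).length + 1 < wsz w)
    (h10 : σ.reg 10 = n) (h1 : σ.reg 1 = (codeL Cs).length) (hm : Holds (σ.mem 1) (codeL Cs)) :
    Tot w flagsP ((2 * n + 1) * 60 + ((codeL Cs).length + 1) * 100 + 20) σ fun σ' =>
      Fr 30 4 σ σ' ∧ ∀ l < 2 * n, σ'.mem 4 l = if [l] ∈ Cs then 1 else 0 := by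
  refine blk_tot (tot_zero (N := 2 * n) (by simp) (by omega) (by simp)
    (fun s' hr => ⟨by simp [hr, h10]; omega, by simp [hr, h10]; omega⟩) le_rfl)
    (by simp; ring_nf; omega) ?_
  rintro σ₁ ⟨a1, a2, a3⟩
  have f1 : Fr 30 4 σ σ₁ := ⟨fun i hi => a1 i (by omega), fun A hA => a2 A (by omega)⟩
  refine blk_assign (by simp) ⟨by simp, by simp; omega⟩ (by simp; ring_nf; omega) ?_
  refine blk_tot (tot_walk (Cs := Cs) (Tb := 60) (by simp) (by simp) hwl
    (fun c σ' => Fr 30 4 σ σ' ∧ σ'.reg 31 = (codeL (Cs.take c)).length ∧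
      ∀ l < 2 * n, σ'.mem 4 l = if [l] ∈ Cs.take c then 1 else 0) ?_ ?_ ?_ ?_ ?_ le_rfl)
      (by simp; ring_nf; omega) ?_
  · rintro c σ' v ⟨g1, g2, g3⟩
    exact ⟨g1.setR (by omega), by simpa using g2, by simpa using g3⟩
  · rintro c σ' ⟨g1, -⟩
    rw [g1.reg 1 (by omega), h1]
  · rintro c σ' ⟨-, g2, -⟩
    exact g2
  · rintro c hc σ' ⟨g1, g2, g3⟩
    have e1 : σ'.mem 1 = σ.mem 1 := g1.mem 1 (by omega)
    have hlen : σ'.mem 1 (σ'.reg 31) = Cs[c].length := by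
      rw [e1, g2]; exact hm _ _ (codeL_getElem?_length Cs hc)
    have hle := length_codeL_take_le Cs hc
    have hnext := length_codeL_take_succ Cs hc
    have fin : ∀ σ₂ : NS, Fr 30 4 σ σ₂ → σ₂.reg 30 = σ'.reg 30 → σ₂.reg 31 = σ'.reg 31 →
        (∀ l < 2 * n, σ₂.mem 4 l = if [l] ∈ Cs.take (c + 1) then 1 else 0) →
        Tot w (blk [assign 31 (.v 31 + (.ld 1 (.v 31) + .c 1))]) 25 σ₂ fun s' =>
          s'.reg 30 = σ'.reg 30 ∧ Fr 30 4 σ s' ∧ s'.reg 31 = (codeL (Cs.take (c + 1))).length ∧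
          ∀ l < 2 * n, s'.mem 4 l = if [l] ∈ Cs.take (c + 1) then 1 else 0 := by
      intro σ₂ h1 h2 h3 h4
      have e2 : σ₂.mem 1 (σ₂.reg 31) = Cs[c].length := by
        rw [h3, h1.mem 1 (by omega), ← e1, hlen]
      refine blk_assign (by simp) ⟨by simp, by simp [e2]; omega⟩ (by simp)
        (blk_nil (by simp) (ind_of ⟨by simpa using h2, h1.setR (by omega), ?_, by simpa using h4⟩).ge)
      simp [e2]; omega
    have htake : Cs.take (c + 1) = Cs.take c ++ [Cs[c]] := List.take_succ_eq_append_getElem hc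
    refine blk_cons (T₁ := 30) (by simp) (ewp_ite ⟨by simp, by simp; omega⟩ (by simp) ?_ ?_)
    · intro hv
      have h : Cs[c].length = 1 := by
        by_contra h
        simp [hlen, h] at hv
      obtain ⟨x, hx⟩ := List.length_eq_one_iff.1 h
      have hlit : σ'.mem 1 (σ'.reg 31 + 1) = x := by
        rw [e1, g2]
        have := hm _ _ (codeL_getElem?_lit Cs hc (t := 0) (by omega))
        simpa [hx] using this
      refine le_trans ?_ ((ewp_store ⟨by simp, by simp; omega⟩ ⟨by simp, by simp; omega⟩).trans
        (ewp_mono (by simp) fun _ => le_rfl))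
      refine (fin _ (g1.setM (by omega)) rfl rfl fun l hl => ?_).trans
        (ewp_mono (by simp) fun _ => le_rfl)
      rw [htake, hx]
      by_cases hlx : l = x
      · simp [hlit, hlx]
      · simp [hlit, hlx, g3 l hl]
    · intro hv
      have h : Cs[c].length ≠ 1 := by
        intro h
        simp [hlen, h] at hv
      refine blk_nil (by simp) ((fin _ g1 rfl rfl fun l hl => ?_).trans
        (ewp_mono (by simp) fun _ => le_rfl))
      have hne : [l] ≠ Cs[c] := fun he => h (by rw [← he]; rfl)
      rw [htake, g3 l hl]
      simp only [List.mem_append, List.mem_singleton, hne, or_false]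
  · exact ⟨f1.setR (by omega), by simp [codeL], by simpa using fun l hl => a3 l hl⟩
  · rintro σ' ⟨g1, -, g3⟩
    rw [List.take_length] at g3
    exact blk_nil (by simp; ring_nf; omega) (ind_of ⟨g1, g3⟩).ge

/-- The number of trials per level. -/
def trialCount (a D n g : ℕ) : ℕ :=
  if n < g then 1 else (n + 1) * 2 ^ (n * a / D + 1 + (g + g) + 6)

/-- The number of steps per level. -/
def stepCount (a D n g : ℕ) : ℕ :=
  if n < g then (n + n + 3) * 2 ^ n else (4 * n + 3) * trialCount a D n g

/-- Compute the parameters. -/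
def paramsP (a D : ℕ) : Prog := blk [
  assign 12 ((.v 3 - .v 2) + .c 2),
  iteP (.bin .lt (.v 10) (.v 12))
    (blk [assign 14 (.c 1), assign 15 (.bin .shl (.v 10 + .v 10 + .c 3) (.v 10))])
    (blk [assign 14 (.bin .shl (.v 10 + .c 1) (.v 10 * .c a / .c D + .c 1 + (.v 12 + .v 12) + .c 6)),
      assign 15 ((.c 4 * .v 10 + .c 3) * .v 14)]),
  assign 16 (.c 200 * (.v 10 + .c 1)),
  assign 17 (.c 0)]

theorem tot_paramsP {a D n p q : ℕ} {σ : NS} (hpq : p ≤ q) (h10 : σ.reg 10 = n) (h2 : σ.reg 2 = p)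
    (h3 : σ.reg 3 = q) (hwq : q + 2 < wsz w) (hwD : D < wsz w) (hwa : a < wsz w)
    (hwna : n * a < wsz w) (hw : 3 * stepCount a D n (q - p + 2) < wsz w)
    (hwn : 400 * (n + 1) < wsz w) (he : n * a / D + 1 + (n + n) + 6 < wsz w) :
    Tot w (paramsP a D) 150 σ fun σ' => (∀ i < 12, σ'.reg i = σ.reg i) ∧ σ'.reg 13 = σ.reg 13 ∧
      σ'.mem = σ.mem ∧ σ'.reg 14 = trialCount a D n (q - p + 2) ∧
      σ'.reg 15 = stepCount a D n (q - p + 2) ∧ σ'.reg 16 = 200 * (n + 1) ∧ σ'.reg 17 = 0 := by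
  refine blk_assign (by simp) ⟨by simp, by simp [h2, h3]; omega⟩ (by simp) ?_
  set σ₁ := σ.setR 12 (Ex.val σ (.v 3 - .v 2 + .c 2)) with hσ₁
  have e12 : σ₁.reg 12 = q - p + 2 := by simp [hσ₁, h2, h3]
  set g := q - p + 2 with hg
  have e10 : σ₁.reg 10 = n := by simp [hσ₁, h10]
  have fin : ∀ σ₂ : NS, (∀ i < 12, σ₂.reg i = σ.reg i) → σ₂.reg 13 = σ.reg 13 → σ₂.mem = σ.mem →
      σ₂.reg 14 = trialCount a D n g → σ₂.reg 15 = stepCount a D n g →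
      Tot w (blk [assign 16 (.c 200 * (.v 10 + .c 1)), assign 17 (.c 0)]) 30 σ₂ fun σ' =>
        (∀ i < 12, σ'.reg i = σ.reg i) ∧ σ'.reg 13 = σ.reg 13 ∧
        σ'.mem = σ.mem ∧ σ'.reg 14 = trialCount a D n g ∧
        σ'.reg 15 = stepCount a D n g ∧ σ'.reg 16 = 200 * (n + 1) ∧ σ'.reg 17 = 0 := by
    intro σ₂ k1 k2 k3 k4 k5
    have e : σ₂.reg 10 = n := by rw [k1 10 (by omega), h10]
    refine blk_assign (by simp) ⟨by simp, by simp [e]; omega⟩ (by simp) ?_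
    refine blk_assign (by simp) ⟨by simp, by simp; omega⟩ (by simp) (blk_nil (by simp) (ind_of
      ⟨fun i hi => ?_, by simpa using k2, by simpa using k3, by simpa using k4, by simpa using k5,
        by simp [e], by simp⟩).ge)
    simp [k1 i hi, show i ≠ 17 by omega, show i ≠ 16 by omega]
  refine blk_cons (T₁ := 100) (by simp) (ewp_ite ⟨by simp, by simp; omega⟩ (by simp) ?_ ?_)
  · intro hv
    have hlt : n < g := by
      by_contra h
      simp [e10, e12, h] at hv
    have h1 : stepCount a D n g = (n + n + 3) * 2 ^ n := if_pos hlt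
    rw [h1] at hw
    refine blk_assign (by simp) ⟨by simp, by simp; omega⟩ (by simp) ?_
    refine blk_assign (by simp) ⟨by simp, by simp [e10]; omega⟩ (by simp) (blk_nil (by simp) ?_)
    refine Tot.mono (T := 30) (fin _ (fun i hi => ?_) ?_ rfl ?_ ?_) (by simp) fun _ h => h
    · simp [hσ₁, show i ≠ 15 by omega, show i ≠ 14 by omega, show i ≠ 12 by omega]
    · simp [hσ₁]
    · simp [trialCount, hlt]
    · simp [h1, e10]
  · intro hv
    have hlt : ¬ n < g := by
      intro h
      simp [e10, e12, h] at hv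
    have h1 : stepCount a D n g = (4 * n + 3) * trialCount a D n g := if_neg hlt
    have h2 : trialCount a D n g = (n + 1) * 2 ^ (n * a / D + 1 + (g + g) + 6) := if_neg hlt
    rw [h1] at hw
    have hL : trialCount a D n g ≤ (4 * n + 3) * trialCount a D n g :=
      Nat.le_mul_of_pos_left _ (by omega)
    refine blk_assign (by simp) ⟨by simp, ?_⟩ (by simp) ?_
    · simp [e10, e12, ← h2]; omega
    refine blk_assign (by simp) ⟨by simp, ?_⟩ (by simp) (blk_nil (by simp) ?_)
    · simp [e10, e12, ← h2]; omega
    refine Tot.mono (T := 30) (fin _ (fun i hi => ?_) ?_ rfl ?_ ?_) (by simp) fun _ h => h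
    · simp [hσ₁, show i ≠ 15 by omega, show i ≠ 14 by omega, show i ≠ 12 by omega]
    · simp [hσ₁]
    · simp [h2, e10, e12]
    · simp [h1, e10, e12, h2]

end WordRAM

namespace WordRAM

variable {w : ℕ}

/-! ### The approximation scheme -/

/-- The approximation scheme with the algorithm `O` for the decision problem as a subroutine. -/
def schemeP (O : Prog) (s a D : ℕ) : Prog := blk [assign 10 (.ld 0 (.c 0)), lenP, flagsP,
  paramsP a D, outerP O s, assign 0 (.v 18), assign 1 (.v 14)]

/-- The time bound for `schemeP`. -/
def schemeT (len s n B T₀ : ℕ) : ℕ :=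
  (2 * n + 1) * 120 + (len + 1) * 100 + 300 + outerT len (4 * n) s n B (200 * (n + 1)) T₀

theorem outerT_mono {len l l' s n B r T₀ : ℕ} (h : l ≤ l') :
    outerT len l s n B r T₀ ≤ outerT len l' s n B r T₀ := by
  unfold outerT levelT sampleT
  gcongr

theorem trialCount_le (a D n g : ℕ) : trialCount a D n g ≤ stepCount a D n g := by
  unfold stepCount trialCount
  split_ifs
  · exact Nat.mul_pos (by omega) (by positivity)
  · exact Nat.le_mul_of_pos_left _ (by omega)

/-- Everything is exponential in `n` with an absolute constant, whatever `ε` is, because the number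
of trials depends on the gap `g` only when `g ≤ n`. This lets the number of votes and the word
length be chosen without reference to `ε`. -/
theorem stepCount_mul_le {a D n g : ℕ} (ha : a ≤ D) :
    stepCount a D n g * 2 ^ n ≤ 2 ^ (6 * n + 9) := by
  have hn : n + 1 ≤ 2 ^ n := Nat.lt_two_pow_self
  unfold stepCount trialCount
  split_ifs with h
  · calc (n + n + 3) * 2 ^ n * 2 ^ n ≤ (4 * 2 ^ n) * 2 ^ n * 2 ^ n := by gcongr; omega
      _ = 2 ^ (3 * n + 2) := by ring
      _ ≤ 2 ^ (6 * n + 9) := Nat.pow_le_pow_right (by omega) (by omega)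
  · have he : n * a / D + 1 + (g + g) + 6 ≤ 3 * n + 7 := by
      have : n * a / D ≤ n := Nat.div_le_of_le_mul (by rw [mul_comm]; exact Nat.mul_le_mul_right _ ha)
      omega
    calc (4 * n + 3) * ((n + 1) * 2 ^ (n * a / D + 1 + (g + g) + 6)) * 2 ^ n ≤
          (4 * 2 ^ n) * (2 ^ n * 2 ^ (3 * n + 7)) * 2 ^ n := by
          gcongr
          · omega
          · omega
      _ = 2 ^ (6 * n + 9) := by ring

/-- Since `(17 / 18) ^ 200 ≤ 2 ^ (-16)`, `200 (n + 1)` votes beat the bound `2 ^ (6 n + 9)` for the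
number of steps at all levels. -/
theorem stepCount_mul_succ_le {a D n g : ℕ} (ha : a ≤ D) :
    (stepCount a D n g : ℝ) * (n + 1) * (17 / 18) ^ (200 * (n + 1)) ≤ 1 / 10 := by
  have h1 : (stepCount a D n g : ℝ) * (n + 1) ≤ 2 ^ (6 * n + 9) := by
    have h := stepCount_mul_le (a := a) (D := D) (n := n) (g := g) ha
    have hn : n + 1 ≤ 2 ^ n := Nat.lt_two_pow_self
    have := (Nat.mul_le_mul_left (stepCount a D n g) hn).trans h
    exact_mod_cast this
  have h2 : ((17 : ℝ) / 18) ^ (200 * (n + 1)) ≤ (1 / 2) ^ (16 * (n + 1)) := by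
    rw [pow_mul, pow_mul]
    exact pow_le_pow_left₀ (by positivity) (by norm_num) _
  calc (stepCount a D n g : ℝ) * (n + 1) * (17 / 18) ^ (200 * (n + 1)) ≤
        2 ^ (6 * n + 9) * (1 / 2) ^ (16 * (n + 1)) := by gcongr
    _ ≤ 2 ^ (16 * n + 9) * (1 / 2) ^ (16 * (n + 1)) := by
        gcongr
        · norm_num
        · omega
    _ = 1 / 2 ^ 7 := by
        rw [one_div, inv_pow, show 16 * (n + 1) = 16 * n + 9 + 7 by ring, pow_add]
        field_simp
        rw [← pow_add]
    _ ≤ 1 / 10 := by norm_num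

section
variable {k n s a D p q Y T₀ : ℕ} {O : Prog} {F : KCNF k n} {σ : NS}

/-- The requirements on the initial state. -/
structure StartOk (w : ℕ) (O : Prog) (F : KCNF k n) (s a D p q Y T₀ : ℕ) (σ : NS) : Prop where
  hk : 1 ≤ k
  m0 : σ.mem 0 0 = n
  r1 : σ.reg 1 = (codeL F.codes).length
  m1 : Holds (σ.mem 1) (codeL F.codes)
  r2 : σ.reg 2 = p
  r3 : σ.reg 3 = q
  pq : p ≤ q
  aD : a ≤ D
  lenY : (codeL F.codes).length + 1 ≤ Y
  qY : q ≤ Y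
  hW : 2 ^ (6 * n + 12) * (D + s + 1) * Y ≤ wsz w
  orc : ∀ (m : ℕ) (hm : m ≤ n) (l : ℕ) (h : Fin m → RowKey l s) (j p : ℕ),
    OracleOk w O T₀ (F.query hk hm h j p)

/-- What holds before the main loop. -/
structure Ready (w : ℕ) (O : Prog) (F : KCNF k n) (s a D g T₀ : ℕ) (l : ℕ) (σ : NS) : Prop where
  r10 : σ.reg 10 = n
  r14 : σ.reg 14 = trialCount a D n g
  r17 : σ.reg 17 = 0
  hl : 2 * n ≤ 2 ^ l
  hl' : l = 0 ∨ 2 ^ l ≤ 4 * n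
  wn : n + 2 < wsz w
  wB : stepCount a D n g * 2 ^ n < wsz w
  level : ∀ m ≤ n, ∀ σ', Fr 17 20 σ σ' → σ'.reg 19 = m →
    LevelOk w O F l s m (trialCount a D n g) (stepCount a D n g) (200 * (n + 1)) T₀ σ'

theorem schemeP_pre (hS : StartOk w O F s a D p q Y T₀ σ) {T : ℕ} {f : NS → ℝ≥0∞} {x : ℝ≥0∞}
    (h : ∀ l σ', Ready w O F s a D (q - p + 2) T₀ l σ' →
      x ≤ ewp w (blk [outerP O s, assign 0 (.v 18), assign 1 (.v 14)]) T f σ') :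
    x ≤ ewp w (schemeP O s a D)
      ((2 * n + 1) * 120 + ((codeL F.codes).length + 1) * 100 + 280 + T) f σ := by
  set len := (codeL F.codes).length
  set g := q - p + 2 with hg
  have hlenY := hS.lenY
  have hqY := hS.qY
  have hW := hS.hW
  have hE : n + 1 ≤ 2 ^ n := Nat.lt_two_pow_self
  have hE6 : 2 ^ n * 2 ^ n ≤ 2 ^ (6 * n) := by
    rw [← pow_add]; exact Nat.pow_le_pow_right (by omega) (by omega)
  have hEE : 2 ^ n ≤ 2 ^ n * 2 ^ n := Nat.le_mul_of_pos_left _ (by omega)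
  have hnn : n * n + n ≤ 2 ^ n * 2 ^ n := by
    have : (n + 1) * n ≤ 2 ^ n * 2 ^ n := Nat.mul_le_mul hE (by omega)
    linarith
  have hP : 2 ^ (6 * n + 12) = 4096 * 2 ^ (6 * n) := by rw [pow_add]; norm_num; ring
  have hP9 : 2 ^ (6 * n + 9) = 512 * 2 ^ (6 * n) := by rw [pow_add]; norm_num; ring
  set P6 := 2 ^ (6 * n) with hP6
  rw [hP] at hW
  have aux : ∀ P d Y W : ℕ, 1 ≤ P → 1 ≤ Y → P * (d + 1) * Y ≤ W →
      P + Y ≤ W + 1 ∧ P * (d + 1) ≤ W := by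
    intro P d Y W hP hY h
    have h1 : P * (d + 1) ≤ P * (d + 1) * Y := Nat.le_mul_of_pos_right _ hY
    have h2 : P * Y ≤ P * (d + 1) * Y := Nat.mul_le_mul_right _ (Nat.le_mul_of_pos_right _ (by omega))
    have h3 : P + Y ≤ P * Y + 1 := by nlinarith
    omega
  obtain ⟨hW1, hW2⟩ := aux _ _ _ _ (by omega) (by omega) hW
  have hW3 : 4096 * P6 ≤ wsz w := by nlinarith
  have hW4 : P6 * (D + s + 1) ≤ wsz w := by nlinarith
  have hDs : D + s + 1 < wsz w := by nlinarith
  have hna : n * a < wsz w := by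
    have h1 : n * a ≤ P6 * D := Nat.mul_le_mul (by omega) hS.aD
    have h2 : P6 * D < P6 * (D + s + 1) := by nlinarith
    omega
  have hstep := stepCount_mul_le (n := n) (g := g) hS.aD
  have hstep1 : stepCount a D n g ≤ stepCount a D n g * 2 ^ n := Nat.le_mul_of_pos_right _ (by omega)
  have htrial := trialCount_le a D n g
  rw [hP9] at hstep
  have hdiv : n * a / D ≤ n := Nat.div_le_of_le_mul (by rw [mul_comm]; exact Nat.mul_le_mul_right _ hS.aD)
  have haD := hS.aD
  have hw0 : w ≠ 0 := by
    rintro rfl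
    rw [wsz, pow_zero] at hW3
    omega
  generalize hB : stepCount a D n g = B at *
  generalize hL : trialCount a D n g = L at *
  refine blk_assign (by simp) ⟨by simp, by simp; omega⟩ (by simp; ring_nf; omega) ?_
  have f₀ : Fr 10 100 σ (σ.setR 10 (Ex.val σ (.ld 0 (.c 0)))) := (Fr.refl _ _ _).setR le_rfl
  have e10 : (σ.setR 10 (Ex.val σ (.ld 0 (.c 0)))).reg 10 = n := by simp [hS.m0]
  generalize σ.setR 10 (Ex.val σ (.ld 0 (.c 0))) = σ₀ at f₀ e10
  refine blk_tot (tot_lenP (n := n) (by omega) e10) (by simp; ring_nf; omega) ?_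
  rintro σ₁ ⟨f₁, hl, hl'⟩
  have f01 := f₀.trans (f₁.mono (by omega) le_rfl)
  have e10' : σ₁.reg 10 = n := by rw [f₁.reg 10 (by omega), e10]
  refine blk_tot (tot_flagsP (Cs := F.codes) (n := n) (by omega) (by omega) e10'
    (by rw [f01.reg 1 (by omega), hS.r1]) (by rw [f01.mem 1 (by omega)]; exact hS.m1))
    (by simp; ring_nf; omega) ?_
  rintro σ₂ ⟨f₂, h4⟩
  have f02 := (f01.mono le_rfl (by omega)).trans (f₂.mono (by omega) le_rfl)
  have e10'' : σ₂.reg 10 = n := by rw [f₂.reg 10 (by omega), e10']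
  refine blk_tot (tot_paramsP (a := a) (D := D) (n := n) hS.pq e10''
    (by rw [f02.reg 2 (by omega), hS.r2]) (by rw [f02.reg 3 (by omega), hS.r3]) (by omega) (by omega)
    (by omega) hna (by rw [hB]; omega) (by omega) (by omega)) (by simp; ring_nf; omega) ?_
  rintro σ₃ ⟨g1, g2, g3, g4, g5, g6, g7⟩
  rw [hB] at g5
  rw [hL] at g4
  refine (h (σ₁.reg 13) σ₃ ?_).trans (ewp_mono (by simp; ring_nf; omega) fun _ => le_rfl)
  have hl2 : 2 ^ σ₁.reg 13 ≤ 4 * n + 1 := by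
    rcases hl' with h | h
    · rw [h]; omega
    · omega
  refine ⟨by rw [g1 10 (by omega), e10''], by rw [g4, hL], g7, hl, hl', by omega,
    by rw [hB]; omega, fun m hm σ' hf h19 => ?_⟩
  rw [hB, hL]
  have hmn : m * n ≤ n * n := Nat.mul_le_mul_right _ hm
  refine ⟨hS.hk, hm, ⟨?_, ?_, ?_, ?_⟩, ?_, by rw [hf.reg 14 (by omega), g4],
    by rw [hf.reg 15 (by omega), g5], by rw [hf.reg 16 (by omega), g6], h19, hw0, by omega, by omega,
    by omega, by omega, by omega, by omega, by omega, by omega, hS.orc m hm _⟩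
  · rw [hf.reg 1 (by omega), g1 1 (by omega), f02.reg 1 (by omega), hS.r1]
  · rw [hf.mem 1 (by omega), g3, f02.mem 1 (by omega)]; exact hS.m1
  · rw [hf.mem 4 (by omega), g3]; exact h4
  · rw [hf.reg 10 (by omega), g1 10 (by omega), e10'']
  · rw [hf.reg 13 (by omega), g2, f₂.reg 13 (by omega)]

theorem schemeP_post {T : ℕ} (hT : 10 ≤ T) {f : NS → ℝ≥0∞} {x : ℝ≥0∞}
    (h : x ≤ f ((σ.setR 0 (σ.reg 18)).setR 1 (σ.reg 14))) :
    x ≤ ewp w (blk [assign 0 (.v 18), assign 1 (.v 14)]) T f σ := by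
  refine blk_assign (by simp) ⟨by simp, by simp⟩ (by simp; omega) ?_
  refine blk_assign (by simp) ⟨by simp, by simp⟩ (by simp; omega) (blk_nil (by simp; omega) ?_)
  simpa using h

theorem l_le {l n : ℕ} (hl' : l = 0 ∨ 2 ^ l ≤ 4 * n) : l ≤ 4 * n := by
  rcases hl' with h | h
  · omega
  · exact Nat.lt_two_pow_self.le.trans h

theorem tot_schemeP (hS : StartOk w O F s a D p q Y T₀ σ) :
    Tot w (schemeP O s a D)
      (schemeT (codeL F.codes).length s n (stepCount a D n (q - p + 2)) T₀) σ fun _ => True := by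
  unfold schemeT
  refine (schemeP_pre hS (T := outerT (codeL F.codes).length (4 * n) s n
    (stepCount a D n (q - p + 2)) (200 * (n + 1)) T₀ + 20) fun l σ' hR => ?_).trans
    (ewp_mono (by omega) fun _ => le_rfl)
  have hmono := outerT_mono (len := (codeL F.codes).length) (s := s) (n := n)
    (B := stepCount a D n (q - p + 2)) (r := 200 * (n + 1)) (T₀ := T₀) (l_le hR.hl')
  refine blk_tot (tot_outerP hR.wn hR.wB hR.r10 hR.level) (by omega) fun σ'' _ => ?_
  exact schemeP_post (by omega) (ind_of trivial).ge

theorem ewp_schemeP {δ ε : ℝ} (hδ0 : 0 < δ) (hδ1 : δ < 1) (hε0 : 0 < ε) (hε1 : ε < 1)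
    (hs : 120 * Real.logb 2 (6 / δ) ^ 2 / δ ≤ (s : ℝ)) (hS : StartOk w O F s a D p q Y T₀ σ)
    (hL : ¬ n < q - p + 2 → 60 * ((n : ℝ) + 1) * 2 ^ (δ * n / 2) ≤
      ε ^ 2 * trialCount a D n (q - p + 2)) :
    2 / 3 ≤ ewp w (schemeP O s a D)
      (schemeT (codeL F.codes).length s n (stepCount a D n (q - p + 2)) T₀)
      (ind fun σ' => F.IsGood ε (trialCount a D n (q - p + 2)) (σ'.reg 0) ∧
        σ'.reg 1 = trialCount a D n (q - p + 2)) σ := by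
  unfold schemeT
  refine (schemeP_pre hS (T := outerT (codeL F.codes).length (4 * n) s n
    (stepCount a D n (q - p + 2)) (200 * (n + 1)) T₀ + 20) fun l σ' hR => ?_).trans
    (ewp_mono (by omega) fun _ => le_rfl)
  have hmono := outerT_mono (len := (codeL F.codes).length) (s := s) (n := n)
    (B := stepCount a D n (q - p + 2)) (r := 200 * (n + 1)) (T₀ := T₀) (l_le hR.hl')
  have hPar : KCNF.ParamsOk δ ε n l (trialCount a D n (q - p + 2)) (stepCount a D n (q - p + 2))
      (200 * (n + 1)) := by
    refine ⟨stepCount_mul_succ_le hS.aD, ?_⟩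
    by_cases h : n < q - p + 2
    · left
      simp only [trialCount, stepCount, if_pos h, true_and]
      ring
    · right
      have hl := hR.hl
      refine ⟨hl, ?_, ?_, ?_, hL h⟩
      · rcases hR.hl' with h0 | h0
        · rw [h0, pow_zero] at hl ⊢
          -- Here `n ≥ 2`, so `l = 0` contradicts `2 * n ≤ 2 ^ l`.
          omega
        · exact h0
      · rw [trialCount, if_neg h]; positivity
      · rw [stepCount, if_neg h]
  obtain ⟨M, hM, A, y, hA1, hAG, hAB, hy, hp⟩ :=
    F.exists_levels (l := l) hδ0 hδ1 hε0 hε1 hs hPar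
  have ho := ewp_outerP hR.wn hR.wB hR.r10 hR.r17 hR.level
    (F.IsGood ε (trialCount a D n (q - p + 2))) A hM hA1 hAG hAB hy
  have h23 : (2 / 3 : ℝ≥0∞) ≤ ((y ^ (M + 1) : ℝ≥0) : ℝ≥0∞) := by
    have : ((2 / 3 : ℝ≥0) : ℝ≥0∞) = 2 / 3 := by rw [ENNReal.coe_div (by norm_num)]; rfl
    rw [← this]
    exact_mod_cast hp
  have := blk_prob (x := 1) (T := outerT (codeL F.codes).length (4 * n) s n
    (stepCount a D n (q - p + 2)) (200 * (n + 1)) T₀ + 20) (ps := [assign 0 (.v 18), assign 1 (.v 14)])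
    (f := ind fun σ' => F.IsGood ε (trialCount a D n (q - p + 2)) (σ'.reg 0) ∧
        σ'.reg 1 = trialCount a D n (q - p + 2)) (h23.trans ho) (by omega) ?_
  · rwa [one_mul] at this
  · rintro σ'' ⟨h1, h2⟩
    refine schemeP_post (by omega) (ind_of ⟨?_, ?_⟩).ge
    · simpa using h2
    · simpa using (h1.reg 14 (by omega)).trans hR.r14

end

end WordRAM

/-! ### Estimates of sizes, tolerances and running time -/

/-- A polynomial bound for the size of an instance. -/
theorem SparseInstance.size_encode_le {k s : ℕ} (I : SparseInstance k s) :
    I.encode.size ≤ ((k + 1) * 2 ^ k * (k + 2) + 5) * (I.n + 1) ^ (k + 2) := by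
  have hN : 1 ≤ (I.n + 1) ^ k := Nat.one_le_pow _ _ (by omega)
  have hm := I.m_le
  have h1 := WordRAM.lsize_le I.F.length_code_le' I.F.le_of_mem_code
  have h2 := WordRAM.lsize_le (le_refl (I.matCode.length)) I.matCode_le
  have h3 := WordRAM.lsize_le (le_refl (I.rhsCode.length)) I.rhsCode_le
  rw [I.length_matCode] at h2
  rw [I.length_rhsCode] at h3
  have h2' : I.m * I.n ≤ I.n * I.n := Nat.mul_le_mul_right _ hm
  rw [WordRAM.size_eq, I.encode_eq]
  simp only [List.map_cons, List.map_nil, List.sum_cons, List.sum_nil, WordRAM.lsize_singleton]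
  rw [pow_add]
  generalize (I.n + 1) ^ k = M at *
  have h4 : (k + 1) * 2 ^ k * M * (2 * I.n + k + 1) ≤
      (k + 1) * 2 ^ k * (k + 2) * (M * (I.n + 1) ^ 2) :=
    calc (k + 1) * 2 ^ k * M * (2 * I.n + k + 1) ≤
          (k + 1) * 2 ^ k * M * ((k + 2) * (I.n + 1) ^ 2) := by gcongr; nlinarith [Nat.zero_le (k * I.n)]
      _ = _ := by ring
  have h5 : (I.n + 1) ^ 2 ≤ M * (I.n + 1) ^ 2 := Nat.le_mul_of_pos_left _ hN
  nlinarith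

namespace WordRAM

theorem schemeT_le {c k : ℕ} (s : ℕ) : ∃ K e : ℕ, ∀ len n B T₀ : ℕ, len ≤ c * (n + 1) ^ k →
    schemeT len s n B T₀ ≤ K * (n + 1) ^ e * (B + 1) * (T₀ + 1) := by
  refine ⟨1000000 * (c + 1) * (s + 1), k + 4, fun len n B T₀ hlen => ?_⟩
  have hlen' : len + 1 ≤ (c + 1) * (n + 1) ^ k := by
    have : 1 ≤ (n + 1) ^ k := Nat.one_le_pow _ _ (by omega)
    nlinarith
  have hM1 : 1 ≤ (c + 1) * (n + 1) ^ k := Nat.mul_pos (by omega) (by positivity)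
  have aux : ∀ M N S T b, 1 ≤ M → 1 ≤ N → 1 ≤ S → 1 ≤ T → 1 ≤ b →
      2 * N * 120 + M * 100 + 300 + (N + 1) * (b * (N ^ 2 * 60 + N * (S * (N * 340) + 100) + 10 +
        (201 * N * (M * 60 + 2 * N * 160 + N ^ 2 * 60 + N * 60 + 250 + T) + 10) + 250) + 50 + 80) ≤
      1000000 * (M * N ^ 4 * S * T * b) := by
    intro M N S T b hM hN hS hT hb
    -- Writing each variable as a successor and expanding, the inequality holds coefficient by
    -- coefficient.
    obtain ⟨M, rfl⟩ := Nat.exists_eq_add_of_le' hM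
    obtain ⟨N, rfl⟩ := Nat.exists_eq_add_of_le' hN
    obtain ⟨S, rfl⟩ := Nat.exists_eq_add_of_le' hS
    obtain ⟨T, rfl⟩ := Nat.exists_eq_add_of_le' hT
    obtain ⟨b, rfl⟩ := Nat.exists_eq_add_of_le' hb
    ring_nf
    omega
  refine le_trans ?_ ((aux _ (n + 1) (s + 1) (T₀ + 1) (B + 1) hM1 (by omega) (by omega) (by omega)
    (by omega)).trans (le_of_eq (by ring)))
  unfold schemeT outerT levelT sampleT queryT buildT
  have h2 : n * n + 1 ≤ (n + 1) ^ 2 := by nlinarith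
  gcongr ?_ * 120 + ?_ * 100 + 300 + ?_ * (_ * (?_ * 60 + _ * (_ * ?_ + 100) + 10 + (?_ * ?_ + 10) + 250) + 50 + 80)
  all_goals omega

/-- Polynomials grow more slowly than exponential functions. -/
theorem exists_pow_le (e : ℕ) {γ : ℝ} (hγ : 0 < γ) :
    ∃ K : ℝ, 0 < K ∧ ∀ n : ℕ, ((n : ℝ) + 1) ^ e ≤ K * 2 ^ (γ * n) := by
  set t := γ * Real.log 2 / (e + 1)
  have hl : 0 < Real.log 2 := Real.log_pos (by norm_num)
  have ht : 0 < t := by positivity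
  refine ⟨(1 / t + 1) ^ e, by positivity, fun n => ?_⟩
  have h1 : (n : ℝ) + 1 ≤ (1 / t + 1) * Real.exp (t * n) := by
    have h := Real.add_one_le_exp (t * n)
    have h0 : (0 : ℝ) ≤ n := n.cast_nonneg
    calc (n : ℝ) + 1 ≤ n + 1 + (1 / t + t * n) := by
          have : 0 ≤ 1 / t + t * n := by positivity
          linarith
      _ = (1 / t + 1) * (t * n + 1) := by field_simp; ring
      _ ≤ _ := by gcongr
  calc ((n : ℝ) + 1) ^ e ≤ ((1 / t + 1) * Real.exp (t * n)) ^ e := by gcongr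
    _ = (1 / t + 1) ^ e * Real.exp (e * (t * n)) := by rw [mul_pow, ← Real.exp_nat_mul]
    _ ≤ (1 / t + 1) ^ e * 2 ^ (γ * n) := by
        rw [Real.rpow_def_of_pos (by norm_num)]
        refine mul_le_mul_of_nonneg_left (Real.exp_le_exp.2 ?_) (by positivity)
        have : γ * Real.log 2 = t * (e + 1) := by simp only [t]; field_simp
        have h0 : 0 ≤ t * n := by positivity
        nlinarith

/-- A binary length determines a number up to a factor `2`, so the two lengths determine `ε` up to a
factor `4`. Only the lengths are used, never the digits, and no division is needed. -/
theorem WithTolerance.bounds {ι : Type} (x : WithTolerance ι) {p q : ℕ}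
    (hp : p = (Nat.digits 2 x.ε.num.toNat).length) (hq : q = (Nat.digits 2 x.ε.den).length) :
    p ≤ q ∧ 2 ≤ (x.ε : ℝ) * 2 ^ (q - p + 2) ∧ (x.ε : ℝ) * 2 ^ (q - p + 2) ≤ 8 := by
  have hnum : 0 < x.ε.num := Rat.num_pos.2 x.pos
  have hden := x.ε.den_pos
  obtain ⟨N, hN⟩ : ∃ N : ℕ, x.ε.num = N := ⟨x.ε.num.toNat, by omega⟩
  generalize hdd : x.ε.den = d at *
  rw [hN] at hp hnum
  have hN0 : 0 < N := by omega
  rw [Int.toNat_natCast] at hp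
  have hε : (x.ε : ℝ) * d = N := by
    have := Rat.mul_den_eq_num x.ε
    rw [hdd, hN] at this
    exact_mod_cast this
  have hlt : N < d := by
    have h1 : (x.ε : ℝ) < 1 := by exact_mod_cast x.lt_one
    have h2 : (0 : ℝ) < d := by exact_mod_cast hden
    have : (N : ℝ) < d := by nlinarith
    exact_mod_cast this
  have a1 : N < 2 ^ p := by rw [hp]; exact Nat.lt_base_pow_length_digits (by norm_num)
  have a2 : 2 ^ p ≤ 2 * N := by rw [hp]; exact Nat.base_pow_length_digits_le 2 N (by norm_num) (by omega)
  have b1 : d < 2 ^ q := by rw [hq]; exact Nat.lt_base_pow_length_digits (by norm_num)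
  have b2 : 2 ^ q ≤ 2 * d := by rw [hq]; exact Nat.base_pow_length_digits_le 2 d (by norm_num) (by omega)
  have hpq : p ≤ q := by
    by_contra h
    have h1 : 2 ^ (q + 1) ≤ 2 ^ p := Nat.pow_le_pow_right (by norm_num) (by omega)
    rw [pow_succ] at h1
    omega
  obtain ⟨g, rfl⟩ := Nat.exists_eq_add_of_le hpq
  rw [Nat.add_sub_cancel_left]
  rw [pow_add] at b1 b2
  have a1' : (N : ℝ) ≤ 2 ^ p := by exact_mod_cast a1.le
  have a2' : (2 : ℝ) ^ p ≤ 2 * N := by exact_mod_cast a2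
  have b1' : (d : ℝ) ≤ 2 ^ p * 2 ^ g := by exact_mod_cast b1.le
  have b2' : (2 : ℝ) ^ p * 2 ^ g ≤ 2 * d := by exact_mod_cast b2
  have hd : (0 : ℝ) < d := by exact_mod_cast hden
  have hG : (0 : ℝ) < 2 ^ g := by positivity
  have hP : (0 : ℝ) < 2 ^ p := by positivity
  refine ⟨hpq, ?_, ?_⟩
  · refine le_of_mul_le_mul_right ?_ hd
    have : (x.ε : ℝ) * 2 ^ (g + 2) * d = 4 * (N * 2 ^ g) := by rw [← hε]; ring
    rw [this]
    nlinarith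
  · refine le_of_mul_le_mul_right ?_ hd
    have : (x.ε : ℝ) * 2 ^ (g + 2) * d = 4 * (N * 2 ^ g) := by rw [← hε]; ring
    rw [this]
    nlinarith

/-- The shift by `2 g` supplies `1 / ε ^ 2` since `(ε * 2 ^ g) ^ 2 ≥ 4`, the shift by `6` supplies
`64`, and `n * a / D + 1` rounds `δ n / 2` upwards. -/
theorem le_trialCount {a D n g : ℕ} {δ ε : ℝ} (hD : 0 < D) (ha : δ / 2 ≤ (a : ℝ) / D)
    (hg : 2 ≤ ε * 2 ^ g) (h : ¬ n < g) :
    60 * ((n : ℝ) + 1) * 2 ^ (δ * n / 2) ≤ ε ^ 2 * trialCount a D n g := by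
  have hD' : (0 : ℝ) < D := by exact_mod_cast hD
  have h1 : (2 : ℝ) ^ (δ * n / 2) ≤ 2 ^ (n * a / D + 1) := by
    rw [← Real.rpow_natCast]
    refine Real.rpow_le_rpow_of_exponent_le (by norm_num) ?_
    have h2 : ((n * a : ℕ) : ℝ) / D < ((n * a / D + 1 : ℕ) : ℝ) := by
      rw [div_lt_iff₀ hD']
      exact_mod_cast Nat.lt_mul_of_div_lt (Nat.lt_succ_self _) hD
    have h3 : n * (δ / 2) ≤ ((n * a : ℕ) : ℝ) / D := by
      rw [Nat.cast_mul, mul_div_assoc]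
      gcongr
    linarith
  rw [trialCount, if_neg h]
  push_cast
  rw [pow_add, pow_add 2 (n * a / D + 1), pow_add 2 g g]
  have h4 : (4 : ℝ) ≤ (ε * 2 ^ g) ^ 2 := by nlinarith
  calc 60 * ((n : ℝ) + 1) * 2 ^ (δ * n / 2) ≤
        64 * 4 * ((n : ℝ) + 1) * 2 ^ (n * a / D + 1) := by gcongr; norm_num
    _ ≤ 64 * (ε * 2 ^ g) ^ 2 * ((n : ℝ) + 1) * 2 ^ (n * a / D + 1) := by gcongr
    _ = _ := by ring

/-- If `n < g` then `2 ^ n ≤ 2 ^ g ≤ 8 / ε`, so exact counting is within the budget of order `1 / ε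
^ 2`; otherwise `(ε * 2 ^ g) ^ 2 ≤ 64` bounds the shift. -/
theorem stepCount_add_one_le {a D n g : ℕ} {δ ε : ℝ} (hδ : 0 ≤ δ) (hε0 : 0 < ε) (hε1 : ε < 1)
    (ha : (a : ℝ) / D ≤ 5 * δ / 8) (hg : ε * 2 ^ g ≤ 8) :
    (stepCount a D n g : ℝ) + 1 ≤ 40000 * ((n : ℝ) + 1) ^ 2 * 2 ^ (5 * δ / 8 * n) * (ε ^ 2)⁻¹ := by
  rw [← div_eq_mul_inv, le_div_iff₀ (by positivity)]
  have hn : (0 : ℝ) ≤ n := n.cast_nonneg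
  have hY : (1 : ℝ) ≤ 2 ^ (5 * δ / 8 * n) := Real.one_le_rpow (by norm_num) (by positivity)
  have hY2 : (2 : ℝ) ^ (n * a / D) ≤ 2 ^ (5 * δ / 8 * n) := by
    rw [← Real.rpow_natCast]
    refine Real.rpow_le_rpow_of_exponent_le (by norm_num) ?_
    refine Nat.cast_div_le.trans ?_
    rw [Nat.cast_mul, mul_div_assoc, mul_comm]
    gcongr
  set Y : ℝ := 2 ^ (5 * δ / 8 * n)
  have hε2 : ε ^ 2 ≤ 1 := by nlinarith
  have hM : 1 ≤ ((n : ℝ) + 1) ^ 2 * Y := by nlinarith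
  have key : stepCount a D n g * ε ^ 2 ≤ 32768 * (((n : ℝ) + 1) ^ 2 * Y) := by
    unfold stepCount trialCount
    split_ifs with h
    · have h1 : (2 : ℝ) ^ n ≤ 2 ^ g := pow_le_pow_right₀ (by norm_num) h.le
      have h2 : (2 : ℝ) ^ n * ε ^ 2 ≤ 8 :=
        calc (2 : ℝ) ^ n * ε ^ 2 ≤ 2 ^ g * ε := by gcongr; nlinarith
          _ ≤ 8 := by linarith
      push_cast
      have h3 : ((n : ℝ) + 1) ≤ ((n : ℝ) + 1) ^ 2 * Y := by nlinarith
      calc ((n : ℝ) + n + 3) * (2 : ℝ) ^ n * ε ^ 2 = ((n : ℝ) + n + 3) * ((2 : ℝ) ^ n * ε ^ 2) := by ring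
        _ ≤ (3 * ((n : ℝ) + 1)) * 8 := by gcongr; linarith
        _ ≤ _ := by linarith
    · push_cast
      have h1 : (ε * 2 ^ g) ^ 2 ≤ 64 := by
        have : 0 < ε * 2 ^ g := by positivity
        nlinarith
      calc (4 * (n : ℝ) + 3) * ((n + 1) * 2 ^ (n * a / D + 1 + (g + g) + 6)) * ε ^ 2 =
            (4 * n + 3) * (n + 1) * 2 ^ (n * a / D) * 128 * (ε * 2 ^ g) ^ 2 := by ring
        _ ≤ (4 * (n + 1)) * (n + 1) * Y * 128 * 64 := by gcongr; linarith
        _ = _ := by ring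
  nlinarith

end WordRAM

/-! ### Choice of the constants -/

namespace WordRAM

/-- Nothing is known about the sign of `C`, hence the absolute values; `Real.logb` ignores signs and
vanishes at `0`, so the monotonicity needed for the word length survives. -/
theorem oracleOk_of_runs {k s c d w T₀ : ℕ} {P : Prog} {C β X : ℝ}
    (hP : ∀ (x : SparseInstance k s) (w : ℕ),
      c * Real.logb 2 (x.encode.size + C * ((x.n : ℝ) + 1) ^ d * 2 ^ (β * x.n)) ≤ w →
      ∀ σ : State w, IsInitial x.encode σ →
        ∃ t : ℕ, (t : ℝ) ≤ C * ((x.n : ℝ) + 1) ^ d * 2 ^ (β * x.n) ∧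
          Succeeds P σ t fun σ => (x.Satisfiable → σ.reg 0 = 1) ∧ (¬ x.Satisfiable → σ.reg 0 = 0))
    (I : SparseInstance k s) (hX1 : 1 ≤ X)
    (hX : ((((k + 1) * 2 ^ k * (k + 2) + 5 : ℕ) : ℝ)) * ((I.n : ℝ) + 1) ^ (k + 2) +
      |C| * ((I.n : ℝ) + 1) ^ d * 2 ^ (β * I.n) ≤ X)
    (hw : c * Real.logb 2 X ≤ w) (hw0 : w ≠ 0)
    (hT : |C| * ((I.n : ℝ) + 1) ^ d * 2 ^ (β * I.n) ≤ T₀) :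
    OracleOk w (P.shift 100) T₀ I := by
  intro σ hσ
  have hsize : (I.encode.size : ℝ) ≤
      (((k + 1) * 2 ^ k * (k + 2) + 5 : ℕ) : ℝ) * ((I.n : ℝ) + 1) ^ (k + 2) := by
    exact_mod_cast I.size_encode_le
  have habs : |C * ((I.n : ℝ) + 1) ^ d * 2 ^ (β * I.n)| =
      |C| * ((I.n : ℝ) + 1) ^ d * 2 ^ (β * I.n) := by
    rw [abs_mul, abs_mul, abs_of_nonneg (a := ((I.n : ℝ) + 1) ^ d) (by positivity),
      abs_of_nonneg (a := (2 : ℝ) ^ (β * I.n)) (by positivity)]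
  refine tot_shift (enc := SparseInstance.encode) (L := fun I : SparseInstance k s => I.Satisfiable)
    (T := fun I : SparseInstance k s => C * ((I.n : ℝ) + 1) ^ d * 2 ^ (β * I.n)) hP I ?_ hw0
    ((le_abs_self _).trans (habs.trans_le hT)) hσ
  refine le_trans (mul_le_mul_of_nonneg_left ?_ c.cast_nonneg) hw
  rw [← Real.logb_abs]
  have hle : |(I.encode.size : ℝ) + C * ((I.n : ℝ) + 1) ^ d * 2 ^ (β * I.n)| ≤ X := by
    refine (abs_add_le _ _).trans ?_
    rw [habs, abs_of_nonneg (Nat.cast_nonneg _)]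
    linarith
  rcases (abs_nonneg ((I.encode.size : ℝ) + C * ((I.n : ℝ) + 1) ^ d * 2 ^ (β * I.n))).eq_or_lt
    with h | h
  · rw [← h, Real.logb_zero]
    exact Real.logb_nonneg (by norm_num) hX1
  · exact Real.logb_le_logb_of_le (by norm_num) h hle

/-- The program has to compute an exponent close to `δ n / 2` with integers only, while `δ` is an
arbitrary real number. -/
theorem exists_ratio {x y : ℝ} (h0 : 0 < x) (hxy : x < y) (hy : y ≤ 1) :
    ∃ a D : ℕ, 0 < D ∧ a ≤ D ∧ x ≤ (a : ℝ) / D ∧ (a : ℝ) / D ≤ y := by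
  obtain ⟨r, h1, h2⟩ := exists_rat_btwn hxy
  have hr : 0 < r := by exact_mod_cast h0.trans h1
  have hnum : 0 < r.num := Rat.num_pos.2 hr
  have e : (r : ℝ) = (r.num.toNat : ℝ) / r.den := by
    have h : ((r.num.toNat : ℤ) : ℝ) = r.num := by rw [Int.toNat_of_nonneg hnum.le]
    rw [Int.cast_natCast] at h
    rw [h, Rat.cast_def]
  have hD : (0 : ℝ) < r.den := by exact_mod_cast r.den_pos
  refine ⟨r.num.toNat, r.den, r.den_pos, ?_, by rw [← e]; exact h1.le, by rw [← e]; exact h2.le⟩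
  have : (r.num.toNat : ℝ) / r.den ≤ 1 := by rw [← e]; linarith
  rw [div_le_one hD] at this
  exact_mod_cast this

/-- The running time of the scheme, up to a constant. -/
theorem scheme_time {k s a D d : ℕ} {C β δ : ℝ} (hδ : 0 < δ) (hβ : 0 ≤ β)
    (ha : (a : ℝ) / D ≤ 5 * δ / 8) :
    ∃ K : ℝ, 0 < K ∧ ∀ (n len g T₀ : ℕ) (ε : ℝ), 0 < ε → ε < 1 → ε * 2 ^ g ≤ 8 →
      len ≤ (k + 1) * 2 ^ k * (n + 1) ^ k →
      (T₀ : ℝ) ≤ |C| * ((n : ℝ) + 1) ^ d * 2 ^ (β * n) + 1 →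
      (schemeT len s n (stepCount a D n g) T₀ : ℝ) ≤
        (ε ^ 2)⁻¹ * (K * 2 ^ ((β + 7 * δ / 8) * n)) := by
  obtain ⟨K₁, e, h₁⟩ := schemeT_le (c := (k + 1) * 2 ^ k) (k := k) s
  obtain ⟨K₂, hK₂, h₂⟩ := exists_pow_le (e + 2 + d) (γ := δ / 4) (by positivity)
  refine ⟨(K₁ + 1) * 40000 * (|C| + 2) * K₂, by positivity, fun n len g T₀ ε hε0 hε1 hg hl hT => ?_⟩
  have h3 : (schemeT len s n (stepCount a D n g) T₀ : ℝ) ≤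
      K₁ * ((n : ℝ) + 1) ^ e * ((stepCount a D n g : ℝ) + 1) * ((T₀ : ℝ) + 1) := by
    exact_mod_cast h₁ len n (stepCount a D n g) T₀ hl
  have h4 := stepCount_add_one_le (n := n) hδ.le hε0 hε1 ha hg
  have hn : (0 : ℝ) ≤ n := n.cast_nonneg
  have hone : (1 : ℝ) ≤ ((n : ℝ) + 1) ^ d * 2 ^ (β * n) :=
    one_le_mul_of_one_le_of_one_le (one_le_pow₀ (by linarith))
      (Real.one_le_rpow (by norm_num) (by positivity))
  have h5 : (T₀ : ℝ) + 1 ≤ (|C| + 2) * (((n : ℝ) + 1) ^ d * 2 ^ (β * n)) := by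
    nlinarith
  calc (schemeT len s n (stepCount a D n g) T₀ : ℝ) ≤ _ := h3
    _ ≤ (K₁ + 1) * ((n : ℝ) + 1) ^ e *
        (40000 * ((n : ℝ) + 1) ^ 2 * 2 ^ (5 * δ / 8 * n) * (ε ^ 2)⁻¹) *
        ((|C| + 2) * (((n : ℝ) + 1) ^ d * 2 ^ (β * n))) := by gcongr; linarith
    _ = (ε ^ 2)⁻¹ * ((K₁ + 1) * 40000 * (|C| + 2) * ((n : ℝ) + 1) ^ (e + 2 + d) *
        (2 ^ (5 * δ / 8 * n) * 2 ^ (β * n))) := by ring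
    _ ≤ (ε ^ 2)⁻¹ * ((K₁ + 1) * 40000 * (|C| + 2) * (K₂ * 2 ^ (δ / 4 * n)) *
        (2 ^ (5 * δ / 8 * n) * 2 ^ (β * n))) := by gcongr; exact h₂ n
    _ = _ := by
        rw [show (β + 7 * δ / 8) * (n : ℝ) = δ / 4 * n + (5 * δ / 8 * n + β * n) by ring,
          Real.rpow_add (by norm_num), Real.rpow_add (by norm_num)]
        ring

theorem query_bound {k d : ℕ} {C β δ : ℝ} (hδ : 0 < δ) (hβ : 0 ≤ β) (A : ℝ) (hA : 0 ≤ A) :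
    ∃ K : ℝ, 0 < K ∧ ∀ n : ℕ, A * ((n : ℝ) + 1) ^ (k + 2) +
      |C| * ((n : ℝ) + 1) ^ d * 2 ^ (β * n) ≤ K * 2 ^ ((β + 7 * δ / 8) * n) := by
  obtain ⟨K, hK, h⟩ := exists_pow_le (k + 2 + d) (γ := 7 * δ / 8) (by positivity)
  refine ⟨(A + |C| + 1) * K, by positivity, fun n => ?_⟩
  have hn : (0 : ℝ) ≤ n := n.cast_nonneg
  have hY : (1 : ℝ) ≤ 2 ^ (β * n) := Real.one_le_rpow (by norm_num) (by positivity)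
  have h1 : ((n : ℝ) + 1) ^ (k + 2) ≤ ((n : ℝ) + 1) ^ (k + 2 + d) :=
    pow_le_pow_right₀ (by linarith) (by omega)
  have h2 : ((n : ℝ) + 1) ^ d ≤ ((n : ℝ) + 1) ^ (k + 2 + d) :=
    pow_le_pow_right₀ (by linarith) (by omega)
  calc A * ((n : ℝ) + 1) ^ (k + 2) + |C| * ((n : ℝ) + 1) ^ d * 2 ^ (β * n) ≤
        A * (((n : ℝ) + 1) ^ (k + 2 + d) * 2 ^ (β * n)) +
        |C| * ((n : ℝ) + 1) ^ (k + 2 + d) * 2 ^ (β * n) := by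
        gcongr
        exact h1.trans (le_mul_of_one_le_right (by positivity) hY)
    _ ≤ (A + |C| + 1) * (((n : ℝ) + 1) ^ (k + 2 + d) * 2 ^ (β * n)) := by
        have : 0 ≤ ((n : ℝ) + 1) ^ (k + 2 + d) * 2 ^ (β * n) := by positivity
        linarith
    _ ≤ (A + |C| + 1) * ((K * 2 ^ (7 * δ / 8 * n)) * 2 ^ (β * n)) := by gcongr; exact h n
    _ = _ := by
        rw [show (β + 7 * δ / 8) * (n : ℝ) = 7 * δ / 8 * n + β * n by ring,
          Real.rpow_add (by norm_num)]
        ring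

/-- The word length suffices for the scheme. -/
theorem word_bound {c D s n Y w : ℕ} {δ θ K X : ℝ} (hδ : 0 < δ) (hθ : δ ≤ θ)
    (hK : 4096 * ((D : ℝ) + s + 1) ≤ K) (hX : (Y : ℝ) + K * 2 ^ (θ * n) ≤ X)
    (hc : 6 / δ + 2 ≤ c) (hw : c * Real.logb 2 X ≤ w) :
    2 ^ (6 * n + 12) * (D + s + 1) * Y ≤ wsz w := by
  have hK1 : 1 ≤ K := by
    have : (0 : ℝ) ≤ (D : ℝ) + s := by positivity
    linarith
  have hn : (0 : ℝ) ≤ n := n.cast_nonneg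
  have hZ : (1 : ℝ) ≤ 2 ^ (θ * n) := Real.one_le_rpow (by norm_num) (by
    have := hδ.le.trans hθ
    positivity)
  have hX0 : (Y : ℝ) ≤ X := by nlinarith
  have hX1 : K ≤ X := by nlinarith [Y.cast_nonneg (α := ℝ)]
  have hX2 : (2 : ℝ) ^ (θ * n) ≤ X := by nlinarith [Y.cast_nonneg (α := ℝ)]
  have hone : 1 ≤ X := hK1.trans hX1
  have h6 : (2 : ℝ) ^ (6 * n) ≤ X ^ (6 / δ) := by
    -- The time bound is at least `2 ^ (δ n)` whatever the growth rate is, so a constant of order `6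
    -- / δ` in the word length makes room for numbers of size `2 ^ (6 n)`.
    calc (2 : ℝ) ^ (6 * n) = (2 ^ (δ * n)) ^ (6 / δ) := by
          rw [← Real.rpow_mul (by norm_num), ← Real.rpow_natCast]
          congr 1
          push_cast
          field_simp
      _ ≤ X ^ (6 / δ) := by
          refine Real.rpow_le_rpow (by positivity) (le_trans ?_ hX2) (by positivity)
          exact Real.rpow_le_rpow_of_exponent_le (by norm_num) (by gcongr)
  have h7 : (2 : ℝ) ^ (6 * n + 12) * (D + s + 1) * Y ≤ X ^ c :=
    calc (2 : ℝ) ^ (6 * n + 12) * (D + s + 1) * Y = 2 ^ (6 * n) * (4096 * (D + s + 1)) * Y := by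
          rw [pow_add, show (2 : ℝ) ^ 12 = 4096 by norm_num]; ring
      _ ≤ X ^ (6 / δ) * X * X := by gcongr; exact hK.trans hX1
      _ = X ^ (6 / δ + 2) := by
          rw [Real.rpow_add (by linarith), show (2 : ℝ) = 1 + 1 by norm_num,
            Real.rpow_add (by linarith), Real.rpow_one]
          ring
      _ ≤ X ^ (c : ℝ) := Real.rpow_le_rpow_of_exponent_le hone hc
      _ = X ^ c := Real.rpow_natCast _ _
  have h8 := h7.trans (pow_le_of_logb_le (by linarith) hw)
  exact_mod_cast h8

end WordRAM

/-! ### Assembling the scheme -/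

namespace WordRAM

variable {k : ℕ}

theorem startOk_of_isInitial {w s a D T₀ p q : ℕ} {O : Prog} {x : WithTolerance (CNFInstance k)}
    {σ : State w} (hσ : IsInitial (x.encode CNFInstance.encode) σ)
    (hk : 1 ≤ k) (haD : a ≤ D) (hpq : p ≤ q)
    (hp : p = (Nat.digits 2 x.ε.num.toNat).length) (hq : q = (Nat.digits 2 x.ε.den).length)
    (hW : 2 ^ (6 * x.inst.n + 12) * (D + s + 1) * (x.encode CNFInstance.encode).size ≤ wsz w)
    (horc : ∀ I : SparseInstance k s, I.n = x.inst.n → OracleOk w O T₀ I) :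
    StartOk w O x.inst.F s a D p q (x.encode CNFInstance.encode).size T₀ (view σ) := by
  set E := x.encode CNFInstance.encode with hE
  have e0 : E[0]? = some [x.inst.n] := rfl
  have e1 : E[1]? = some x.inst.F.code := rfl
  have e2 : E[2]? = some (Nat.digits 2 x.ε.num.toNat) := rfl
  have e3 : E[3]? = some (Nat.digits 2 x.ε.den) := rfl
  have hsz : E.size = (x.inst.n + 1) + (lsize x.inst.F.code +
      (lsize (Nat.digits 2 x.ε.num.toNat) + lsize (Nat.digits 2 x.ε.den))) := by
    rw [size_eq]
    show (List.map lsize [[x.inst.n], x.inst.F.code, Nat.digits 2 x.ε.num.toNat,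
      Nat.digits 2 x.ε.den]).sum = _
    simp [lsize_singleton]
  have l1 := length_le_lsize x.inst.F.code
  have l3 := length_le_lsize (Nat.digits 2 x.ε.den)
  have hw : E.size < wsz w := by
    refine lt_of_lt_of_le ?_ hW
    have h1 : 1 < 2 ^ (6 * x.inst.n + 12) := Nat.one_lt_two_pow (by omega)
    have h2 : 2 ^ (6 * x.inst.n + 12) * 1 ≤ 2 ^ (6 * x.inst.n + 12) * (D + s + 1) :=
      Nat.mul_le_mul_left _ (by omega)
    exact lt_mul_of_one_lt_left (by omega) (by omega)
  obtain ⟨-, v0⟩ := view_initial hσ hw (by omega) e0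
  obtain ⟨r1, v1⟩ := view_initial hσ hw (by omega) e1
  obtain ⟨r2, -⟩ := view_initial hσ hw (by omega) e2
  obtain ⟨r3, -⟩ := view_initial hσ hw (by omega) e3
  rw [x.inst.F.code_eq] at r1 v1 l1 hsz
  exact ⟨hk, v0 0 _ rfl, r1, v1, by rw [r2, hp], by rw [r3, hq], hpq, haD, by omega, by omega, hW,
    fun m hm l h j p => horc _ rfl⟩

theorem approx_of_isGood {n L res : ℕ} {F : KCNF k n} {ε : ℚ} (hL : 0 < L)
    (h : F.IsGood (ε : ℝ) L res) :
    (1 - ε) * (F.numSat : ℚ) ≤ (res : ℚ) / L ∧ (res : ℚ) / L ≤ (1 + ε) * (F.numSat : ℚ) := by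
  have hL' : (0 : ℚ) < L := by exact_mod_cast hL
  obtain ⟨h1, h2⟩ := h
  rw [le_div_iff₀ hL', div_le_iff₀ hL', mul_assoc, mul_assoc]
  exact ⟨by exact_mod_cast h1, by exact_mod_cast h2⟩

end WordRAM

open WordRAM in
theorem growthRate_nonneg (k s : ℕ) : 0 ≤ growthRate k s := Real.sInf_nonneg fun _ h => h.1.le

open WordRAM in
theorem mainTheorem2 (k s : ℕ) (hk : 2 ≤ k) (δ : ℝ) (hδ0 : 0 < δ) (hδ1 : δ < 1)
    (hs : 120 * Real.logb 2 (6 / δ) ^ 2 / δ ≤ (s : ℝ)) :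
    ∃ (P : WordRAM.Prog) (C : ℝ),
      WordRAM.IsApproxScheme P CNFInstance.encode (fun F : CNFInstance k => F.count)
        (fun F ε => ((ε : ℝ) ^ 2)⁻¹ * (C * 2 ^ ((growthRate k s + δ) * F.n))) := by
  have hπ := growthRate_nonneg k s
  -- The infimum need not be attained, which costs `δ / 8`. The remaining `7 δ / 8` is split into `5
  -- δ / 8` for the trials and `δ / 4` for polynomial factors; `a / D` lies between the necessary `δ
  -- / 2` and the affordable `5 δ / 8`.
  obtain ⟨β, ⟨hβ0, P₀, C₀, d, c₀, hP⟩, hβ⟩ := exists_lt_of_csInf_lt (exists_decider k s)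
    (show growthRate k s < growthRate k s + δ / 8 by linarith)
  obtain ⟨a, D, hD, haD, ha1, ha2⟩ := exists_ratio (x := δ / 2) (y := 5 * δ / 8) (by linarith)
    (by linarith) (by linarith)
  obtain ⟨K₁, hK₁, htime⟩ := scheme_time (k := k) (s := s) (d := d) (C := C₀) hδ0 hβ0.le ha2
  obtain ⟨K₂, hK₂, hquery⟩ := query_bound (k := k) (d := d) (C := C₀) hδ0 hβ0.le
    (((k + 1) * 2 ^ k * (k + 2) + 5 : ℕ) : ℝ) (Nat.cast_nonneg _)
  -- The three summands serve the running time, the word length demanded by the subroutine, and the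
  -- scheme's own numbers.
  set K : ℝ := K₁ + K₂ + 4096 * ((D : ℝ) + s + 1)
  have hDs : 0 < 4096 * ((D : ℝ) + s + 1) := by positivity
  -- The word-length constant is the one of the subroutine plus what `word_bound` needs.
  refine ⟨schemeP (P₀.shift 100) s a D, K, c₀ + ⌈6 / δ + 2⌉₊, fun x w hw σ hσ => ?_⟩
  set n := x.inst.n
  set θ := growthRate k s + δ with hθ
  have hn : (0 : ℝ) ≤ n := n.cast_nonneg
  have hε0 : (0 : ℝ) < x.ε := by exact_mod_cast x.pos
  have hε1 : (x.ε : ℝ) < 1 := by exact_mod_cast x.lt_one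
  have hexp : (2 : ℝ) ^ ((β + 7 * δ / 8) * n) ≤ 2 ^ (θ * n) :=
    Real.rpow_le_rpow_of_exponent_le (by norm_num) (by gcongr; linarith)
  have hZ : (1 : ℝ) ≤ 2 ^ (θ * n) := Real.one_le_rpow (by norm_num) (by positivity)
  have hKT : K * 2 ^ (θ * n) ≤ ((x.ε : ℝ) ^ 2)⁻¹ * (K * 2 ^ (θ * n)) :=
    le_mul_of_one_le_left (by positivity) (by
      rw [one_le_inv₀ (by positivity)]
      exact pow_le_one₀ hε0.le hε1.le)
  dsimp only at hw ⊢
  set Y := (x.encode CNFInstance.encode).size with hY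
  set T : ℝ := ((x.ε : ℝ) ^ 2)⁻¹ * (K * 2 ^ (θ * n))
  have hX1 : 1 ≤ (Y : ℝ) + T := by
    have h1 : 1 ≤ K := by
      have : (0 : ℝ) ≤ (D : ℝ) + s := by positivity
      linarith
    have h2 : (0 : ℝ) ≤ Y := Y.cast_nonneg
    nlinarith
  have hlogX : 0 ≤ Real.logb 2 ((Y : ℝ) + T) := Real.logb_nonneg (by norm_num) hX1
  have hW : 2 ^ (6 * n + 12) * (D + s + 1) * Y ≤ wsz w := by
    refine word_bound (c := c₀ + ⌈6 / δ + 2⌉₊) (K := K) hδ0 (show δ ≤ θ by linarith) (by linarith)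
      (add_le_add_right hKT _) ?_ hw
    push_cast
    exact (Nat.le_ceil _).trans (le_add_of_nonneg_left c₀.cast_nonneg)
  obtain ⟨hpq, hg1, hg2⟩ := x.bounds rfl rfl
  set p := (Nat.digits 2 x.ε.num.toNat).length with hp
  set q := (Nat.digits 2 x.ε.den).length with hq
  set T₀ := ⌈|C₀| * ((n : ℝ) + 1) ^ d * 2 ^ (β * n)⌉₊ with hT₀
  have hYn : 1 ≤ Y := by
    have : lsize [n] ≤ Y := lsize_le_size (i := 0) rfl
    rw [lsize_singleton] at this
    omega
  have hw0 : w ≠ 0 := by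
    rintro rfl
    have : 2 ^ (6 * n + 12) * 1 * 1 ≤ wsz 0 := le_trans (by gcongr; omega) hW
    rw [wsz, pow_zero, mul_one, mul_one] at this
    exact absurd (Nat.one_lt_two_pow (n := 6 * n + 12) (by omega)) (by omega)
  have hS : StartOk w (P₀.shift 100) x.inst.F s a D p q Y T₀ (view σ) := by
    refine startOk_of_isInitial hσ (by omega) haD hpq rfl rfl hW fun I hI => ?_
    refine oracleOk_of_runs hP I hX1 ?_ (le_trans ?_ hw) hw0 ?_
    · rw [hI]
      refine (hquery n).trans ?_
      have h1 : K₂ * 2 ^ ((β + 7 * δ / 8) * n) ≤ K * 2 ^ (θ * n) := by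
        gcongr
        linarith
      have h2 : (0 : ℝ) ≤ Y := Y.cast_nonneg
      linarith
    · push_cast
      exact mul_le_mul_of_nonneg_right (le_add_of_nonneg_right (Nat.cast_nonneg _)) hlogX
    · rw [hI]
      exact Nat.le_ceil _
  have hlen : (codeL x.inst.F.codes).length ≤ (k + 1) * 2 ^ k * (n + 1) ^ k := by
    rw [← x.inst.F.code_eq]
    exact x.inst.F.length_code_le'
  refine ⟨schemeT (codeL x.inst.F.codes).length s n (stepCount a D n (q - p + 2)) T₀, ?_, ?_⟩
  · refine (htime n _ _ _ _ hε0 hε1 hg2 hlen ((Nat.ceil_lt_add_one (by positivity)).le)).trans ?_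
    show _ ≤ ((x.ε : ℝ) ^ 2)⁻¹ * (K * 2 ^ (θ * n))
    exact mul_le_mul_of_nonneg_left (mul_le_mul (by linarith) hexp (by positivity) (by positivity))
      (by positivity)
  · refine succeeds_of_tot (tot_schemeP hS) (ewp_schemeP hδ0 hδ1 hε0 hε1 hs hS fun h =>
      le_trialCount hD ha1 hg1 h) ?_
    rintro σ' ⟨h1, h2⟩
    have hL : 0 < trialCount a D n (q - p + 2) := by
      unfold trialCount
      split_ifs
      · exact one_pos
      · positivity
    have e0 : (view σ').reg 0 = (σ'.reg 0).toNat := by simp [view, IsTemp]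
    have e1 : (view σ').reg 1 = (σ'.reg 1).toNat := by simp [view, IsTemp]
    rw [e0] at h1
    rw [e1] at h2
    rw [h2]
    exact ⟨hL.ne', approx_of_isGood hL h1⟩
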